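/- **Theorem (magnetization of the four-spin model).** For $\beta>0$, $h\in\mathbb R$ and $n\ge 1$ let $\mu_n$ be the probability measure on $\{-1,1\}^n$ with $$\mu_n(\omega)\propto \exp\Big(\frac{\beta}{n^3}\sum_{i,j,k,l=1}^n\omega_i\omega_j\omega_k\omega_l+\frac hn\sum_{i,j=1}^n\omega_i\omega_j\Big),$$ let $M_n=\omega_1+\dots+\omega_n$ be the magnetization, and let $A:[0,1]\to\mathbb R$, $$A(a)=\beta(2a-1)^4+h(2a-1)^2-a\log a-(1-a)\log(1-a).$$ Let $d_W(X,Y)=\sup\{|\mathbb E f(X)-\mathbb E f(Y)|: f \text{ 1-Lipschitz}\}$ be the Wasserstein distance. A maximizer $a\in(0,1)$ of $A$ is called $2$-regular if $A'(a)=0$ and $A''(a)<0$. Let $S\subset(0,1)$ be a finite set of $2$-regular maximizers of $A$. Put $$p_a=\frac{r_a}{\sum_{b\in S}r_b},\qquad r_a=\frac{1}{\sqrt{a(1-a)}}\int_{\mathbb R}e^{A''(a)x^2/2}\,dx \qquad(a\in S).$$ Call $\delta>0$ *isolating* for $S$ if the intervals $(2a-1-\delta,2a-1+\delta)$, $a\in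 S$, are pairwise disjoint. We say that *the magnetization is concentrated around the points $2a-1$, $a\in S$*, if * $M_n/n$ converges in law to $\sum_{a\in S}p_a\delta_{2a-1}$; * for every $\delta>0$ there is $c>0$ with $\mu_n(|M_n/n-(2a-1)|>\delta\ \forall a\in S)\le e^{-cn}$ for all large $n$; * for every isolating $\delta$ and every $a\in S$, $\mu_n(|M_n/n-(2a-1)|\le\delta)=p_a+O((\log n)^3/\sqrt n)$. We say that *the conditional central limit theorems around these points hold* if for every isolating $\delta$ and every $a\in S$, conditionally on $|M_n/n-(2a-1)|\le\delta$, * the law of $n^{-1/2}(M_n-n(2a-1))$ has Wasserstein distance $O(n^{-1/2})$ from $N(0,-4/A''(a))$, and * for every integer $l\ge0$ the conditional expectation of $|M_n/n-(2a-1)|^l$ is $O(n^{-l/2})$. The constants in all $O(\cdot)$ terms do not depend on $n$. There is a function $g:(0,\infty)\to\mathbb R$ with $g(\beta)=1/2$ for $0<\beta\le 1/12$ such that the following holds for all $\beta>0$ and $h\in\mathbb R$. 1. If $h<g(\beta)$ (region $R_1$), then $1/2$ is the unique maximizer of $A$ and is $2$-regular. The magnetization is concentrated around $0$, and the (conditional)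 central limit theorem around $0$ holds with $S=\{1/2\}$. Unconditionally, $d_W\big(n^{-1/2}M_n,\,N(0,-4/A''(1/2))\big)=O(n^{-1/2})$. 2. If $h>g(\beta)$ (region $R_2$), then $A$ has exactly two maximizers $a_\pm$, where $0<a_-<1/2<a_+<1$, and both are $2$-regular. The magnetization is concentrated around the two points $2a_--1$, $2a_+-1$, and the conditional central limit theorems around these points hold. 3. If $\beta>1/12$ and $h=g(\beta)$ (region $R_3$), then $A$ has exactly three maximizers $a_-,1/2,a_+$, where $0<a_-<1/2<a_+<1$, and all are $2$-regular. The magnetization is concentrated around the three points $2a_--1$, $0$, $2a_+-1$, and the conditional central limit theorems around these points hold. 4. If $0<\beta<1/12$ and $h=1/2$ (region $R_4$), then $A^{(4)}(1/2)<0$ and $$d_W\big(n^{-3/4}M_n,\,Y\big)=O(n^{-1/4}),\qquad Y\text{ with density}\propto\exp\Big(\frac{A^{(4)}(1/2)\,x^4}{2^4\,4!}\Big).$$ 5. If $(\beta,h)=(1/12,1/2)$, then $A^{(6)}(1/2)<0$ and $$d_W\big(n^{-5/6}M_n,\,Y\big)=O(n^{-1/4}),\qquad Y\text{ with density}\propto\exp\Big(\frac{A^{(6)}(1/2)\,x^6}{2^6\,6!}\Big).$$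 -/

import Mathlib

open MeasureTheory ProbabilityTheory Filter Topology
open scoped ENNReal BoundedContinuousFunction

noncomputable section

/-- The Wasserstein distance `sup |∫ f dμ - ∫ f dν|` over all 1-Lipschitz `f : ℝ → ℝ`, for
probability measures on `ℝ` with finite first moment. -/
def wassersteinDist (μ ν : Measure ℝ) : ℝ≥0∞ :=
  ⨆ (f : ℝ → ℝ) (_ : LipschitzWith 1 f), ENNReal.ofReal |∫ x, f x ∂μ - ∫ x, f x ∂ν|

/-- The probability law on `ℝ` whose Lebesgue density is proportional to `exp (c * x ^ k)`
(for `c < 0` and `k` even and positive). -/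
def expPowerLaw (c : ℝ) (k : ℕ) : Measure ℝ :=
  (volume : Measure ℝ).tilted fun x => c * x ^ k

namespace FourSpin

/-- Spin configurations; `ℤˣ = {1, -1}`. -/
abbrev Config (n : ℕ) : Type := Fin n → ℤˣ

instance : MeasurableSingletonClass ℤˣ where
  measurableSet_singleton a :=
    ⟨{(a : ℤ)}, MeasurableSet.singleton _, by ext b; simp [Units.ext_iff]⟩

/-- The spin at site `i`, as a real number. -/
def spin {n : ℕ} (ω : Config n) (i : Fin n) : ℝ := ((ω i : ℤ) : ℝ)

/-- The magnetization `M_n = ω_1 + ... + ω_n`. -/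
def magnetization {n : ℕ} (ω : Config n) : ℝ := ∑ i, spin ω i

/-- The Hamiltonian mixing four-spin and two-spin interactions. -/
def hamiltonian (n : ℕ) (β h : ℝ) (ω : Config n) : ℝ :=
  β / (n : ℝ) ^ 3 * (∑ i, ∑ j, ∑ k, ∑ l, spin ω i * spin ω j * spin ω k * spin ω l)
    + h / (n : ℝ) * (∑ i, ∑ j, spin ω i * spin ω j)

/-- The Hamiltonian as a function of the mean magnetization. -/
lemma hamiltonian_eq (n : ℕ) (hn : n ≠ 0) (β h : ℝ) (ω : Config n) :
    hamiltonian n β h ω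
      = n * (β * (magnetization ω / n) ^ 4 + h * (magnetization ω / n) ^ 2) := by
  have hn' : (n : ℝ) ≠ 0 := by exact_mod_cast hn
  simp only [hamiltonian, magnetization, ← Finset.mul_sum, ← Finset.sum_mul]
  field_simp

/-- The Gibbs measure `μ_n(ω) ∝ exp (H_n(ω))` on configurations. -/
def gibbs (n : ℕ) (β h : ℝ) : Measure (Config n) :=
  (Measure.count : Measure (Config n)).tilted (hamiltonian n β h)

instance (n : ℕ) (β h : ℝ) : IsProbabilityMeasure (gibbs n β h) :=
  isProbabilityMeasure_tilted (Integrable.of_finite)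

/-- The associated function `A(a) = β (2a - 1)^4 + h (2a - 1)^2 + I(a)`, with the entropy
`I(a) = - a log a - (1 - a) log (1 - a)`. -/
def assoc (β h a : ℝ) : ℝ :=
  β * (2 * a - 1) ^ 4 + h * (2 * a - 1) ^ 2 + Real.binEntropy a

/-- The set of maximizers of `A` on `[0, 1]`. -/
def maximizers (β h : ℝ) : Set ℝ :=
  {a | a ∈ Set.Icc (0 : ℝ) 1 ∧ IsMaxOn (assoc β h) (Set.Icc 0 1) a}

/-- The maximizer `a` is 2-regular: `A'(a) = 0` and `A''(a) < 0`. -/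
def TwoRegular (β h a : ℝ) : Prop :=
  iteratedDeriv 1 (assoc β h) a = 0 ∧ iteratedDeriv 2 (assoc β h) a < 0

/-- The unnormalized asymptotic weight of the 2-regular maximizer `a`:
`∫ exp (A''(a) x² / 2) dx / √(a (1 - a))`. -/
def rawWeight (β h a : ℝ) : ℝ :=
  (∫ x : ℝ, Real.exp (iteratedDeriv 2 (assoc β h) a / 2 * x ^ 2)) / √(a * (1 - a))

/-- The asymptotic weight of `a` among the finite set `S` of 2-regular maximizers. -/
def weight (β h : ℝ) (S : Finset ℝ) (a : ℝ) : ℝ :=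
  rawWeight β h a / ∑ b ∈ S, rawWeight β h b

/-- The radius `δ` isolates the points `2a - 1`, `a ∈ S`, from each other. -/
def Isolates (S : Finset ℝ) (δ : ℝ) : Prop :=
  0 < δ ∧ (S : Set ℝ).PairwiseDisjoint fun a => Set.Ioo (2 * a - 1 - δ) (2 * a - 1 + δ)

/-- The event `|M_n / n - (2a - 1)| ≤ δ`. -/
def near (n : ℕ) (a δ : ℝ) : Set (Config n) :=
  {ω | |magnetization ω / n - (2 * a - 1)| ≤ δ}

/-- Concentration of the magnetization around the points `2a - 1`, `a ∈ S`: the law of `M_n / n`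
converges weakly to `∑ a ∈ S, weight a • δ_{2a - 1}`; the probability that `M_n / n` is away from
all these points is exponentially small; and the probability of being near one of them converges
to its weight with rate `(log n)^3 / √n`. -/
def ConcentratesAround (β h : ℝ) (S : Finset ℝ) : Prop :=
  (∀ f : ℝ →ᵇ ℝ, Tendsto (fun n : ℕ => ∫ ω : Config n, f (magnetization ω / n) ∂(gibbs n β h))
      atTop (𝓝 (∑ a ∈ S, weight β h S a * f (2 * a - 1)))) ∧
  (∀ δ : ℝ, 0 < δ → ∃ c : ℝ, 0 < c ∧ ∀ᶠ n : ℕ in atTop,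
      (gibbs n β h).real {ω : Config n | ∀ a ∈ S, δ < |magnetization ω / n - (2 * a - 1)|}
        ≤ Real.exp (-c * n)) ∧
  (∀ δ : ℝ, Isolates S δ → ∀ a ∈ S, ∃ C : ℝ, ∀ᶠ n : ℕ in atTop,
      |(gibbs n β h).real (near n a δ) - weight β h S a| ≤ C * (Real.log n ^ 3 / √n))

/-- The law of `n ^ (-r) (M_n - n (2a - 1))` under a measure `μ` on configurations. -/
def scaledLaw {n : ℕ} (μ : Measure (Config n)) (r a : ℝ) : Measure ℝ :=
  μ.map fun ω => (n : ℝ) ^ (-r) * (magnetization ω - n * (2 * a - 1))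

/-- The limiting centred normal law of `n ^ (-1/2) (M_n - n (2a - 1))` near a 2-regular
maximizer `a`, with variance `-4 / A''(a)`; its density is proportional to
`exp (A''(a) x² / 8)`. -/
def limitGaussian (β h a : ℝ) : Measure ℝ :=
  gaussianReal 0 (-4 / iteratedDeriv 2 (assoc β h) a).toNNReal

/-- Conditional central limit theorems around the points `2a - 1`, `a ∈ S`, with Wasserstein
distance `O(1/√n)`, together with the conditional moment bounds. -/
def ConditionalCLT (β h : ℝ) (S : Finset ℝ) : Prop :=
  ∀ δ : ℝ, Isolates S δ → ∀ a ∈ S,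
    (∀ l : ℕ, ∃ C : ℝ, ∀ᶠ n : ℕ in atTop,
      ∫ ω : Config n, |magnetization ω / n - (2 * a - 1)| ^ l ∂((gibbs n β h)[|near n a δ])
        ≤ C * (n : ℝ) ^ (-(l : ℝ) / 2)) ∧
    (∃ C : ℝ, ∀ᶠ n : ℕ in atTop,
      wassersteinDist (scaledLaw ((gibbs n β h)[|near n a δ]) (1 / 2) a) (limitGaussian β h a)
        ≤ ENNReal.ofReal (C / √n))

end FourSpin

end

namespace FourSpin

/-! ### The associated function and its derivatives -/

/-! The energy depends only on the number `k` of positive spins. By Stirling, the level `k` has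
weight about `exp (n A(x)) / √(2 π n x (1 - x))` with `x = k / n`. The theorem therefore splits into
finding the maximizers of `A` and running Laplace's method on the lattice of the `k / n`, uniformly
over 1-Lipschitz observables.

Maximizers. With `m = 2 a - 1`, the power series of the entropy gives `A(a) - log 2 = (h - 1/2) m² +
(β - 1/12) m⁴ - m⁶/30 - ...`, all further coefficients being negative. Whether some `a` beats `1/2`
is thus a threshold condition on `h`. The critical field `g(β)` is the infimum of the thresholds,
including their limit `1/2` as `m → 0`. It equals `1/2` for `β ≤ 1/12`. For `β > 1/12` it is smaller
and is attained away from `1/2` (`exists_quotient_eq_critField`), which produces three maximizers.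
Moreover `A'(a) / (2 m)` is a strictly concave function of `m²`; its tangent lines
(`tangent_inequality`) show that at most one maximizer exceeds `1/2` and that it is 2-regular. The
symmetry `a ↦ 1 - a` gives the rest.

Laplace's method. Suppose `A(a + t) = A(a) - c t^(2q) + O(|t|^(2q+e))`, and put `N = n^(1/(2q))`, `y
= 2 N (k/n - a)`. The weight divided by `peak` is `exp (-c (y/2)^(2q))` up to `O(N^(-e) exp (-|y|))`
(`exists_window_bound`). Viewing the lattice sum as the integral of a step function compares it with
the limit integral at the same rate (`exists_lattice_sum_sub_integral_le`), and levels away from the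
maximizers are exponentially negligible. Quotients of such sums give the Wasserstein bounds
(`exists_nearSum_ratio_le`). Comparing masses at different maximizers, where `exp (n A)` is common,
gives the limit weights (`exists_mass_le`, `exists_total_le`).

A 2-regular maximizer has `q = e = 1`. At the degenerate points `q` is 2 or 3, and evenness around
`1/2` allows `e = 2`. -/

lemma iteratedDeriv_eq_of_hasDerivAt {D : ℕ → ℝ → ℝ} {s : Set ℝ} (hs : IsOpen s) (N : ℕ)
    (hD : ∀ j < N, ∀ x ∈ s, HasDerivAt (D j) (D (j + 1) x) x) :
    ∀ j ≤ N, ∀ x ∈ s, iteratedDeriv j (D 0) x = D j x := by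
  intro j
  induction j with
  | zero => intro _ x _; simp
  | succ j ih =>
    intro hj x hx
    rw [iteratedDeriv_succ]
    have : iteratedDeriv j (D 0) =ᶠ[𝓝 x] D j := by
      filter_upwards [hs.mem_nhds hx] with y hy using ih (by omega) y hy
    rw [this.deriv_eq]
    exact (hD j (by omega) x hx).deriv

/-- The successive derivatives of `assoc β h` on `(0, 1)`, up to order six. -/
noncomputable def assocDeriv (β h : ℝ) : ℕ → ℝ → ℝ
  | 0 => assoc β h
  | 1 => fun a => 8 * β * (2 * a - 1) ^ 3 + 4 * h * (2 * a - 1) + (Real.log (1 - a) - Real.log a)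
  | 2 => fun a => 48 * β * (2 * a - 1) ^ 2 + 8 * h - (a⁻¹ + (1 - a)⁻¹)
  | 3 => fun a => 192 * β * (2 * a - 1) + ((a ^ 2)⁻¹ - ((1 - a) ^ 2)⁻¹)
  | 4 => fun a => 384 * β - 2 * ((a ^ 3)⁻¹ + ((1 - a) ^ 3)⁻¹)
  | 5 => fun a => 6 * ((a ^ 4)⁻¹ - ((1 - a) ^ 4)⁻¹)
  | _ => fun a => -24 * ((a ^ 5)⁻¹ + ((1 - a) ^ 5)⁻¹)

lemma hasDerivAt_inv_pow (k : ℕ) {a : ℝ} (ha : a ≠ 0) :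
    HasDerivAt (fun x : ℝ => (x ^ (k + 1))⁻¹) (-(k + 1) * (a ^ (k + 2))⁻¹) a := by
  refine ((hasDerivAt_pow (k + 1) a).inv (pow_ne_zero _ ha)).congr_deriv ?_
  simp only [Nat.add_sub_cancel]
  push_cast
  field_simp
  ring

lemma hasDerivAt_inv_one_sub_pow (k : ℕ) {a : ℝ} (ha : 1 - a ≠ 0) :
    HasDerivAt (fun x : ℝ => ((1 - x) ^ (k + 1))⁻¹) ((k + 1) * ((1 - a) ^ (k + 2))⁻¹) a :=
  ((hasDerivAt_inv_pow k ha).comp a ((hasDerivAt_id a).const_sub 1)).congr_deriv (by simp; ring)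

lemma hasDerivAt_two_mul_sub_one (a : ℝ) : HasDerivAt (fun x : ℝ => 2 * x - 1) 2 a :=
  (((hasDerivAt_id a).const_mul 2).sub_const 1).congr_deriv (by simp)

lemma hasDerivAt_two_mul_sub_one_pow (k : ℕ) (a : ℝ) :
    HasDerivAt (fun x : ℝ => (2 * x - 1) ^ (k + 1)) (2 * (k + 1) * (2 * a - 1) ^ k) a := by
  refine ((hasDerivAt_two_mul_sub_one a).pow (k + 1)).congr_deriv ?_
  simp only [Nat.add_sub_cancel]
  push_cast
  ring

lemma hasDerivAt_assocDeriv (β h : ℝ) {a : ℝ} (ha0 : 0 < a) (ha1 : a < 1) :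
    ∀ j < 6, HasDerivAt (assocDeriv β h j) (assocDeriv β h (j + 1) a) a := by
  have h0 : a ≠ 0 := ha0.ne'
  have h1 : 1 - a ≠ 0 := by linarith
  have P := fun k => hasDerivAt_two_mul_sub_one_pow k a
  have P0 := hasDerivAt_two_mul_sub_one a
  have I := fun k => hasDerivAt_inv_pow k h0
  have J := fun k => hasDerivAt_inv_one_sub_pow k h1
  have S : HasDerivAt (fun x : ℝ => 1 - x) (-1) a := (hasDerivAt_id a).const_sub 1
  intro j hj
  interval_cases j
  · refine ((((P 3).const_mul β).add ((P 1).const_mul h)).add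
      (Real.hasDerivAt_binEntropy h0 ha1.ne)).congr_deriv ?_
    simp only [assocDeriv]; push_cast; ring
  · refine ((((P 2).const_mul (8 * β)).add (P0.const_mul (4 * h))).add
      ((S.log h1).sub ((hasDerivAt_id' a).log h0))).congr_deriv ?_
    simp only [assocDeriv]; push_cast; field_simp; ring
  · refine ((((P 1).const_mul (48 * β)).add_const (8 * h)).sub
      ((hasDerivAt_inv h0).add (S.inv h1))).congr_deriv ?_
    simp only [assocDeriv]; push_cast; field_simp; ring
  · refine ((P0.const_mul (192 * β)).add ((I 1).sub (J 1))).congr_deriv ?_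
    simp only [assocDeriv]; push_cast; ring
  · refine ((((I 2).add (J 2)).const_mul 2).const_sub (384 * β)).congr_deriv ?_
    simp only [assocDeriv]; push_cast; ring
  · refine (((I 3).sub (J 3)).const_mul 6).congr_deriv ?_
    simp only [assocDeriv]; push_cast; ring

lemma iteratedDeriv_assoc (β h : ℝ) {a : ℝ} (ha0 : 0 < a) (ha1 : a < 1) {j : ℕ} (hj : j ≤ 6) :
    iteratedDeriv j (assoc β h) a = assocDeriv β h j a :=
  iteratedDeriv_eq_of_hasDerivAt (D := assocDeriv β h) isOpen_Ioo 6
    (fun j hj _ hx => hasDerivAt_assocDeriv β h hx.1 hx.2 j hj) j hj a ⟨ha0, ha1⟩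

lemma iteratedDeriv_two_assoc_half (β h : ℝ) :
    iteratedDeriv 2 (assoc β h) (1 / 2) = 8 * (h - 1 / 2) := by
  rw [iteratedDeriv_assoc β h (by norm_num) (by norm_num) (by norm_num)]
  simp only [assocDeriv]; norm_num; ring

lemma iteratedDeriv_four_assoc_half (β h : ℝ) :
    iteratedDeriv 4 (assoc β h) (1 / 2) = 384 * (β - 1 / 12) := by
  rw [iteratedDeriv_assoc β h (by norm_num) (by norm_num) (by norm_num)]
  simp only [assocDeriv]; norm_num; ring

lemma iteratedDeriv_six_assoc_half (β h : ℝ) :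
    iteratedDeriv 6 (assoc β h) (1 / 2) = -1536 := by
  rw [iteratedDeriv_assoc β h (by norm_num) (by norm_num) (by norm_num)]
  simp only [assocDeriv]; norm_num

lemma twoRegular_iff {β h a : ℝ} (ha0 : 0 < a) (ha1 : a < 1) :
    TwoRegular β h a ↔ assocDeriv β h 1 a = 0 ∧ assocDeriv β h 2 a < 0 := by
  rw [TwoRegular, iteratedDeriv_assoc β h ha0 ha1 (by norm_num),
    iteratedDeriv_assoc β h ha0 ha1 (by norm_num)]

lemma assoc_one_sub (β h a : ℝ) : assoc β h (1 - a) = assoc β h a := by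
  simp only [assoc, Real.binEntropy_one_sub]; ring

lemma assoc_half (β h : ℝ) : assoc β h (1 / 2) = Real.log 2 := by
  have := Real.binEntropy_two_inv
  simp only [assoc, one_div, this]; norm_num

lemma continuous_assoc (β h : ℝ) : Continuous (assoc β h) := by
  unfold assoc
  fun_prop

lemma hasDerivAt_assoc (β h : ℝ) {a : ℝ} (ha0 : 0 < a) (ha1 : a < 1) :
    HasDerivAt (assoc β h) (assocDeriv β h 1 a) a :=
  hasDerivAt_assocDeriv β h ha0 ha1 0 (by norm_num)

/-! ### Power series -/

/-- The left side is `(m/2) (log (1+m) - log (1-m)) + (1/2) log (1-m²)`; the coefficients combine by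
`1/(2k+1) - 1/(2k+2)`. Their positivity makes every truncation a one-sided bound. -/
lemma hasSum_log_two_sub_binEntropy {m : ℝ} (hm : |m| < 1) :
    HasSum (fun k : ℕ => m ^ (2 * (k + 1)) / ((2 * k + 2) * (2 * k + 1)))
      (Real.log 2 - Real.binEntropy ((1 + m) / 2)) := by
  obtain ⟨hm1, hm2⟩ := abs_lt.1 hm
  have h1 := (Real.hasSum_log_sub_log_of_abs_lt_one hm).mul_left (m / 2)
  have hs : |m ^ 2| < 1 := by rw [abs_pow]; exact pow_lt_one₀ (abs_nonneg _) hm (by norm_num)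
  have h2 := (Real.hasSum_pow_div_log_of_abs_lt_one hs).mul_left (-1 / 2)
  have h3 := h1.add h2
  have e1 : (fun k : ℕ => m ^ (2 * (k + 1)) / ((2 * (k : ℝ) + 2) * (2 * k + 1))) = fun b : ℕ =>
      m / 2 * (2 * (1 / (2 * (b : ℝ) + 1)) * m ^ (2 * b + 1))
        + -1 / 2 * ((m ^ 2) ^ (b + 1) / ((b : ℝ) + 1)) := by
    ext k
    have : (2 * (k : ℝ) + 1) ≠ 0 := by positivity
    have : ((k : ℝ) + 1) ≠ 0 := by positivity
    field_simp
    ring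
  have e2 : Real.log 2 - Real.binEntropy ((1 + m) / 2) =
      m / 2 * (Real.log (1 + m) - Real.log (1 - m)) + -1 / 2 * -Real.log (1 - m ^ 2) := by
    have e : (1 : ℝ) - m ^ 2 = (1 + m) * (1 - m) := by ring
    rw [e, Real.log_mul (by linarith) (by linarith), Real.binEntropy,
      show 1 - (1 + m) / 2 = (1 - m) / 2 by ring, Real.log_inv, Real.log_inv,
      Real.log_div (by linarith) (by norm_num), Real.log_div (by linarith) (by norm_num)]
    ring
  rwa [e1, e2]

lemma log_two_sub_binEntropy_ge {a : ℝ} (ha : a ∈ Set.Icc (0 : ℝ) 1) :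
    (2 * a - 1) ^ 2 / 2 + (2 * a - 1) ^ 4 / 12 + (2 * a - 1) ^ 6 / 30
      ≤ Real.log 2 - Real.binEntropy a := by
  -- The endpoints `|m| = 1` lie outside the disc of the series; there the claim is `1/2 + 1/12 +
  -- 1/30 ≤ log 2`.
  have l2 := Real.log_two_gt_d9
  rcases eq_or_lt_of_le ha.1 with h0 | h0
  · subst h0; norm_num at l2 ⊢; linarith
  rcases eq_or_lt_of_le ha.2 with h1 | h1
  · subst h1; norm_num at l2 ⊢; linarith
  have hs := hasSum_log_two_sub_binEntropy (m := 2 * a - 1) (abs_lt.2 ⟨by linarith, by linarith⟩)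
  rw [show (1 + (2 * a - 1)) / 2 = a by ring] at hs
  have := sum_le_hasSum (Finset.range 3) (fun k _ => by rw [pow_mul]; positivity) hs
  simp only [Finset.sum_range_succ, Finset.sum_range_zero] at this
  norm_num at this
  linarith

lemma log_two_sub_binEntropy_le {a : ℝ} (ha : (2 * a - 1) ^ 2 ≤ 1 / 2) :
    Real.log 2 - Real.binEntropy a ≤
      (2 * a - 1) ^ 2 / 2 + (2 * a - 1) ^ 4 / 12 + (2 * a - 1) ^ 6 / 30 + (2 * a - 1) ^ 8 := by
  set m := 2 * a - 1 with hm
  have hm1 : |m| < 1 := by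
    rw [← sq_lt_one_iff_abs_lt_one]; linarith
  have hs := hasSum_log_two_sub_binEntropy hm1
  rw [show (1 + m) / 2 = a by rw [hm]; ring] at hs
  have hs' := (hasSum_nat_add_iff' 3).2 hs
  -- The tail coefficients are crudely at most `1/2`, which cancels `(1 - m²)⁻¹ ≤ 2` and leaves
  -- `m⁸`.
  have hg := (hasSum_geometric_of_lt_one (sq_nonneg m) (by linarith)).mul_left (m ^ 8 / 2)
  have := hasSum_le (fun k => ?_) hs' hg
  · have h2 : (1 - m ^ 2)⁻¹ ≤ 2 := by
      rw [inv_le_comm₀ (by linarith) (by norm_num)]; linarith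
    have h8 : 0 ≤ m ^ 8 / 2 := by positivity
    have := this.trans (mul_le_mul_of_nonneg_left h2 h8)
    simp only [Finset.sum_range_succ, Finset.sum_range_zero] at this
    norm_num at this
    linarith
  · have e : m ^ (2 * (k + 3 + 1)) = m ^ 8 * (m ^ 2) ^ k := by
      rw [← pow_mul, ← pow_add]; congr 1; omega
    rw [e, div_mul_eq_mul_div]
    have : 0 ≤ m ^ 8 * (m ^ 2) ^ k := by positivity
    apply div_le_div_of_nonneg_left this (by norm_num)
    push_cast
    nlinarith [(Nat.cast_nonneg k : (0 : ℝ) ≤ k)]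

/-- Bernoulli's inequality for `s / t`, that is, convexity of `s ↦ s ^ k` at `t`. Writing the slope
as `k * t ^ k / t` avoids the exponent `k - 1`. -/
lemma one_sub_mul_le_pow_sub (k : ℕ) {s t : ℝ} (hs : 0 ≤ s) (ht : 0 < t) :
    0 ≤ s ^ k - t ^ k - k * t ^ k / t * (s - t) := by
  have h := one_add_mul_le_pow (a := s / t - 1) (by have := div_nonneg hs ht.le; linarith) k
  have e : s ^ k = t ^ k * (1 + (s / t - 1)) ^ k := by
    rw [← mul_pow]; congr 1; field_simp; ring
  have := mul_le_mul_of_nonneg_left h (pow_pos ht k).le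
  rw [e]
  have e2 : (k : ℝ) * t ^ k / t * (s - t) = t ^ k * (k * (s / t - 1)) := by field_simp
  rw [e2]
  linarith

/-- The tangent line inequality for `A'(a) / (2a - 1)`, a strictly concave function of
`(2a - 1) ^ 2`. -/
lemma tangent_inequality (β h : ℝ) {m m₀ : ℝ} (hm0 : 0 < m) (hm1 : m < 1) (hm₀0 : 0 < m₀)
    (hm₀1 : m₀ < 1) (hne : m ≠ m₀) (hz : assocDeriv β h 1 ((1 + m₀) / 2) = 0) :
    assocDeriv β h 1 ((1 + m) / 2) / (2 * m) <
      assocDeriv β h 2 ((1 + m₀) / 2) / (8 * m₀ ^ 2) * (m ^ 2 - m₀ ^ 2) := by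
  have hs : ∀ x : ℝ, 0 < x → x < 1 → HasSum (fun k : ℕ => (x ^ 2) ^ k / (2 * k + 1))
      (4 * β * x ^ 2 + 2 * h - assocDeriv β h 1 ((1 + x) / 2) / (2 * x)) := by
    intro x hx0 hx1
    have := (Real.hasSum_log_sub_log_of_abs_lt_one
      (show |x| < 1 by rwa [abs_of_pos hx0])).mul_left (1 / (2 * x))
    have e1 : (fun k : ℕ => (x ^ 2) ^ k / (2 * (k : ℝ) + 1)) = fun i : ℕ =>
        1 / (2 * x) * (2 * (1 / (2 * (i : ℝ) + 1)) * x ^ (2 * i + 1)) := by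
      ext k
      have : (2 * (k : ℝ) + 1) ≠ 0 := by positivity
      field_simp
      ring
    have e2 : 4 * β * x ^ 2 + 2 * h - assocDeriv β h 1 ((1 + x) / 2) / (2 * x)
        = 1 / (2 * x) * (Real.log (1 + x) - Real.log (1 - x)) := by
      simp only [assocDeriv]
      rw [show 1 - (1 + x) / 2 = (1 - x) / 2 by ring,
        Real.log_div (by linarith) (by norm_num), Real.log_div (by linarith) (by norm_num)]
      field_simp
      ring
    rwa [e1, e2]
  have hg := hasSum_geometric_of_lt_one (sq_nonneg m₀) (by nlinarith)
  have h1 := hs m hm0 hm1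
  have h2 := hs m₀ hm₀0 hm₀1
  -- The `k`-th term is the tangent gap of `s ↦ s ^ k` between `m²` and `m₀²`, divided by `2k + 1`.
  -- All gaps are nonnegative, and the one for `k = 2` is `(m² - m₀²)² / 5 > 0`.
  have hk := (h1.sub h2).sub ((hg.sub h2).mul_left ((m ^ 2 - m₀ ^ 2) / (2 * m₀ ^ 2)))
  have hpos := hasSum_lt (i := 2) (fun k => ?_) ?_ hasSum_zero hk
  · rw [hz] at hpos
    have e : assocDeriv β h 2 ((1 + m₀) / 2)
        = 48 * β * m₀ ^ 2 + 8 * h - 4 * (1 - m₀ ^ 2)⁻¹ := by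
      have a1 : (1 + m₀) ≠ 0 := by linarith
      have a2 : (1 - m₀) ≠ 0 := by linarith
      have a3 : 1 - m₀ ^ 2 ≠ 0 := by nlinarith
      simp only [assocDeriv]
      rw [show 1 - (1 + m₀) / 2 = (1 - m₀) / 2 by ring]
      rw [show (1 - m₀ ^ 2) = (1 - m₀) * (1 + m₀) by ring]
      field_simp
      ring
    rw [e]
    have e3 : (48 * β * m₀ ^ 2 + 8 * h - 4 * (1 - m₀ ^ 2)⁻¹) / (8 * m₀ ^ 2) * (m ^ 2 - m₀ ^ 2)
        = 4 * β * (m ^ 2 - m₀ ^ 2) - (m ^ 2 - m₀ ^ 2) / (2 * m₀ ^ 2) *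
          ((1 - m₀ ^ 2)⁻¹ - (4 * β * m₀ ^ 2 + 2 * h - 0 / (2 * m₀))) := by
      field_simp
      ring
    rw [e3]
    simp only [zero_div, sub_zero] at hpos ⊢
    linarith
  · have := one_sub_mul_le_pow_sub k (sq_nonneg m) (show 0 < m₀ ^ 2 by positivity)
    have hk : (0 : ℝ) < 2 * k + 1 := by positivity
    have := div_nonneg this hk.le
    convert this using 1
    field_simp
    ring
  · have : 0 < (m ^ 2 - m₀ ^ 2) ^ 2 / 5 := by
      have : m ^ 2 - m₀ ^ 2 ≠ 0 := by
        intro h0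
        apply hne
        nlinarith
      positivity
    refine lt_of_lt_of_eq this ?_
    push_cast
    field_simp
    ring

/-! ### Maximizers -/

lemma maximizers_one_sub {β h a : ℝ} (ha : a ∈ maximizers β h) : 1 - a ∈ maximizers β h := by
  refine ⟨⟨by linarith [ha.1.2], by linarith [ha.1.1]⟩, fun b hb => ?_⟩
  rw [Set.mem_ofPred_eq, assoc_one_sub]
  exact ha.2 hb

lemma maximizers_nonempty (β h : ℝ) : (maximizers β h).Nonempty := by
  obtain ⟨a, ha, hm⟩ := isCompact_Icc.exists_isMaxOn (Set.nonempty_Icc.2 zero_le_one)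
    (continuous_assoc β h).continuousOn
  exact ⟨a, ha, hm⟩

/-- The entropy has infinite slope at the endpoint. Moving inwards by `ε` gains more than `ε log
(1/ε)`, while the polynomial part loses at most `(8 |β| + 4 |h|) ε`; `ε = exp (-L - 1)` makes the
gain win. -/
lemma one_notMem_maximizers (β h : ℝ) : (1 : ℝ) ∉ maximizers β h := by
  intro hmax
  set L := 8 * |β| + 4 * |h| with hL
  have hL0 : 0 ≤ L := by positivity
  set ε := Real.exp (-L - 1) with hε
  have hε0 : 0 < ε := Real.exp_pos _
  have hε1 : ε < 1 := by rw [hε, Real.exp_lt_one_iff]; linarith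
  have hlog : Real.log ε = -L - 1 := Real.log_exp _
  have hlt : 0 < Real.log (1 - ε)⁻¹ :=
    Real.log_pos ((one_lt_inv₀ (by linarith)).2 (by linarith))
  have h1 := hmax.2 (show 1 - ε ∈ Set.Icc (0 : ℝ) 1 from ⟨by linarith, by linarith⟩)
  simp only [assoc, Set.mem_ofPred_eq, Real.binEntropy_one_sub, Real.binEntropy_one] at h1
  rw [Real.binEntropy, Real.log_inv ε, hlog] at h1
  have h2 : 0 < (1 - ε) * Real.log (1 - ε)⁻¹ := mul_pos (by linarith) hlt
  set m := 2 * (1 - ε) - 1 with hm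
  have hm1 : |m| ≤ 1 := abs_le.2 ⟨by linarith, by linarith⟩
  have hq : 1 - m ^ 2 ≤ 4 * ε := by nlinarith
  have hm2 : m ^ 2 ≤ 1 := by rw [← sq_abs]; exact pow_le_one₀ (abs_nonneg _) hm1
  have hb : β * (1 - m ^ 4) ≤ |β| * (8 * ε) := by
    have : 1 - m ^ 4 ≤ 8 * ε := by nlinarith [sq_nonneg m]
    have h0 : 0 ≤ 1 - m ^ 4 := by nlinarith [sq_nonneg m]
    exact (mul_le_mul_of_nonneg_right (le_abs_self β) h0).trans
      (mul_le_mul_of_nonneg_left this (abs_nonneg β))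
  have hh : h * (1 - m ^ 2) ≤ |h| * (4 * ε) :=
    (mul_le_mul_of_nonneg_right (le_abs_self h) (by linarith)).trans
      (mul_le_mul_of_nonneg_left hq (abs_nonneg h))
  nlinarith

lemma mem_Ioo_of_mem_maximizers {β h a : ℝ} (ha : a ∈ maximizers β h) : 0 < a ∧ a < 1 := by
  constructor
  · refine lt_of_le_of_ne ha.1.1 fun h0 => one_notMem_maximizers β h ?_
    simpa [← h0] using maximizers_one_sub ha
  · refine lt_of_le_of_ne ha.1.2 fun h0 => one_notMem_maximizers β h ?_
    rwa [← h0]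

lemma assocDeriv_one_eq_zero {β h a : ℝ} (ha : a ∈ maximizers β h) : assocDeriv β h 1 a = 0 := by
  obtain ⟨h0, h1⟩ := mem_Ioo_of_mem_maximizers ha
  exact (ha.2.isLocalMax (Icc_mem_nhds h0 h1)).hasDerivAt_eq_zero (hasDerivAt_assoc β h h0 h1)

/-- If `A''(a) ≥ 0`, the tangent at the zero `a` of the concave function has nonnegative slope, so
`A' < 0` on `(1/2, a)`. Then `A(1/2) > A(a)`, against maximality. -/
lemma assocDeriv_two_neg {β h a : ℝ} (ha : a ∈ maximizers β h) (hgt : 1 / 2 < a) :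
    assocDeriv β h 2 a < 0 := by
  by_contra! hd
  obtain ⟨h0, h1⟩ := mem_Ioo_of_mem_maximizers ha
  have hneg : ∀ x ∈ Set.Ioo (1 / 2) a, assocDeriv β h 1 x < 0 := by
    intro x hx
    have hz := assocDeriv_one_eq_zero ha
    have hx0 : 0 < 2 * x - 1 := by linarith [hx.1]
    have ht := tangent_inequality β h (m := 2 * x - 1) (m₀ := 2 * a - 1) hx0
      (by linarith [hx.2]) (by linarith) (by linarith) (by intro h; linarith [hx.2])
      (by rwa [show (1 + (2 * a - 1)) / 2 = a by ring])
    rw [show (1 + (2 * a - 1)) / 2 = a by ring, show (1 + (2 * x - 1)) / 2 = x by ring] at ht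
    have h2 : (2 * x - 1) ^ 2 - (2 * a - 1) ^ 2 ≤ 0 := by nlinarith [hx.2]
    have := ht.trans_le (mul_nonpos_of_nonneg_of_nonpos (div_nonneg hd (by positivity)) h2)
    rwa [div_lt_iff₀ (by linarith), zero_mul] at this
  have hanti : StrictAntiOn (assoc β h) (Set.Icc (1 / 2) a) := by
    refine strictAntiOn_of_deriv_neg (convex_Icc _ _) (continuous_assoc β h).continuousOn ?_
    intro x hx
    rw [interior_Icc] at hx
    rw [(hasDerivAt_assoc β h (by linarith [hx.1]) (by linarith [hx.2])).deriv]
    exact hneg x hx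
  have := hanti (Set.left_mem_Icc.2 hgt.le) (Set.right_mem_Icc.2 hgt.le) hgt
  have h3 := ha.2 (show (1 / 2 : ℝ) ∈ Set.Icc (0 : ℝ) 1 by norm_num)
  simp only [Set.mem_ofPred_eq] at h3
  linarith

/-- The tangent at `a` has negative slope, so `A'` is strictly negative beyond `a` and cannot vanish
at `b > a`. -/
lemma maximizers_le_of_half_lt {β h a b : ℝ} (ha : a ∈ maximizers β h) (hb : b ∈ maximizers β h)
    (ha2 : 1 / 2 < a) (hb2 : 1 / 2 < b) : b ≤ a := by
  by_contra! hlt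
  have a1 := (mem_Ioo_of_mem_maximizers ha).2
  have b1 := (mem_Ioo_of_mem_maximizers hb).2
  have ht := tangent_inequality β h (m := 2 * b - 1) (m₀ := 2 * a - 1) (by linarith)
    (by linarith) (by linarith) (by linarith) (by intro h; linarith)
    (by rw [show (1 + (2 * a - 1)) / 2 = a by ring]; exact assocDeriv_one_eq_zero ha)
  rw [show (1 + (2 * a - 1)) / 2 = a by ring, show (1 + (2 * b - 1)) / 2 = b by ring,
    assocDeriv_one_eq_zero hb, zero_div] at ht
  have h2 : 0 ≤ (2 * b - 1) ^ 2 - (2 * a - 1) ^ 2 := by nlinarith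
  have := mul_nonpos_of_nonpos_of_nonneg
    (div_nonpos_of_nonpos_of_nonneg (assocDeriv_two_neg ha ha2).le
      (show 0 ≤ 8 * (2 * a - 1) ^ 2 by positivity)) h2
  linarith

lemma assocDeriv_two_one_sub (β h a : ℝ) : assocDeriv β h 2 (1 - a) = assocDeriv β h 2 a := by
  simp only [assocDeriv, sub_sub_cancel]; ring

/-- A maximizer other than `1 / 2` is, up to the symmetry `a ↦ 1 - a`, the only one, and it is
2-regular. -/
lemma exists_maximizer_pair {β h a : ℝ} (ha : a ∈ maximizers β h) (hne : a ≠ 1 / 2) :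
    ∃ ap, 1 / 2 < ap ∧ ap < 1 ∧ ap ∈ maximizers β h ∧ 1 - ap ∈ maximizers β h ∧
      TwoRegular β h ap ∧ TwoRegular β h (1 - ap) ∧
      ∀ b ∈ maximizers β h, b = 1 - ap ∨ b = 1 / 2 ∨ b = ap := by
  obtain ⟨ap, hap, hgt⟩ : ∃ ap ∈ maximizers β h, 1 / 2 < ap := by
    rcases lt_or_gt_of_ne hne with h1 | h1
    · exact ⟨1 - a, maximizers_one_sub ha, by linarith⟩
    · exact ⟨a, ha, h1⟩
  have h1 := (mem_Ioo_of_mem_maximizers hap).2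
  have hap' := maximizers_one_sub hap
  refine ⟨ap, hgt, h1, hap, hap', ?_, ?_, ?_⟩
  · rw [twoRegular_iff (by linarith) h1]
    exact ⟨assocDeriv_one_eq_zero hap, assocDeriv_two_neg hap hgt⟩
  · rw [twoRegular_iff (by linarith) (by linarith)]
    exact ⟨assocDeriv_one_eq_zero hap', by
      rw [assocDeriv_two_one_sub]; exact assocDeriv_two_neg hap hgt⟩
  · intro b hb
    rcases lt_trichotomy b (1 / 2) with hb2 | hb2 | hb2
    · have hb' := maximizers_one_sub hb
      have e1 := maximizers_le_of_half_lt hap hb' hgt (by linarith)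
      have e2 := maximizers_le_of_half_lt hb' hap (by linarith) hgt
      left; linarith
    · exact Or.inr (Or.inl hb2)
    · exact Or.inr (Or.inr (le_antisymm (maximizers_le_of_half_lt hap hb hgt hb2)
        (maximizers_le_of_half_lt hb hap hb2 hgt)))

/-! ### The critical line -/

/-- The set whose infimum is the critical field. -/
def fieldSet (β : ℝ) : Set ℝ :=
  insert (1 / 2) {x | ∃ a ∈ Set.Icc (0 : ℝ) 1, a ≠ 1 / 2 ∧
    x = (Real.log 2 - Real.binEntropy a - β * (2 * a - 1) ^ 4) / (2 * a - 1) ^ 2}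

/-- The critical field: for `h` below it, `1 / 2` is the unique maximizer of `assoc β h`. -/
noncomputable def critField (β : ℝ) : ℝ := sInf (fieldSet β)

lemma sq_pos_of_ne_half {a : ℝ} (ha : a ≠ 1 / 2) : 0 < (2 * a - 1) ^ 2 := by
  have : 2 * a - 1 ≠ 0 := fun h => ha (by linarith)
  positivity

lemma sq_le_one_of_mem {a : ℝ} (ha : a ∈ Set.Icc (0 : ℝ) 1) : (2 * a - 1) ^ 2 ≤ 1 := by
  nlinarith [ha.1, ha.2]

/-- Source of the value `1/12`: the threshold field starts as `1/2 - (β - 1/12) m²`, and the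
remaining terms of the series only raise it. -/
lemma half_sub_le_quotient {β a : ℝ} (ha : a ∈ Set.Icc (0 : ℝ) 1) (hne : a ≠ 1 / 2) :
    1 / 2 - (β - 1 / 12) * (2 * a - 1) ^ 2
      ≤ (Real.log 2 - Real.binEntropy a - β * (2 * a - 1) ^ 4) / (2 * a - 1) ^ 2 := by
  have hp := sq_pos_of_ne_half hne
  rw [le_div_iff₀ hp]
  have := log_two_sub_binEntropy_ge ha
  have : 0 ≤ (2 * a - 1) ^ 6 / 30 := by positivity
  nlinarith

lemma bddBelow_fieldSet {β : ℝ} (hβ : 0 < β) : BddBelow (fieldSet β) := by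
  refine ⟨-β, ?_⟩
  rintro x (rfl | ⟨a, ha, hne, rfl⟩)
  · linarith
  · have := half_sub_le_quotient (β := β) ha hne
    have h2 := sq_le_one_of_mem ha
    nlinarith [sq_nonneg (2 * a - 1)]

lemma critField_le_half {β : ℝ} (hβ : 0 < β) : critField β ≤ 1 / 2 :=
  csInf_le (bddBelow_fieldSet hβ) (Set.mem_insert _ _)

lemma critField_le_quotient {β a : ℝ} (hβ : 0 < β) (ha : a ∈ Set.Icc (0 : ℝ) 1)
    (hne : a ≠ 1 / 2) : critField β
      ≤ (Real.log 2 - Real.binEntropy a - β * (2 * a - 1) ^ 4) / (2 * a - 1) ^ 2 :=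
  csInf_le (bddBelow_fieldSet hβ) (Set.mem_insert_of_mem _ ⟨a, ha, hne, rfl⟩)

lemma critField_eq_half {β : ℝ} (hβ : 0 < β) (hβ' : β ≤ 1 / 12) : critField β = 1 / 2 := by
  refine le_antisymm (critField_le_half hβ) (le_csInf ⟨_, Set.mem_insert _ _⟩ ?_)
  rintro x (rfl | ⟨a, ha, hne, rfl⟩)
  · exact le_rfl
  · have := half_sub_le_quotient (β := β) ha hne
    nlinarith [sq_nonneg (2 * a - 1)]

/-- `A(a)` is affine in `h` with slope `(2 a - 1)² > 0`, so beating `A(1/2) = log 2` is a threshold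
condition on `h`. -/
lemma assoc_lt_iff {β h a : ℝ} (hne : a ≠ 1 / 2) : assoc β h a < Real.log 2 ↔
    h < (Real.log 2 - Real.binEntropy a - β * (2 * a - 1) ^ 4) / (2 * a - 1) ^ 2 := by
  rw [lt_div_iff₀ (sq_pos_of_ne_half hne), assoc]
  constructor <;> intro h <;> linarith

lemma assoc_le_iff {β h a : ℝ} (hne : a ≠ 1 / 2) : assoc β h a ≤ Real.log 2 ↔
    h ≤ (Real.log 2 - Real.binEntropy a - β * (2 * a - 1) ^ 4) / (2 * a - 1) ^ 2 := by
  rw [le_div_iff₀ (sq_pos_of_ne_half hne), assoc]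
  constructor <;> intro h <;> linarith

lemma assoc_lt_of_lt_critField {β h a : ℝ} (hβ : 0 < β) (hh : h < critField β)
    (ha : a ∈ Set.Icc (0 : ℝ) 1) (hne : a ≠ 1 / 2) : assoc β h a < Real.log 2 :=
  (assoc_lt_iff hne).2 (hh.trans_le (critField_le_quotient hβ ha hne))

/-- At `h = 1/2` the quadratic terms cancel and the quartic one is nonpositive; the sextic term
keeps the inequality strict even at `β = 1/12`. -/
lemma assoc_lt_of_le_one_twelfth {β a : ℝ} (hβ : β ≤ 1 / 12) (ha : a ∈ Set.Icc (0 : ℝ) 1)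
    (hne : a ≠ 1 / 2) : assoc β (1 / 2) a < Real.log 2 := by
  have := log_two_sub_binEntropy_ge ha
  have hp := sq_pos_of_ne_half hne
  have h6 : 0 < (2 * a - 1) ^ 6 / 30 := by
    rw [show (2 * a - 1) ^ 6 = ((2 * a - 1) ^ 2) ^ 3 by ring]; positivity
  have h4 : 0 ≤ (2 * a - 1) ^ 4 := by positivity
  rw [assoc]
  nlinarith

lemma maximizers_eq_singleton {β h : ℝ}
    (hlt : ∀ a ∈ Set.Icc (0 : ℝ) 1, a ≠ 1 / 2 → assoc β h a < Real.log 2) :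
    maximizers β h = {1 / 2} := by
  have hmem : (1 / 2 : ℝ) ∈ Set.Icc (0 : ℝ) 1 := by norm_num
  ext a
  rw [Set.mem_singleton_iff]
  constructor
  · intro ha
    by_contra hne
    have h1 := ha.2 hmem
    rw [Set.mem_ofPred_eq, assoc_half] at h1
    exact absurd (hlt a ha.1 hne) (not_lt.2 h1)
  · rintro rfl
    refine ⟨hmem, fun b hb => ?_⟩
    rw [Set.mem_ofPred_eq, assoc_half]
    by_cases hb2 : b = 1 / 2
    · rw [hb2, assoc_half]
    · exact (hlt b hb hb2).le

/-- A small test value of `m` suffices, since the threshold is at most `1/2 - (β - 1/12) m² + 2 m⁴`.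
For `y > 1/2` all corrections are small; for `β > 1/12` the negative quadratic term dominates. -/
lemma exists_lt_quotient_lt {β y : ℝ} (hβ : 0 < β) (hy : 1 / 2 < y ∨ (1 / 12 < β ∧ 1 / 2 ≤ y)) :
    ∃ a ∈ Set.Icc (0 : ℝ) 1, a ≠ 1 / 2 ∧
      (Real.log 2 - Real.binEntropy a - β * (2 * a - 1) ^ 4) / (2 * a - 1) ^ 2 < y := by
  have key : ∀ m : ℝ, 0 < m → m ≤ 1 / 2 → 1 / 2 - (β - 1 / 12) * m ^ 2 + 2 * m ^ 4 < y →
      ∃ a ∈ Set.Icc (0 : ℝ) 1, a ≠ 1 / 2 ∧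
      (Real.log 2 - Real.binEntropy a - β * (2 * a - 1) ^ 4) / (2 * a - 1) ^ 2 < y := by
    intro m hm0 hm1 hm
    refine ⟨(1 + m) / 2, ⟨by linarith, by linarith⟩, by intro h; linarith, ?_⟩
    have := log_two_sub_binEntropy_le (a := (1 + m) / 2) (by nlinarith)
    rw [show 2 * ((1 + m) / 2) - 1 = m by ring] at this ⊢
    rw [div_lt_iff₀ (by positivity)]
    have h2 : m ^ 8 ≤ m ^ 6 := pow_le_pow_of_le_one hm0.le (by linarith) (by norm_num)
    have h6 : 0 ≤ m ^ 6 := by positivity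
    nlinarith [mul_lt_mul_of_pos_right hm (show 0 < m ^ 2 by positivity)]
  rcases hy with hy | ⟨hβ', hy⟩
  · have hpos : 0 < min (1 / 2) ((y - 1 / 2) / 2) := lt_min (by norm_num) (by linarith)
    refine key _ hpos (min_le_left _ _) ?_
    set m := min (1 / 2) ((y - 1 / 2) / 2)
    have h1 : m ≤ 1 / 2 := min_le_left _ _
    have h2 : m ≤ (y - 1 / 2) / 2 := min_le_right _ _
    have h3 : m ^ 2 ≤ 1 / 4 := by nlinarith
    have h4 : m ^ 2 ≤ m / 2 := by nlinarith
    nlinarith [mul_pos hβ (show 0 < m ^ 2 by positivity)]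
  · have hpos : 0 < min (1 / 2) ((β - 1 / 12) / 2) := lt_min (by norm_num) (by linarith)
    refine key _ hpos (min_le_left _ _) ?_
    set m := min (1 / 2) ((β - 1 / 12) / 2)
    have h1 : m ≤ 1 / 2 := min_le_left _ _
    have h2 : m ≤ (β - 1 / 12) / 2 := min_le_right _ _
    have h4 : 2 * m ^ 2 < β - 1 / 12 := by nlinarith
    nlinarith [mul_pos (sub_pos.2 h4) (show 0 < m ^ 2 by positivity)]

lemma exists_log_two_lt_assoc {β h : ℝ} (hβ : 0 < β) (hh : critField β < h) :
    ∃ a ∈ Set.Icc (0 : ℝ) 1, Real.log 2 < assoc β h a := by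
  obtain ⟨a, ha, hne, hlt⟩ : ∃ a ∈ Set.Icc (0 : ℝ) 1, a ≠ 1 / 2 ∧
      (Real.log 2 - Real.binEntropy a - β * (2 * a - 1) ^ 4) / (2 * a - 1) ^ 2 < h := by
    obtain ⟨x, hx, hxh⟩ := exists_lt_of_csInf_lt ⟨_, Set.mem_insert _ _⟩ hh
    rcases hx with rfl | ⟨a, ha, hne, rfl⟩
    · exact exists_lt_quotient_lt hβ (Or.inl hxh)
    · exact ⟨a, ha, hne, hxh⟩
  exact ⟨a, ha, not_le.1 fun h' => absurd ((assoc_le_iff hne).1 h') (not_le.2 hlt)⟩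

lemma critField_lt_half {β : ℝ} (hβ : 1 / 12 < β) : critField β < 1 / 2 := by
  obtain ⟨a, ha, hne, hlt⟩ := exists_lt_quotient_lt (β := β) (y := 1 / 2) (by linarith)
    (Or.inr ⟨hβ, le_rfl⟩)
  exact (critField_le_quotient (by linarith) ha hne).trans_lt hlt

/-- The infimum lies strictly below the limiting value `1/2`, so a minimizing sequence cannot
approach `a = 1/2`, and compactness of the rest of the interval gives a minimizer. -/
lemma exists_quotient_eq_critField {β : ℝ} (hβ : 1 / 12 < β) :
    ∃ a ∈ Set.Icc (0 : ℝ) 1, a ≠ 1 / 2 ∧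
      (Real.log 2 - Real.binEntropy a - β * (2 * a - 1) ^ 4) / (2 * a - 1) ^ 2
        = critField β := by
  have hβ0 : 0 < β := by linarith
  have hg := critField_lt_half hβ
  obtain ⟨a₁, ha₁, hne₁, hlt₁⟩ := exists_lt_quotient_lt (β := β) (y := 1 / 2) hβ0
    (Or.inr ⟨hβ, le_rfl⟩)
  set Q : ℝ → ℝ := fun a =>
    (Real.log 2 - Real.binEntropy a - β * (2 * a - 1) ^ 4) / (2 * a - 1) ^ 2 with hQ
  -- For `m² < ε` the bound `Q a ≥ 1/2 - β m²` already exceeds `Q a₁`, so this neighbourhood of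
  -- `1/2` can be removed.
  set ε := (1 / 2 - Q a₁) / β with hε
  have hε0 : 0 < ε := div_pos (sub_pos.2 hlt₁) hβ0
  have hout : ∀ a ∈ Set.Icc (0 : ℝ) 1, a ≠ 1 / 2 → (2 * a - 1) ^ 2 < ε → Q a₁ < Q a := by
    intro a ha hne hlt
    have h1 := half_sub_le_quotient (β := β) ha hne
    rw [hε, lt_div_iff₀ hβ0] at hlt
    have h2 := sq_pos_of_ne_half hne
    change Q a₁ < Q a
    change 1 / 2 - (β - 1 / 12) * (2 * a - 1) ^ 2 ≤ Q a at h1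
    nlinarith
  set K := Set.Icc (0 : ℝ) 1 ∩ {a | ε ≤ (2 * a - 1) ^ 2} with hK
  have hKc : IsCompact K := isCompact_Icc.inter_right
    (isClosed_le continuous_const (by fun_prop))
  have hKne : ∀ a ∈ K, a ≠ 1 / 2 := by
    rintro a ⟨_, ha⟩ rfl
    have : ε ≤ (2 * (1 / 2) - 1) ^ 2 := ha
    norm_num at this
    linarith
  have ha₁K : a₁ ∈ K := ⟨ha₁, not_lt.1 fun h => lt_irrefl _ (hout a₁ ha₁ hne₁ h)⟩
  have hQc : ContinuousOn Q K := by
    refine ContinuousOn.div (by fun_prop) (by fun_prop) fun a ha => ?_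
    exact (sq_pos_of_ne_half (hKne a ha)).ne'
  obtain ⟨a, haK, hmin⟩ := hKc.exists_isMinOn ⟨a₁, ha₁K⟩ hQc
  refine ⟨a, haK.1, hKne a haK, le_antisymm ?_ (critField_le_quotient hβ0 haK.1 (hKne a haK))⟩
  have hle₁ : Q a ≤ Q a₁ := hmin ha₁K
  refine le_csInf ⟨_, Set.mem_insert _ _⟩ ?_
  rintro x (rfl | ⟨b, hb, hne, rfl⟩)
  · exact hle₁.trans hlt₁.le
  · by_cases hbε : (2 * b - 1) ^ 2 < ε
    · exact hle₁.trans (hout b hb hne hbε).le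
    · exact hmin (show b ∈ K from ⟨hb, not_lt.1 hbε⟩)

lemma maximizers_of_lt_critField {β h : ℝ} (hβ : 0 < β) (hh : h < critField β) :
    maximizers β h = {1 / 2} ∧ TwoRegular β h (1 / 2) := by
  have hmax := maximizers_eq_singleton fun a ha hne => assoc_lt_of_lt_critField hβ hh ha hne
  refine ⟨hmax, ?_⟩
  have hmem : (1 / 2 : ℝ) ∈ maximizers β h := by rw [hmax]; rfl
  rw [TwoRegular, iteratedDeriv_assoc β h (by norm_num) (by norm_num) (by norm_num),
    iteratedDeriv_two_assoc_half]
  exact ⟨assocDeriv_one_eq_zero hmem, by linarith [critField_le_half hβ]⟩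

lemma maximizers_of_critField_lt {β h : ℝ} (hβ : 0 < β) (hh : critField β < h) :
    ∃ ap, 1 / 2 < ap ∧ ap < 1 ∧ maximizers β h = {1 - ap, ap} ∧
      TwoRegular β h (1 - ap) ∧ TwoRegular β h ap := by
  obtain ⟨b, hb, hblt⟩ := exists_log_two_lt_assoc hβ hh
  have hhalf : (1 / 2 : ℝ) ∉ maximizers β h := by
    intro hm
    have := hm.2 hb
    rw [Set.mem_ofPred_eq, assoc_half] at this
    linarith
  obtain ⟨a, ha⟩ := maximizers_nonempty β h
  obtain ⟨ap, h1, h2, h3, h4, h5, h6, h7⟩ := exists_maximizer_pair ha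
    (fun h => hhalf (h ▸ ha))
  refine ⟨ap, h1, h2, ?_, h6, h5⟩
  ext c
  simp only [Set.mem_insert_iff, Set.mem_singleton_iff]
  constructor
  · intro hc
    rcases h7 c hc with h | h | h
    · exact Or.inl h
    · exact absurd (h ▸ hc) hhalf
    · exact Or.inr h
  · rintro (rfl | rfl) <;> assumption

lemma maximizers_of_eq_critField {β : ℝ} (hβ : 1 / 12 < β) :
    ∃ ap, 1 / 2 < ap ∧ ap < 1 ∧ maximizers β (critField β) = {1 - ap, 1 / 2, ap} ∧
      TwoRegular β (critField β) (1 - ap) ∧ TwoRegular β (critField β) (1 / 2) ∧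
      TwoRegular β (critField β) ap := by
  set h := critField β with hh
  have hβ0 : 0 < β := by linarith
  have hle : ∀ a ∈ Set.Icc (0 : ℝ) 1, assoc β h a ≤ Real.log 2 := by
    intro a ha
    by_cases hne : a = 1 / 2
    · rw [hne, assoc_half]
    · exact (assoc_le_iff hne).2 (critField_le_quotient hβ0 ha hne)
  have hmem : ∀ a ∈ Set.Icc (0 : ℝ) 1, assoc β h a = Real.log 2 → a ∈ maximizers β h := by
    intro a ha he
    refine ⟨ha, fun b hb => ?_⟩
    rw [Set.mem_ofPred_eq, he]
    exact hle b hb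
  have hhalf : (1 / 2 : ℝ) ∈ maximizers β h := hmem _ (by norm_num) (assoc_half β h)
  obtain ⟨a, ha, hne, he⟩ := exists_quotient_eq_critField hβ
  have haM : a ∈ maximizers β h := hmem a ha <| le_antisymm (hle a ha) <| not_lt.1 fun hlt =>
    absurd ((assoc_lt_iff hne).1 hlt) (by rw [he]; exact lt_irrefl _)
  obtain ⟨ap, h1, h2, h3, h4, h5, h6, h7⟩ := exists_maximizer_pair haM hne
  refine ⟨ap, h1, h2, ?_, h6, ?_, h5⟩
  · ext c
    simp only [Set.mem_insert_iff, Set.mem_singleton_iff]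
    exact ⟨h7 c, by rintro (rfl | rfl | rfl) <;> assumption⟩
  · rw [TwoRegular, iteratedDeriv_assoc β h (by norm_num) (by norm_num) (by norm_num),
      iteratedDeriv_two_assoc_half]
    exact ⟨assocDeriv_one_eq_zero hhalf, by linarith [critField_lt_half hβ]⟩

/-! ### Binomial coefficients -/

/-- The decrements of `log (stirlingSeq n)` are at most `1/(12 n (n+1))`, which telescopes:
subtracting `1/(12 n)` gives a monotone sequence with limit `log √π`. The shift `j + 1` avoids the
junk value at `0`. -/
lemma log_stirlingSeq_sub_le {n : ℕ} (hn : n ≠ 0) :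
    Real.log (Stirling.stirlingSeq n) - Real.log (√Real.pi) ≤ 1 / (12 * n) := by
  set f : ℕ → ℝ := fun j => Real.log (Stirling.stirlingSeq (j + 1)) - 1 / (12 * ((j : ℝ) + 1))
    with hf
  have hmono : Monotone f := monotone_nat_of_le_succ fun j => by
    have := Stirling.log_stirlingSeq_sdiff_le (j + 1)
    have e : (1 : ℝ) / (12 * ((j + 1 : ℕ) : ℝ) * (((j + 1 : ℕ) : ℝ) + 1))
        = 1 / (12 * ((j : ℝ) + 1)) - 1 / (12 * (((j + 1 : ℕ) : ℝ) + 1)) := by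
      push_cast
      field_simp
      ring
    simp only [hf]
    linarith
  have hlim : Tendsto f atTop (𝓝 (Real.log (√Real.pi) - 0)) := by
    refine Tendsto.sub ?_ ?_
    · exact ((Real.continuousAt_log (by positivity)).tendsto.comp
        (Stirling.tendsto_stirlingSeq_sqrt_pi)).comp (tendsto_add_atTop_nat 1)
    · have := (tendsto_one_div_add_atTop_nhds_zero_nat (𝕜 := ℝ)).const_mul (1 / 12)
      rw [mul_zero] at this
      refine this.congr fun j => ?_
      field_simp
  have := hmono.ge_of_tendsto hlim (n - 1)
  have e : n - 1 + 1 = n := Nat.sub_add_cancel (Nat.one_le_iff_ne_zero.2 hn)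
  simp only [hf, e] at this
  rw [show ((n - 1 : ℕ) : ℝ) + 1 = n by exact_mod_cast e] at this
  linarith

lemma log_stirlingSeq_sub_nonneg {n : ℕ} (hn : n ≠ 0) :
    0 ≤ Real.log (Stirling.stirlingSeq n) - Real.log (√Real.pi) :=
  sub_nonneg.2 (Real.log_le_log (by positivity) (Stirling.sqrt_pi_le_stirlingSeq hn))

lemma abs_log_choose_sub_le {n k : ℕ} (hk : 0 < k) (hkn : k < n) :
    |Real.log (n.choose k) - (n * Real.binEntropy (k / n)
        - Real.log (2 * Real.pi * n * ((k / n : ℝ) * (1 - k / n))) / 2)|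
      ≤ 1 / (12 * n) + 1 / (12 * k) + 1 / (12 * (n - k : ℝ)) := by
  obtain ⟨j, rfl⟩ := Nat.exists_eq_add_of_lt hkn
  obtain ⟨l, hl⟩ : ∃ l, l = j + 1 := ⟨_, rfl⟩
  rw [show k + j + 1 = k + l by omega]
  have hl0 : 0 < l := by omega
  have hk' : (0 : ℝ) < k := by exact_mod_cast hk
  have hl' : (0 : ℝ) < l := by exact_mod_cast hl0
  have f1 := Stirling.log_stirlingSeq_formula k
  have f2 := Stirling.log_stirlingSeq_formula l
  have f3 := Stirling.log_stirlingSeq_formula (k + l)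
  have b1 := log_stirlingSeq_sub_le hk.ne'
  have b2 := log_stirlingSeq_sub_le hl0.ne'
  have b3 := log_stirlingSeq_sub_le (n := k + l) (by omega)
  have c1 := log_stirlingSeq_sub_nonneg hk.ne'
  have c2 := log_stirlingSeq_sub_nonneg hl0.ne'
  have c3 := log_stirlingSeq_sub_nonneg (n := k + l) (by omega)
  have hch : Real.log ((k + l).choose k)
      = Real.log (k + l).factorial - Real.log k.factorial - Real.log l.factorial := by
    have h := Nat.add_choose_mul_factorial_mul_factorial k l
    rw [← Nat.choose_symm_add] at h
    have h' : ((k + l).choose k : ℝ) * k.factorial * l.factorial = (k + l).factorial := by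
      exact_mod_cast h
    rw [← h', Real.log_mul, Real.log_mul]
    · ring
    all_goals first
      | positivity
      | (have : 0 < (k + l).choose k := Nat.choose_pos (by omega)
         positivity)
  push_cast at *
  have hn' : (0 : ℝ) < k + l := by positivity
  have e1 : (1 : ℝ) - k / (k + l) = l / (k + l) := by field_simp; ring
  have e2 : ((k : ℝ) + l - k) = l := by ring
  rw [e1, e2]
  rw [Real.log_div hk'.ne' (Real.exp_pos 1).ne', Real.log_exp,
    Real.log_mul two_ne_zero hk'.ne'] at f1
  rw [Real.log_div hl'.ne' (Real.exp_pos 1).ne', Real.log_exp,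
    Real.log_mul two_ne_zero hl'.ne'] at f2
  rw [Real.log_div hn'.ne' (Real.exp_pos 1).ne', Real.log_exp,
    Real.log_mul two_ne_zero hn'.ne'] at f3
  have hpi : Real.log (√Real.pi) = Real.log Real.pi / 2 := Real.log_sqrt Real.pi_pos.le
  rw [hpi] at b1 b2 b3 c1 c2 c3
  have e3 : Real.log (2 * Real.pi * (k + l) * ((k / (k + l) : ℝ) * (l / (k + l))))
      = Real.log 2 + Real.log Real.pi + Real.log k + Real.log l - Real.log (k + l) := by
    rw [Real.log_mul (by positivity) (by positivity), Real.log_mul (by positivity) (by positivity),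
      Real.log_mul (by positivity) (by positivity), Real.log_mul (by positivity) (by positivity),
      Real.log_div (by positivity) (by positivity), Real.log_div (by positivity) (by positivity)]
    ring
  have e4 : ((k : ℝ) + l) * Real.binEntropy (k / (k + l))
      = (k + l) * Real.log (k + l) - k * Real.log k - l * Real.log l := by
    rw [Real.binEntropy, e1, Real.log_inv, Real.log_inv,
      Real.log_div (by positivity) (by positivity), Real.log_div (by positivity) (by positivity)]
    field_simp
    ring
  rw [e3, e4, hch, abs_le]
  have p1 : (0 : ℝ) ≤ 1 / (12 * k) := by positivity
  have p2 : (0 : ℝ) ≤ 1 / (12 * l) := by positivity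
  have p3 : (0 : ℝ) ≤ 1 / (12 * (k + l)) := by positivity
  constructor <;> linarith

/-- One term of the binomial expansion of `(a + (1 - a)) ^ n = 1` at `a = k / n`. Unlike the
Stirling estimate this covers `k = 0` and `k = n`. -/
lemma choose_le_exp {n k : ℕ} (hn : n ≠ 0) (hk : k ≤ n) :
    (n.choose k : ℝ) ≤ Real.exp (n * Real.binEntropy (k / n)) := by
  rcases Nat.eq_zero_or_pos k with rfl | hk0
  · simp
  rcases hk.eq_or_lt with rfl | hkn
  · have : (k : ℝ) ≠ 0 := by exact_mod_cast hn
    simp [this]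
  have hk' : (0 : ℝ) < k := by exact_mod_cast hk0
  have hn' : (0 : ℝ) < n := by positivity
  have hkn' : (k : ℝ) < n := by exact_mod_cast hkn
  set a : ℝ := k / n with ha
  have ha0 : 0 < a := by positivity
  have ha1 : 0 < 1 - a := by rw [ha, sub_pos, div_lt_one hn']; exact hkn'
  have hsum := add_pow a (1 - a) n
  rw [show a + (1 - a) = 1 by ring, one_pow] at hsum
  have hle : a ^ k * (1 - a) ^ (n - k) * n.choose k ≤ 1 := by
    refine le_of_le_of_eq ?_ hsum.symm
    exact Finset.single_le_sum (f := fun m => a ^ m * (1 - a) ^ (n - m) * (n.choose m : ℝ))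
      (fun i _ => by positivity) (Finset.mem_range.2 (Nat.lt_succ_of_le hk))
  have e : Real.exp (n * Real.binEntropy a) = (a ^ k * (1 - a) ^ (n - k))⁻¹ := by
    rw [← Real.exp_log (show 0 < (a ^ k * (1 - a) ^ (n - k))⁻¹ by positivity), Real.log_inv,
      Real.log_mul (by positivity) (by positivity), Real.log_pow, Real.log_pow, Real.binEntropy,
      Real.log_inv, Real.log_inv, Nat.cast_sub hk]
    congr 1
    rw [ha]
    field_simp
    ring
  rw [e, ← one_div, le_div_iff₀ (by positivity)]
  linarith

/-! ### Reduction to sums over the number of positive spins -/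

/-- The Gibbs weight of the configurations of size `n` with exactly `k` positive spins. -/
noncomputable def spinWeight (β h : ℝ) (n k : ℕ) : ℝ :=
  n.choose k * Real.exp (n * (β * (2 * (k / n) - 1) ^ 4 + h * (2 * (k / n) - 1) ^ 2))

lemma spinWeight_nonneg (β h : ℝ) (n k : ℕ) : 0 ≤ spinWeight β h n k := by
  unfold spinWeight; positivity

lemma spinWeight_pos (β h : ℝ) {n k : ℕ} (hk : k ≤ n) : 0 < spinWeight β h n k := by
  have : 0 < n.choose k := Nat.choose_pos hk
  unfold spinWeight; positivity

lemma sum_spinWeight_pos (β h : ℝ) (n : ℕ) :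
    0 < ∑ k ∈ Finset.range (n + 1), spinWeight β h n k :=
  Finset.sum_pos (fun k hk => spinWeight_pos β h (by simpa [Nat.lt_succ_iff] using hk))
    ⟨0, by simp⟩

open Classical in
/-- Configurations correspond to the sets of their positive spins. -/
noncomputable def configEquivFinset (n : ℕ) : Config n ≃ Finset (Fin n) where
  toFun ω := Finset.univ.filter fun i => ω i = 1
  invFun s i := if i ∈ s then 1 else -1
  left_inv ω := by
    ext i
    rcases Int.units_eq_one_or (ω i) with h | h <;> simp [h]
  right_inv s := by
    ext i
    by_cases h : i ∈ s <;> simp [h]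

lemma magnetization_eq {n : ℕ} (ω : Config n) :
    magnetization ω = 2 * (configEquivFinset n ω).card - n := by
  have h : ∀ i, spin ω i = 2 * (if ω i = 1 then (1 : ℝ) else 0) - 1 := by
    intro i
    rcases Int.units_eq_one_or (ω i) with h | h <;> simp [spin, h]
    norm_num
  simp only [magnetization, h, Finset.sum_sub_distrib, ← Finset.mul_sum]
  simp [configEquivFinset]

lemma sum_config {n : ℕ} (F : ℝ → ℝ) : ∑ ω : Config n, F (magnetization ω)
    = ∑ k ∈ Finset.range (n + 1), (n.choose k : ℝ) * F (2 * k - n) := by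
  have h1 : ∑ ω : Config n, F (magnetization ω)
      = ∑ s : Finset (Fin n), F (2 * s.card - n) :=
    Fintype.sum_equiv (configEquivFinset n) _ _ fun ω => by rw [magnetization_eq]
  rw [h1, ← Finset.powerset_univ,
    Finset.sum_powerset_apply_card (fun j : ℕ => F (2 * (j : ℝ) - n))]
  simp

lemma integral_gibbs {n : ℕ} (hn : n ≠ 0) (β h : ℝ) (F : ℝ → ℝ) :
    ∫ ω, F (magnetization ω) ∂(gibbs n β h)
      = (∑ k ∈ Finset.range (n + 1), spinWeight β h n k * F (2 * k - n))
        / ∑ k ∈ Finset.range (n + 1), spinWeight β h n k := by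
  have hn' : (n : ℝ) ≠ 0 := by exact_mod_cast hn
  have key : ∀ G : ℝ → ℝ, ∑ ω : Config n, Real.exp (hamiltonian n β h ω) * G (magnetization ω)
      = ∑ k ∈ Finset.range (n + 1), spinWeight β h n k * G (2 * k - n) := by
    intro G
    simp only [hamiltonian_eq n hn]
    rw [sum_config (fun x => Real.exp (n * (β * (x / n) ^ 4 + h * (x / n) ^ 2)) * G x)]
    refine Finset.sum_congr rfl fun k _ => ?_
    rw [spinWeight, show (2 * (k : ℝ) - n) / n = 2 * (k / n) - 1 by field_simp]
    ring
  have hZ := key fun _ => 1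
  simp only [mul_one] at hZ
  rw [gibbs, integral_tilted, integral_count, integral_count, hZ, ← key, Finset.sum_div]
  refine Finset.sum_congr rfl fun ω _ => ?_
  rw [smul_eq_mul]
  ring

open Classical in
lemma setIntegral_gibbs {n : ℕ} (hn : n ≠ 0) (β h : ℝ) (P : ℝ → Prop) (F : ℝ → ℝ) :
    ∫ ω in {ω | P (magnetization ω)}, F (magnetization ω) ∂(gibbs n β h)
      = (∑ k ∈ (Finset.range (n + 1)).filter fun k : ℕ => P (2 * (k : ℝ) - n),
          spinWeight β h n k * F (2 * k - n))
        / ∑ k ∈ Finset.range (n + 1), spinWeight β h n k := by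
  rw [← integral_indicator (Set.toFinite _).measurableSet]
  have := integral_gibbs hn β h fun x => if P x then F x else 0
  simp only [mul_ite, mul_zero] at this
  rw [← Finset.sum_filter] at this
  rw [← this]
  rfl

open Classical in
lemma gibbs_real_eq {n : ℕ} (hn : n ≠ 0) (β h : ℝ) (P : ℝ → Prop) :
    (gibbs n β h).real {ω | P (magnetization ω)}
      = (∑ k ∈ (Finset.range (n + 1)).filter fun k : ℕ => P (2 * (k : ℝ) - n),
          spinWeight β h n k)
        / ∑ k ∈ Finset.range (n + 1), spinWeight β h n k := by
  have := setIntegral_gibbs hn β h P fun _ => 1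
  simpa using this

/-- The sum over the `k` with `|2 k / n - 2 a| ≤ δ` of the weight of `k` times `F (2 k - n)`. -/
noncomputable def nearSum (β h a δ : ℝ) (n : ℕ) (F : ℝ → ℝ) : ℝ :=
  ∑ k ∈ (Finset.range (n + 1)).filter fun k : ℕ => |2 * ((k : ℝ) / n - a)| ≤ δ,
    spinWeight β h n k * F (2 * k - n)

open Classical in
lemma nearSum_eq {n : ℕ} (hn : n ≠ 0) (β h a δ : ℝ) (F : ℝ → ℝ) : nearSum β h a δ n F =
    ∑ k ∈ (Finset.range (n + 1)).filter fun k : ℕ => |(2 * (k : ℝ) - n) / n - (2 * a - 1)| ≤ δ,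
      spinWeight β h n k * F (2 * k - n) := by
  have hn' : (n : ℝ) ≠ 0 := by exact_mod_cast hn
  have e : ∀ k : ℕ, (2 * (k : ℝ) - n) / n - (2 * a - 1) = 2 * (k / n - a) := by
    intro k; field_simp; ring
  simp only [nearSum, e]

lemma setIntegral_near {n : ℕ} (hn : n ≠ 0) (β h a δ : ℝ) (F : ℝ → ℝ) :
    ∫ ω in near n a δ, F (magnetization ω) ∂(gibbs n β h)
      = nearSum β h a δ n F / ∑ k ∈ Finset.range (n + 1), spinWeight β h n k := by
  classical
  rw [nearSum_eq hn]
  exact setIntegral_gibbs hn β h (fun x => |x / n - (2 * a - 1)| ≤ δ) F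

lemma gibbs_real_near {n : ℕ} (hn : n ≠ 0) (β h a δ : ℝ) :
    (gibbs n β h).real (near n a δ)
      = nearSum β h a δ n (fun _ => 1) / ∑ k ∈ Finset.range (n + 1), spinWeight β h n k := by
  rw [← setIntegral_near hn]
  simp

/-- The partition function cancels. No positivity of the window is needed: if it is empty, both
sides are `0` by convention. -/
lemma integral_cond_near {n : ℕ} (hn : n ≠ 0) (β h a δ : ℝ) (F : ℝ → ℝ) :
    ∫ ω, F (magnetization ω) ∂((gibbs n β h)[|near n a δ])
      = nearSum β h a δ n F / nearSum β h a δ n fun _ => 1 := by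
  rw [ProbabilityTheory.cond, integral_smul_measure, ENNReal.toReal_inv, setIntegral_near hn,
    ← Measure.real, gibbs_real_near hn, smul_eq_mul]
  have := (sum_spinWeight_pos β h n).ne'
  field_simp

/-- The window of radius `1` around `1/2` contains every level, so unconditional laws are handled as
conditional ones. -/
lemma integral_gibbs_eq_nearSum {n : ℕ} (hn : n ≠ 0) (β h : ℝ) (F : ℝ → ℝ) :
    ∫ ω, F (magnetization ω) ∂(gibbs n β h)
      = nearSum β h (1 / 2) 1 n F / nearSum β h (1 / 2) 1 n fun _ => 1 := by
  rw [integral_gibbs hn]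
  have hn' : (0 : ℝ) < n := by positivity
  have e : (Finset.range (n + 1)).filter (fun k : ℕ => |2 * ((k : ℝ) / n - 1 / 2)| ≤ 1)
      = Finset.range (n + 1) := by
    refine Finset.filter_true_of_mem fun k hk => ?_
    have hk' : (k : ℝ) ≤ n := by exact_mod_cast Nat.lt_succ_iff.1 (Finset.mem_range.1 hk)
    have h1 : (k : ℝ) / n ≤ 1 := (div_le_one hn').2 hk'
    have h0 : 0 ≤ (k : ℝ) / n := by positivity
    exact abs_le.2 ⟨by linarith, by linarith⟩
  simp only [nearSum, e, mul_one]

/-- The crude upper bound for the weights. -/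
lemma spinWeight_le {n k : ℕ} (hn : n ≠ 0) (hk : k ≤ n) (β h : ℝ) :
    spinWeight β h n k ≤ Real.exp (n * assoc β h (k / n)) := by
  have := mul_le_mul_of_nonneg_right (choose_le_exp hn hk)
    (Real.exp_pos (n * (β * (2 * (k / n) - 1) ^ 4 + h * (2 * (k / n) - 1) ^ 2))).le
  rw [← Real.exp_add] at this
  refine this.trans_eq ?_
  rw [assoc]
  ring_nf

/-! ### From lattice sums to integrals -/

lemma add_abs_pow_mul_exp_le (c : ℝ) (hc : 0 ≤ c) (j : ℕ) (x : ℝ) :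
    (c + |x|) ^ j * Real.exp (-|x|) ≤ j.factorial * Real.exp c := by
  have h := Real.pow_div_factorial_le_exp (c + |x|) (by positivity) j
  rw [div_le_iff₀ (by positivity), Real.exp_add] at h
  have := mul_le_mul_of_nonneg_right h (Real.exp_pos (-|x|)).le
  refine this.trans_eq ?_
  have e : Real.exp |x| * Real.exp (-|x|) = 1 := by rw [← Real.exp_add]; simp
  linear_combination (Real.exp c * j.factorial) * e

lemma integrable_add_abs_pow_mul_exp (c : ℝ) (hc : 1 ≤ c) (j : ℕ) :
    Integrable fun x : ℝ => (c + |x|) ^ j * Real.exp (-|x|) := by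
  refine (integrable_inv_one_add_sq.const_mul ((j + 2).factorial * Real.exp c)).mono'
    (by fun_prop) (ae_of_all _ fun x => ?_)
  rw [Real.norm_of_nonneg (by positivity), ← div_eq_mul_inv, le_div_iff₀ (by positivity)]
  refine le_trans ?_ (add_abs_pow_mul_exp_le c (by linarith) (j + 2) x)
  have h1 : 1 + x ^ 2 ≤ (c + |x|) ^ 2 := by
    rw [← sq_abs]
    nlinarith [abs_nonneg x]
  calc (c + |x|) ^ j * Real.exp (-|x|) * (1 + x ^ 2)
      ≤ (c + |x|) ^ j * Real.exp (-|x|) * (c + |x|) ^ 2 :=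
        mul_le_mul_of_nonneg_left h1 (by positivity)
    _ = _ := by ring

/-- The unnormalized limit density `exp (-c (x / 2) ^ (2 q))`. -/
noncomputable def limitDensity (c : ℝ) (q : ℕ) (x : ℝ) : ℝ := Real.exp (-c * (x / 2) ^ (2 * q))

lemma limitDensity_pos (c : ℝ) (q : ℕ) (x : ℝ) : 0 < limitDensity c q x := Real.exp_pos _

lemma continuous_limitDensity (c : ℝ) (q : ℕ) : Continuous (limitDensity c q) := by
  unfold limitDensity; fun_prop

lemma sub_one_le_pow {t : ℝ} (ht : 0 ≤ t) {q : ℕ} (hq : 1 ≤ q) : t - 1 ≤ t ^ q := by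
  rcases le_total t 1 with h | h
  · linarith [pow_nonneg ht q]
  · linarith [le_self_pow₀ h (by omega : q ≠ 0)]

lemma exists_pow_mul_limitDensity_le {c : ℝ} (hc : 0 < c) {q : ℕ} (hq : 1 ≤ q) (j : ℕ) :
    ∃ C : ℝ, 0 ≤ C ∧ ∀ x, (1 + |x|) ^ j * limitDensity c q x ≤ C * Real.exp (-|x|) := by
  refine ⟨j.factorial * Real.exp 1 * Real.exp (c + 4 / c), by positivity, fun x => ?_⟩
  have h1 := add_abs_pow_mul_exp_le 1 zero_le_one j x
  -- Since `s - 1 ≤ s ^ q`, a completed square bounds the exponent by `-2 |x| + c + 4 / c`. One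
  -- factor `exp (-|x|)` is then spent on the polynomial.
  have h2 : limitDensity c q x ≤ Real.exp (-|x|) * (Real.exp (-|x|) * Real.exp (c + 4 / c)) := by
    rw [limitDensity, ← Real.exp_add, ← Real.exp_add, Real.exp_le_exp]
    have h3 := sub_one_le_pow (sq_nonneg (x / 2)) hq
    rw [← pow_mul] at h3
    have h4 : 2 * |x| ≤ c * (x / 2) ^ 2 + 4 / c := by
      have : c * (x / 2) ^ 2 + 4 / c - 2 * |x| = (c * |x| / 2 - 2) ^ 2 / c := by
        rw [div_pow, ← sq_abs x]
        field_simp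
        ring
      have h5 : 0 ≤ (c * |x| / 2 - 2) ^ 2 / c := by positivity
      linarith
    nlinarith
  calc (1 + |x|) ^ j * limitDensity c q x
      ≤ (1 + |x|) ^ j * (Real.exp (-|x|) * (Real.exp (-|x|) * Real.exp (c + 4 / c))) :=
        mul_le_mul_of_nonneg_left h2 (by positivity)
    _ = ((1 + |x|) ^ j * Real.exp (-|x|)) * (Real.exp (-|x|) * Real.exp (c + 4 / c)) := by ring
    _ ≤ (j.factorial * Real.exp 1) * (Real.exp (-|x|) * Real.exp (c + 4 / c)) :=
        mul_le_mul_of_nonneg_right h1 (by positivity)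
    _ = _ := by ring

lemma exp_neg_abs_le {x y r : ℝ} (h : |x - y| ≤ r) :
    Real.exp (-|x|) ≤ Real.exp r * Real.exp (-|y|) := by
  rw [← Real.exp_add, Real.exp_le_exp]
  have := abs_sub_abs_le_abs_sub y x
  rw [abs_sub_comm] at this
  linarith

/-- Mean value inequality; restricting to `|x - y| ≤ 2` lets the decay be moved from the
intermediate point to `y` at the cost of `exp 2`. -/
lemma exists_limitDensity_sub_le {c : ℝ} (hc : 0 < c) {q : ℕ} (hq : 1 ≤ q) :
    ∃ C : ℝ, 0 ≤ C ∧ ∀ x y, |x - y| ≤ 2 →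
      |limitDensity c q x - limitDensity c q y| ≤ C * |x - y| * Real.exp (-|y|) := by
  obtain ⟨C, hC0, hC⟩ := exists_pow_mul_limitDensity_le hc hq (2 * q - 1)
  refine ⟨c * q * C * Real.exp 2, by positivity, fun x y hxy => ?_⟩
  have hd : ∀ z, HasDerivAt (limitDensity c q)
      (limitDensity c q z * (-c * q * (z / 2) ^ (2 * q - 1))) z := by
    intro z
    refine ((((hasDerivAt_id z).div_const 2).pow (2 * q)).const_mul (-c)).exp.congr_deriv ?_
    simp only [limitDensity, id]
    push_cast
    simp only [Pi.pow_apply]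
    ring
  have := (convex_uIcc y x).norm_image_sub_le_of_norm_hasDerivWithin_le
    (f := limitDensity c q) (C := c * q * C * Real.exp 2 * Real.exp (-|y|))
    (fun z _ => (hd z).hasDerivWithinAt) (fun z hz => ?_) Set.left_mem_uIcc Set.right_mem_uIcc
  · rw [Real.norm_eq_abs, Real.norm_eq_abs] at this
    linarith
  · have hzy : |z - y| ≤ 2 := (Set.abs_sub_left_of_mem_uIcc hz).trans hxy
    have h1 : |z / 2| ^ (2 * q - 1) ≤ (1 + |z|) ^ (2 * q - 1) := by
      refine pow_le_pow_left₀ (abs_nonneg _) ?_ _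
      rw [abs_div, abs_two]
      linarith [abs_nonneg z]
    have hp := limitDensity_pos c q z
    rw [Real.norm_eq_abs, abs_mul, abs_mul, abs_mul, abs_neg, abs_of_pos hc, abs_pow,
      Nat.abs_cast, abs_of_pos hp]
    calc limitDensity c q z * (c * q * |z / 2| ^ (2 * q - 1))
        ≤ limitDensity c q z * (c * q * (1 + |z|) ^ (2 * q - 1)) := by gcongr
      _ = c * q * ((1 + |z|) ^ (2 * q - 1) * limitDensity c q z) := by ring
      _ ≤ c * q * (C * (Real.exp 2 * Real.exp (-|y|))) := by
        refine mul_le_mul_of_nonneg_left ((hC z).trans ?_) (by positivity)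
        exact mul_le_mul_of_nonneg_left (exp_neg_abs_le hzy) hC0
      _ = _ := by ring

/-- A lattice sum of mesh `h` is exactly the integral of this step function, so sums and integrals
can be compared through a pointwise bound on integrands. -/
lemma comp_floor_eq_sum_indicator {h : ℝ} (hh : 0 < h) (b : ℝ) (K : Finset ℤ) (G : ℤ → ℝ)
    (hG : ∀ k ∉ K, G k = 0) (x : ℝ) : G ⌊(x - b) / h⌋
      = ∑ k ∈ K, (Set.Ico (h * k + b) (h * k + b + h)).indicator (fun _ => G k) x := by
  have hmem : ∀ k : ℤ, x ∈ Set.Ico (h * k + b) (h * k + b + h) ↔ ⌊(x - b) / h⌋ = k := by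
    intro k
    rw [Int.floor_eq_iff, le_div_iff₀ hh, div_lt_iff₀ hh, Set.mem_Ico]
    constructor <;> rintro ⟨h1, h2⟩ <;> constructor <;> linarith
  classical
  simp only [Set.indicator_apply, hmem]
  rw [Finset.sum_ite_eq]
  split_ifs with hk
  · rfl
  · exact hG _ hk

lemma integrable_comp_floor {h : ℝ} (hh : 0 < h) (b : ℝ) (K : Finset ℤ) (G : ℤ → ℝ)
    (hG : ∀ k ∉ K, G k = 0) : Integrable fun x : ℝ => G ⌊(x - b) / h⌋ := by
  simp only [comp_floor_eq_sum_indicator hh b K G hG]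
  refine integrable_finsetSum _ fun k _ => ?_
  exact (integrable_indicator_iff measurableSet_Ico).2 (by simp)

lemma integral_comp_floor {h : ℝ} (hh : 0 < h) (b : ℝ) (K : Finset ℤ) (G : ℤ → ℝ)
    (hG : ∀ k ∉ K, G k = 0) : ∫ x : ℝ, G ⌊(x - b) / h⌋ = h * ∑ k ∈ K, G k := by
  simp only [comp_floor_eq_sum_indicator hh b K G hG]
  rw [integral_finsetSum _ fun k _ =>
    (integrable_indicator_iff measurableSet_Ico).2 (by simp), Finset.mul_sum]
  refine Finset.sum_congr rfl fun k _ => ?_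
  rw [integral_indicator measurableSet_Ico]
  simp [hh.le]

lemma abs_sub_floor_le {h : ℝ} (hh : 0 < h) (b x : ℝ) :
    |x - (h * ⌊(x - b) / h⌋ + b)| ≤ h := by
  have h1 := Int.floor_le ((x - b) / h)
  have h2 := Int.lt_floor_add_one ((x - b) / h)
  rw [le_div_iff₀ hh] at h1
  rw [div_lt_iff₀ hh] at h2
  rw [abs_le]
  constructor <;> linarith

lemma abs_le_one_add_abs {g : ℝ → ℝ} (hg : LipschitzWith 1 g) (hg0 : |g 0| ≤ 1) (x : ℝ) :
    |g x| ≤ 1 + |x| := by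
  have := hg.dist_le_mul x 0
  rw [Real.dist_eq, Real.dist_eq, sub_zero, NNReal.coe_one, one_mul] at this
  have h2 := abs_sub_abs_le_abs_sub (g x) (g 0)
  linarith

lemma integrable_limitDensity_mul {c : ℝ} (hc : 0 < c) {q : ℕ} (hq : 1 ≤ q) {g : ℝ → ℝ}
    (hg : LipschitzWith 1 g) (hg0 : |g 0| ≤ 1) :
    Integrable fun x => limitDensity c q x * g x := by
  obtain ⟨C, hC0, hC⟩ := exists_pow_mul_limitDensity_le hc hq 1
  have hint := (integrable_add_abs_pow_mul_exp 1 le_rfl 0).const_mul C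
  refine hint.mono' ((continuous_limitDensity c q).mul hg.continuous).aestronglyMeasurable
    (ae_of_all _ fun x => ?_)
  rw [norm_mul, Real.norm_of_nonneg (limitDensity_pos c q x).le, Real.norm_eq_abs]
  have := mul_le_mul_of_nonneg_left (abs_le_one_add_abs hg hg0 x) (limitDensity_pos c q x).le
  have h2 := hC x
  simp only [pow_one, pow_zero, one_mul] at h2 ⊢
  linarith

/-- The integrand error splits as `(v - p(x)) g(y) + p(x) (g(y) - g(x))`, with `p` the limit density
and `y` the lattice point below `x`. The first part is small by the hypothesis on `V` and the
regularity of `p`, the second because `g` is 1-Lipschitz and the mesh is at most `2 η`. The constant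
does not depend on `g`, as the Wasserstein distance requires. -/
lemma exists_lattice_sum_sub_integral_le {c : ℝ} (hc : 0 < c) {q : ℕ} (hq : 1 ≤ q) (C₀ : ℝ)
    (hC₀ : 0 ≤ C₀) : ∃ C : ℝ, 0 ≤ C ∧ ∀ (h b η : ℝ) (K : Finset ℤ) (V : ℤ → ℝ), 0 < h → h ≤ 2 →
      h ≤ 2 * η → (∀ k ∉ K, V k = 0) →
      (∀ k : ℤ, |V k - limitDensity c q (h * k + b)| ≤ C₀ * η * Real.exp (-|h * k + b|)) →
      ∀ g : ℝ → ℝ, LipschitzWith 1 g → |g 0| ≤ 1 →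
        |h * ∑ k ∈ K, V k * g (h * k + b) - ∫ x, limitDensity c q x * g x| ≤ C * η := by
  obtain ⟨C₁, hC₁0, hC₁⟩ := exists_limitDensity_sub_le hc hq
  obtain ⟨C₂, hC₂0, hC₂⟩ := exists_pow_mul_limitDensity_le hc hq 0
  set D := (C₀ + 2 * C₁) * Real.exp 2 + 2 * C₂ with hD
  have hD0 : 0 ≤ D := by positivity
  set I := ∫ x : ℝ, (3 + |x|) ^ 1 * Real.exp (-|x|) with hI
  refine ⟨D * I, mul_nonneg hD0 (integral_nonneg fun x => by positivity), ?_⟩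
  intro h b η K V hh hh2 hhη hVK hV g hg hg0
  have hη : 0 ≤ η := by linarith
  have hG : ∀ k ∉ K, V k * g (h * k + b) = 0 := fun k hk => by rw [hVK k hk, zero_mul]
  rw [← integral_comp_floor hh b K (fun k => V k * g (h * k + b)) hG,
    ← integral_sub (integrable_comp_floor hh b K (fun k => V k * g (h * k + b)) hG)
      (integrable_limitDensity_mul hc hq hg hg0)]
  have hint := (integrable_add_abs_pow_mul_exp 3 (by norm_num) 1).const_mul (D * η)
  have := norm_integral_le_of_norm_le hint (f := fun x =>
    V ⌊(x - b) / h⌋ * g (h * ⌊(x - b) / h⌋ + b) - limitDensity c q x * g x)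
    (ae_of_all _ fun x => ?_)
  · rw [Real.norm_eq_abs, integral_const_mul] at this
    linarith
  · have hxy := abs_sub_floor_le hh b x
    have hVy := hV ⌊(x - b) / h⌋
    set y := h * (⌊(x - b) / h⌋ : ℝ) + b with hy
    set v := V ⌊(x - b) / h⌋
    have hyx : |y - x| ≤ h := by rw [abs_sub_comm]; exact hxy
    have e1 := exp_neg_abs_le (hyx.trans hh2)
    have p1 := hC₁ x y (hxy.trans hh2)
    have p2 := hC₂ x
    rw [pow_zero, one_mul] at p2
    have gy : |g y| ≤ 3 + |x| := by
      have := abs_le_one_add_abs hg hg0 y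
      have := abs_sub_abs_le_abs_sub y x
      linarith
    have gxy : |g y - g x| ≤ h := by
      have := hg.dist_le_mul y x
      rw [Real.dist_eq, Real.dist_eq, NNReal.coe_one, one_mul] at this
      linarith
    have hpx := limitDensity_pos c q x
    have hE := Real.exp_pos (-|x|)
    have hv : |v - limitDensity c q x| ≤ (C₀ + 2 * C₁) * η * (Real.exp 2 * Real.exp (-|x|)) := by
      have q1 : |v - limitDensity c q x| ≤ (C₀ + 2 * C₁) * η * Real.exp (-|y|) := by
        have t := abs_sub_le v (limitDensity c q y) (limitDensity c q x)
        rw [abs_sub_comm (limitDensity c q y)] at t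
        have : C₁ * |x - y| * Real.exp (-|y|) ≤ C₁ * (2 * η) * Real.exp (-|y|) := by
          gcongr
          linarith
        linarith
      exact q1.trans (mul_le_mul_of_nonneg_left e1 (by positivity))
    rw [Real.norm_eq_abs]
    have split : v * g y - limitDensity c q x * g x
        = (v - limitDensity c q x) * g y + limitDensity c q x * (g y - g x) := by ring
    rw [split]
    refine (abs_add_le _ _).trans ?_
    rw [abs_mul, abs_mul, abs_of_pos hpx]
    have t1 : |v - limitDensity c q x| * |g y| ≤
        ((C₀ + 2 * C₁) * η * (Real.exp 2 * Real.exp (-|x|))) * (3 + |x|) :=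
      mul_le_mul hv gy (abs_nonneg _) (by positivity)
    have t2 : limitDensity c q x * |g y - g x| ≤ (C₂ * Real.exp (-|x|)) * (2 * η) :=
      mul_le_mul p2 (by linarith) (abs_nonneg _) (by positivity)
    have t3 : (C₂ * Real.exp (-|x|)) * (2 * η) ≤
        (C₂ * Real.exp (-|x|)) * (2 * η) * (3 + |x|) :=
      le_mul_of_one_le_right (by positivity) (by linarith [abs_nonneg x])
    rw [hD, pow_one]
    linarith

/-- Only boundedness is needed, so it is enough that `V` is dominated by a multiple of `exp (-|y|)`.
-/
lemma exists_lattice_moment_le {c : ℝ} (hc : 0 < c) {q : ℕ} (hq : 1 ≤ q) (C₀ : ℝ)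
    (hC₀ : 0 ≤ C₀) (l : ℕ) : ∃ C : ℝ, 0 ≤ C ∧ ∀ (h b η : ℝ) (K : Finset ℤ) (V : ℤ → ℝ), 0 < h →
      h ≤ 2 → 0 ≤ η → η ≤ 1 → (∀ k ∉ K, V k = 0) →
      (∀ k : ℤ, |V k - limitDensity c q (h * k + b)| ≤ C₀ * η * Real.exp (-|h * k + b|)) →
        h * ∑ k ∈ K, V k * |h * k + b| ^ l ≤ C := by
  obtain ⟨C₂, hC₂0, hC₂⟩ := exists_pow_mul_limitDensity_le hc hq 0
  set D := (C₂ + C₀) * Real.exp 2 with hD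
  refine ⟨D * ∫ x : ℝ, (3 + |x|) ^ l * Real.exp (-|x|),
    mul_nonneg (by positivity) (integral_nonneg fun x => by positivity), ?_⟩
  intro h b η K V hh hh2 hη0 hη1 hVK hV
  have hG : ∀ k ∉ K, V k * |h * k + b| ^ l = 0 := fun k hk => by rw [hVK k hk, zero_mul]
  rw [← integral_comp_floor hh b K (fun k => V k * |h * k + b| ^ l) hG, ← integral_const_mul]
  refine integral_mono (integrable_comp_floor hh b K (fun k => V k * |h * k + b| ^ l) hG)
    ((integrable_add_abs_pow_mul_exp 3 (by norm_num) l).const_mul D) fun x => ?_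
  have hxy := abs_sub_floor_le hh b x
  have hVy := hV ⌊(x - b) / h⌋
  change V ⌊(x - b) / h⌋ * |h * (⌊(x - b) / h⌋ : ℝ) + b| ^ l ≤ _
  set y := h * (⌊(x - b) / h⌋ : ℝ) + b with hy
  set v := V ⌊(x - b) / h⌋
  have hyx : |y - x| ≤ h := by rw [abs_sub_comm]; exact hxy
  have e1 := exp_neg_abs_le (hyx.trans hh2)
  have p2 := hC₂ y
  rw [pow_zero, one_mul] at p2
  have hv : v ≤ (C₂ + C₀) * Real.exp (-|y|) := by
    have h1 := (abs_le.1 hVy).2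
    have h2 : C₀ * η * Real.exp (-|y|) ≤ C₀ * Real.exp (-|y|) := by
      gcongr
      exact mul_le_of_le_one_right hC₀ hη1
    linarith
  have hyl : |y| ^ l ≤ (3 + |x|) ^ l := by
    refine pow_le_pow_left₀ (abs_nonneg _) ?_ _
    have := abs_sub_abs_le_abs_sub y x
    linarith
  calc v * |y| ^ l ≤ ((C₂ + C₀) * Real.exp (-|y|)) * |y| ^ l :=
        mul_le_mul_of_nonneg_right hv (by positivity)
    _ ≤ ((C₂ + C₀) * (Real.exp 2 * Real.exp (-|x|))) * (3 + |x|) ^ l := by gcongr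
    _ = _ := by rw [hD]; ring

/-! ### Local expansion around a maximizer -/

/-- Near `a` the associated function is `A(a) - c t ^ (2 q)` up to an error of order
`|t| ^ (2 q + e)`, and the entropic prefactor is constant up to an error of order `|t| ^ e`. -/
structure LocalExpansion (β h a c : ℝ) (q e : ℕ) : Prop where
  pos : 0 < a
  lt_one : a < 1
  coeff_pos : 0 < c
  one_le_e : 1 ≤ e
  e_lt : e + 1 ≤ 2 * q
  bound : ∃ K δ : ℝ, 0 ≤ K ∧ 0 < δ ∧ ∀ t, |t| ≤ δ →
    |assoc β h (a + t) - assoc β h a + c * t ^ (2 * q)| ≤ K * |t| ^ (2 * q + e) ∧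
    |Real.log ((a + t) * (1 - (a + t))) - Real.log (a * (1 - a))| ≤ K * |t| ^ e

/-- The asymptotic size of the largest weight near the maximizer `a`. -/
noncomputable def peak (β h a : ℝ) (n : ℕ) : ℝ :=
  Real.exp (n * assoc β h a) / √(2 * Real.pi * n * (a * (1 - a)))

lemma peak_pos (β h : ℝ) {a : ℝ} (ha0 : 0 < a) (ha1 : a < 1) {n : ℕ} (hn : n ≠ 0) :
    0 < peak β h a n := by
  have : 0 < 1 - a := by linarith
  unfold peak; positivity

lemma abs_exp_sub_one_le_mul_exp (u : ℝ) : |Real.exp u - 1| ≤ |u| * Real.exp |u| := by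
  have h1 := Real.add_one_le_exp (-u)
  have h2 := Real.add_one_le_exp u
  rcases le_total 0 u with hu | hu
  · rw [abs_of_nonneg hu, abs_of_nonneg (by linarith)]
    have := mul_le_mul_of_nonneg_right h1 (Real.exp_pos u).le
    rw [← Real.exp_add, neg_add_cancel, Real.exp_zero] at this
    linarith
  · have h3 : Real.exp u ≤ 1 := Real.exp_le_one_iff.2 hu
    have h4 : 1 ≤ Real.exp |u| := Real.one_le_exp (abs_nonneg u)
    rw [abs_of_nonpos (by linarith), abs_of_nonpos hu]
    rw [abs_of_nonpos hu] at h4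
    nlinarith

lemma log_spinWeight_div_peak (β h : ℝ) {a : ℝ} (ha0 : 0 < a) (ha1 : a < 1) {n k : ℕ} (hk : 0 < k)
    (hkn : k < n) :
    |Real.log (spinWeight β h n k / peak β h a n) - (n * (assoc β h (k / n) - assoc β h a)
      - (Real.log ((k / n : ℝ) * (1 - k / n)) - Real.log (a * (1 - a))) / 2)|
      ≤ 1 / (12 * n) + 1 / (12 * k) + 1 / (12 * (n - k : ℝ)) := by
  have hn : (0 : ℝ) < n := by exact_mod_cast (by omega : 0 < n)
  have hk' : (0 : ℝ) < k := by exact_mod_cast hk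
  have hkn' : (k : ℝ) < n := by exact_mod_cast hkn
  have hx0 : 0 < (k : ℝ) / n := by positivity
  have hx1 : 0 < 1 - (k : ℝ) / n := by rw [sub_pos, div_lt_one hn]; exact hkn'
  have ha1' : 0 < 1 - a := by linarith
  have hch : (0 : ℝ) < n.choose k := by exact_mod_cast Nat.choose_pos hkn.le
  refine le_of_eq_of_le ?_ (abs_log_choose_sub_le hk hkn)
  congr 1
  rw [Real.log_div (spinWeight_pos β h hkn.le).ne' (peak_pos β h ha0 ha1 (by omega)).ne',
    spinWeight, peak, Real.log_mul hch.ne' (Real.exp_pos _).ne', Real.log_exp,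
    Real.log_div (Real.exp_pos _).ne' (by positivity), Real.log_exp,
    Real.log_sqrt (by positivity), Real.log_mul (by positivity) (by positivity),
    Real.log_mul (x := 2 * Real.pi * n) (by positivity) (by positivity), assoc, assoc]
  ring

/-- With `t = k/n - a` and `y = 2 N t` one has `n t^(2q) = (y/2)^(2q)`, so the ratio is the limit
density times `exp u`. The error `u` is bounded twice: by `N^(-e)` times a polynomial in `|y|`, for
the rate, and by `(c/2) (y/2)^(2q) + K₂`, so that `exp |u|` uses up only half of the decay. Then
`|exp u - 1| ≤ |u| exp |u|` combines the two. -/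
lemma exists_window_bound {β h a c : ℝ} {q e : ℕ} (H : LocalExpansion β h a c q e) {δ : ℝ}
    (hδ : 0 < δ) : ∃ δ₀ C : ℝ, 0 < δ₀ ∧ δ₀ ≤ δ ∧ δ₀ < a ∧ δ₀ < 1 - a ∧ 0 ≤ C ∧
      ∀ (n : ℕ) (N : ℝ), 1 ≤ n → 1 ≤ N → N ^ (2 * q) = n → ∀ k : ℕ, |(k : ℝ) / n - a| ≤ δ₀ →
        |spinWeight β h n k / peak β h a n - limitDensity c q (2 * N * (k / n - a))|
          ≤ C * (N ^ e)⁻¹ * Real.exp (-|2 * N * (k / n - a)|) := by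
  obtain ⟨K, δ₁, hK0, hδ₁, hK⟩ := H.bound
  have ha0 := H.pos
  have ha1 := H.lt_one
  have hc := H.coeff_pos
  have hq : 1 ≤ q := by have := H.e_lt; omega
  set ε := min a (1 - a) / 2 with hε
  have hεpos : 0 < ε := div_pos (lt_min ha0 (by linarith)) two_pos
  have hεa : 2 * ε ≤ a := by rw [hε]; linarith [min_le_left a (1 - a)]
  have hεb : 2 * ε ≤ 1 - a := by rw [hε]; linarith [min_le_right a (1 - a)]
  set K₁ := 1 / 12 + 1 / (12 * ε) + 1 / (12 * ε) with hK₁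
  set K₂ := K + K / 2 + K₁ with hK₂
  have hK₁0 : 0 ≤ K₁ := by positivity
  have hK₂0 : 0 ≤ K₂ := by positivity
  obtain ⟨C, hC0, hC⟩ := exists_pow_mul_limitDensity_le (half_pos hc) hq (2 * q + e)
  -- The bound by `ε` keeps `k / n` away from `0` and `1`, as the Stirling errors need; the bound by
  -- `c / (2 (K + 1))` makes the Taylor remainder at most half of the main term.
  set δ₀ := min (min δ δ₁) (min ε (min 1 (c / (2 * (K + 1))))) with hδ₀
  have b1 : δ₀ ≤ δ := (min_le_left _ _).trans (min_le_left _ _)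
  have b2 : δ₀ ≤ δ₁ := (min_le_left _ _).trans (min_le_right _ _)
  have b3 : δ₀ ≤ ε := (min_le_right _ _).trans (min_le_left _ _)
  have b4 : δ₀ ≤ 1 := (min_le_right _ _).trans ((min_le_right _ _).trans (min_le_left _ _))
  have b5 : δ₀ ≤ c / (2 * (K + 1)) :=
    (min_le_right _ _).trans ((min_le_right _ _).trans (min_le_right _ _))
  have hδ₀0 : 0 < δ₀ := by positivity
  have b6 : K * δ₀ ≤ c / 2 := by
    rw [le_div_iff₀ (by positivity)] at b5
    nlinarith
  refine ⟨δ₀, Real.exp K₂ * K₂ * C, hδ₀0, b1, by linarith, by linarith, by positivity, ?_⟩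
  intro n N hn hN hNn k hk
  have hn' : (0 : ℝ) < n := by exact_mod_cast hn
  have hN0 : 0 < N := by linarith
  set t := (k : ℝ) / n - a with ht
  have hx : (k : ℝ) / n = a + t := by rw [ht]; ring
  have hkx : (k : ℝ) = n * (a + t) := by rw [← hx]; field_simp
  have ht' := abs_le.1 (hk.trans b3)
  have hkε : n * ε ≤ k := by rw [hkx]; gcongr; linarith
  have hkε' : n * ε ≤ n - k := by
    rw [hkx]
    have : n * ε ≤ n * (1 - (a + t)) := by gcongr; linarith
    linarith
  have hnε : 0 < n * ε := by positivity
  have hk0 : 0 < k := by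
    have : (0 : ℝ) < k := by linarith
    exact_mod_cast this
  have hkn : k < n := by
    have : (k : ℝ) < n := by linarith
    exact_mod_cast this
  set η := (N ^ e)⁻¹ with hη
  have hη0 : 0 < η := by positivity
  have hn1 : (1 : ℝ) / n ≤ η := by
    rw [← hNn, one_div, hη]
    refine inv_anti₀ (by positivity) (pow_le_pow_right₀ hN ?_)
    have := H.e_lt; omega
  have hn2 : (1 : ℝ) / n ≤ 1 := by
    rw [div_le_one hn']; exact_mod_cast hn
  have hθ := log_spinWeight_div_peak β h ha0 ha1 hk0 hkn
  have hstir : (1 : ℝ) / (12 * n) + 1 / (12 * k) + 1 / (12 * (n - k : ℝ)) ≤ K₁ * (1 / n) := by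
    have s1 : (1 : ℝ) / (12 * k) ≤ 1 / (12 * (n * ε)) := by
      apply one_div_le_one_div_of_le <;> linarith
    have s2 : (1 : ℝ) / (12 * (n - k : ℝ)) ≤ 1 / (12 * (n * ε)) := by
      apply one_div_le_one_div_of_le <;> linarith
    have s3 : K₁ * (1 / n) = 1 / (12 * n) + 1 / (12 * (n * ε)) + 1 / (12 * (n * ε)) := by
      rw [hK₁]; field_simp
    linarith
  rw [hx] at hθ
  obtain ⟨hA, hB⟩ := hK t (hk.trans b2)
  set R := spinWeight β h n k / peak β h a n with hR
  have hRpos : 0 < R := div_pos (spinWeight_pos β h hkn.le) (peak_pos β h ha0 ha1 (by omega))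
  set y := 2 * N * t with hy
  have hyt : N * |t| = |y| / 2 := by
    rw [hy, abs_mul, abs_of_pos (by positivity : 0 < 2 * N)]; ring
  have hY : n * t ^ (2 * q) = (y / 2) ^ (2 * q) := by
    rw [← hNn, ← mul_pow, hy]; congr 1; ring
  have hY0 : 0 ≤ (y / 2) ^ (2 * q) := by rw [pow_mul]; positivity
  set u := Real.log R + c * (y / 2) ^ (2 * q) with hu
  have hu1 : |u| ≤ n * (K * |t| ^ (2 * q + e)) + K * |t| ^ e / 2 + K₁ * (1 / n) := by
    have hA' : |n * (assoc β h (a + t) - assoc β h a + c * t ^ (2 * q))|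
        ≤ n * (K * |t| ^ (2 * q + e)) := by
      rw [abs_mul, abs_of_pos hn']
      exact mul_le_mul_of_nonneg_left hA hn'.le
    have e1 : u = (Real.log R - (n * (assoc β h (a + t) - assoc β h a)
        - (Real.log ((a + t) * (1 - (a + t))) - Real.log (a * (1 - a))) / 2))
        + n * (assoc β h (a + t) - assoc β h a + c * t ^ (2 * q))
        - (Real.log ((a + t) * (1 - (a + t))) - Real.log (a * (1 - a))) / 2 := by
      rw [hu, ← hY]; ring
    rw [abs_le] at hθ hA' hB ⊢
    rw [e1]
    constructor <;> linarith [hθ.1, hθ.2, hA'.1, hA'.2, hB.1, hB.2]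
  have hnt : n * |t| ^ (2 * q) = (y / 2) ^ (2 * q) := by
    rw [← hY, pow_mul, sq_abs, ← pow_mul]
  have hte : |t| ^ e ≤ δ₀ := (pow_le_pow_left₀ (abs_nonneg t) hk e).trans
    (pow_le_of_le_one hδ₀0.le b4 (by have := H.one_le_e; omega))
  have hu2 : |u| ≤ η * (K₂ * (1 + |y|) ^ (2 * q + e)) := by
    have hy1 : 1 ≤ 1 + |y| := by linarith [abs_nonneg y]
    have g1 : n * |t| ^ (2 * q + e) = η * (|y| / 2) ^ (2 * q + e) := by
      rw [← hNn, hη, ← hyt, mul_pow, pow_add N]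
      field_simp
    have g2 : |t| ^ e = η * (|y| / 2) ^ e := by
      rw [hη, ← hyt, mul_pow]; field_simp
    have g3 : (|y| / 2) ^ (2 * q + e) ≤ (1 + |y|) ^ (2 * q + e) :=
      pow_le_pow_left₀ (by positivity) (by linarith [abs_nonneg y]) _
    have g4 : (|y| / 2) ^ e ≤ (1 + |y|) ^ (2 * q + e) :=
      (pow_le_pow_left₀ (by positivity) (by linarith [abs_nonneg y]) _).trans
        (pow_le_pow_right₀ hy1 (by omega))
    have g5 : 1 ≤ (1 + |y|) ^ (2 * q + e) := one_le_pow₀ hy1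
    calc |u| ≤ K * (n * |t| ^ (2 * q + e)) + K / 2 * |t| ^ e + K₁ * (1 / n) := by linarith
      _ ≤ K * (η * (1 + |y|) ^ (2 * q + e)) + K / 2 * (η * (1 + |y|) ^ (2 * q + e))
          + K₁ * (η * (1 + |y|) ^ (2 * q + e)) := by
        rw [g1, g2]
        gcongr
        exact hn1.trans (le_mul_of_one_le_right hη0.le g5)
      _ = _ := by rw [hK₂]; ring
  have hu3 : |u| ≤ c / 2 * (y / 2) ^ (2 * q) + K₂ := by
    have g1 : n * (K * |t| ^ (2 * q + e)) = K * |t| ^ e * (y / 2) ^ (2 * q) := by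
      rw [← hnt]; ring
    have g2 : K * |t| ^ e ≤ c / 2 := (mul_le_mul_of_nonneg_left hte hK0).trans b6
    have g3 : K * |t| ^ e ≤ K := mul_le_of_le_one_right hK0 (hte.trans b4)
    have g4 : K₁ * (1 / n) ≤ K₁ := mul_le_of_le_one_right hK₁0 hn2
    have g5 := mul_le_mul_of_nonneg_right g2 hY0
    rw [hK₂]
    linarith
  have hRe : R = limitDensity c q y * Real.exp u := by
    rw [limitDensity, ← Real.exp_add, hu, neg_mul, neg_add_cancel_comm_assoc, Real.exp_log hRpos]
  have hdom : limitDensity c q y * Real.exp |u| ≤ Real.exp K₂ * limitDensity (c / 2) q y := by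
    rw [limitDensity, limitDensity, ← Real.exp_add, ← Real.exp_add, Real.exp_le_exp]
    linarith
  calc |R - limitDensity c q y| = limitDensity c q y * |Real.exp u - 1| := by
        rw [hRe, ← mul_sub_one, abs_mul, abs_of_pos (limitDensity_pos c q y)]
    _ ≤ limitDensity c q y * (|u| * Real.exp |u|) :=
        mul_le_mul_of_nonneg_left (abs_exp_sub_one_le_mul_exp u) (limitDensity_pos c q y).le
    _ = (limitDensity c q y * Real.exp |u|) * |u| := by ring
    _ ≤ (Real.exp K₂ * limitDensity (c / 2) q y) * (η * (K₂ * (1 + |y|) ^ (2 * q + e))) :=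
        mul_le_mul hdom hu2 (abs_nonneg _)
          (mul_nonneg (Real.exp_pos _).le (limitDensity_pos _ q y).le)
    _ = (Real.exp K₂ * K₂ * η) * ((1 + |y|) ^ (2 * q + e) * limitDensity (c / 2) q y) := by ring
    _ ≤ (Real.exp K₂ * K₂ * η) * (C * Real.exp (-|y|)) :=
        mul_le_mul_of_nonneg_left (hC y) (by positivity)
    _ = _ := by ring

/-! ### Sums over a neighbourhood of a maximizer -/

open Classical in
-- Extending the weights by zero to all of `ℤ` costs only the density outside the window. There `1 +
-- |y| ≥ 2 δ₀ N`, so `N^e` times the density is still `O(exp (-|y|))`.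
lemma exists_window_extension {β h a c : ℝ} {q e : ℕ} (H : LocalExpansion β h a c q e) {δ : ℝ}
    (hδ : 0 < δ) : ∃ δ₀ C : ℝ, 0 < δ₀ ∧ δ₀ ≤ δ ∧ 0 ≤ C ∧
      ∀ (n : ℕ) (N : ℝ), 1 ≤ n → 1 ≤ N → N ^ (2 * q) = n → ∃ (V : ℤ → ℝ) (K : Finset ℤ),
        (∀ k ∉ K, V k = 0) ∧
        (∀ k : ℤ, |V k - limitDensity c q (2 * N / n * k + -(2 * N * a))|
          ≤ C * (N ^ e)⁻¹ * Real.exp (-|2 * N / n * k + -(2 * N * a)|)) ∧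
        ∀ G : ℝ → ℝ, ∑ k ∈ K, V k * G (2 * N / n * k + -(2 * N * a))
          = ∑ k ∈ (Finset.range (n + 1)).filter fun k : ℕ => |(k : ℝ) / n - a| ≤ δ₀,
            spinWeight β h n k / peak β h a n * G (2 * N * (k / n - a)) := by
  have hc := H.coeff_pos
  have hq : 1 ≤ q := by have := H.e_lt; omega
  obtain ⟨δ₀, C₁, hδ₀, hδ₀δ, hδa, hδb, hC₁, hw⟩ := exists_window_bound H hδ
  obtain ⟨C₂, hC₂0, hC₂⟩ := exists_pow_mul_limitDensity_le hc hq e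
  refine ⟨δ₀, C₁ + C₂ * ((2 * δ₀) ^ e)⁻¹, hδ₀, hδ₀δ, by positivity, ?_⟩
  intro n N hn hN hNn
  have hn' : (0 : ℝ) < n := by exact_mod_cast hn
  have hN0 : 0 < N := by linarith
  have hy : ∀ x : ℝ, 2 * N / n * x + -(2 * N * a) = 2 * N * (x / n - a) := by
    intro x; field_simp; ring
  simp only [hy]
  set V : ℤ → ℝ := fun k => if |(k : ℝ) / n - a| ≤ δ₀ then
    spinWeight β h n k.toNat / peak β h a n else 0 with hV
  -- Since `δ₀ < a` and `δ₀ < 1 - a`, window points satisfy `0 ≤ k ≤ n`, so `toNat` loses nothing.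
  have hwin : ∀ k : ℤ, |(k : ℝ) / n - a| ≤ δ₀ → 0 ≤ k ∧ k ≤ n := by
    intro k hk
    have hk' := abs_le.1 hk
    have h1 : 0 < (k : ℝ) / n := by linarith
    have h2 : (k : ℝ) / n < 1 := by linarith
    rw [div_lt_one hn'] at h2
    have h3 : (0 : ℝ) < k := by
      have := mul_pos h1 hn'
      rwa [div_mul_cancel₀ _ hn'.ne'] at this
    exact ⟨by exact_mod_cast h3.le, by exact_mod_cast h2.le⟩
  refine ⟨V, (Finset.range (n + 1)).map Nat.castEmbedding, ?_, ?_, ?_⟩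
  · intro k hk
    rw [hV]
    refine if_neg fun hk' => hk ?_
    obtain ⟨h1, h2⟩ := hwin k hk'
    lift k to ℕ using h1
    simp only [Finset.mem_map, Finset.mem_range]
    exact ⟨k, by omega, rfl⟩
  · intro k
    by_cases hk : |(k : ℝ) / n - a| ≤ δ₀
    · obtain ⟨h1, h2⟩ := hwin k hk
      lift k to ℕ using h1
      simp only [hV, if_pos hk, Int.toNat_natCast]
      simp only [Int.cast_natCast] at hk ⊢
      refine (hw n N hn hN hNn k hk).trans ?_
      gcongr
      have : 0 ≤ C₂ * ((2 * δ₀) ^ e)⁻¹ := by positivity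
      linarith
    · simp only [hV, if_neg hk, zero_sub, abs_neg, abs_of_pos (limitDensity_pos _ _ _)]
      set y := 2 * N * ((k : ℝ) / n - a) with hy
      have hyN : 2 * δ₀ * N ≤ 1 + |y| := by
        rw [hy, abs_mul, abs_of_pos (by positivity : 0 < 2 * N)]
        have := mul_le_mul_of_nonneg_left (not_le.1 hk).le (by positivity : 0 ≤ 2 * N)
        linarith
      have h1 := pow_le_pow_left₀ (by positivity) hyN e
      have h2 := (mul_le_mul_of_nonneg_right h1 (limitDensity_pos c q y).le).trans (hC₂ y)
      rw [mul_pow] at h2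
      have h3 : limitDensity c q y ≤ C₂ * ((2 * δ₀) ^ e)⁻¹ * (N ^ e)⁻¹ * Real.exp (-|y|) := by
        have : C₂ * ((2 * δ₀) ^ e)⁻¹ * (N ^ e)⁻¹ * Real.exp (-|y|)
            = (C₂ * Real.exp (-|y|)) / ((2 * δ₀) ^ e * N ^ e) := by field_simp
        rw [this, le_div_iff₀ (by positivity)]
        linarith
      refine h3.trans ?_
      gcongr
      linarith
  · intro G
    rw [Finset.sum_map, Finset.sum_filter]
    refine Finset.sum_congr rfl fun k _ => ?_
    simp [hV]

lemma exists_gap {β h A₀ : ℝ} {T : Set ℝ} (hT : IsClosed T)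
    (hlt : ∀ x ∈ Set.Icc (0 : ℝ) 1 ∩ T, assoc β h x < A₀) :
    ∃ κ : ℝ, 0 < κ ∧ ∀ x ∈ Set.Icc (0 : ℝ) 1 ∩ T, assoc β h x ≤ A₀ - κ := by
  rcases (Set.Icc (0 : ℝ) 1 ∩ T).eq_empty_or_nonempty with he | hne
  · exact ⟨1, one_pos, fun x hx => by rw [he] at hx; exact absurd hx (Set.notMem_empty x)⟩
  · obtain ⟨x, hx, hmax⟩ := (isCompact_Icc.inter_right hT).exists_isMaxOn hne
      (continuous_assoc β h).continuousOn
    refine ⟨A₀ - assoc β h x, sub_pos.2 (hlt x hx), fun z hz => ?_⟩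
    rw [sub_sub_cancel]
    exact hmax hz

lemma pow_mul_exp_neg_le {κ : ℝ} (hκ : 0 < κ) (j n : ℕ) :
    (n : ℝ) ^ j * Real.exp (-(κ * n)) ≤ j.factorial / κ ^ j := by
  have h := Real.pow_div_factorial_le_exp (κ * n) (by positivity) j
  rw [div_le_iff₀ (by positivity), mul_pow] at h
  rw [Real.exp_neg, ← div_eq_mul_inv, div_le_div_iff₀ (Real.exp_pos _) (by positivity)]
  linarith

lemma spinWeight_div_peak_le {β h a κ : ℝ} (ha0 : 0 < a) (ha1 : a < 1) {n k : ℕ} (hn : 1 ≤ n)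
    (hk : k ≤ n) (hA : assoc β h (k / n) ≤ assoc β h a - κ) :
    spinWeight β h n k / peak β h a n ≤ 7 * n * Real.exp (-(κ * n)) := by
  have hn' : (1 : ℝ) ≤ n := by exact_mod_cast hn
  have ha1' : 0 < 1 - a := by linarith
  rw [div_le_iff₀ (peak_pos β h ha0 ha1 (by omega)), peak, mul_div_assoc', le_div_iff₀
    (by positivity)]
  have hs : √(2 * Real.pi * n * (a * (1 - a))) ≤ 7 * n := by
    refine Real.sqrt_le_iff.2 ⟨by positivity, ?_⟩
    have h1 : a * (1 - a) ≤ 1 := by nlinarith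
    have h2 : 2 * Real.pi * n * (a * (1 - a)) ≤ 2 * Real.pi * n * 1 := by gcongr
    have := Real.pi_lt_four
    nlinarith
  have hw := (spinWeight_le (by omega : n ≠ 0) hk β h).trans (Real.exp_le_exp.2
    (mul_le_mul_of_nonneg_left hA (by positivity : (0 : ℝ) ≤ n)))
  calc spinWeight β h n k * √(2 * Real.pi * n * (a * (1 - a)))
      ≤ Real.exp (n * (assoc β h a - κ)) * (7 * n) := by gcongr
    _ = _ := by
      rw [mul_assoc (7 * (n : ℝ)), ← Real.exp_add]
      ring_nf

/-- At most `2 n` terms, each at most `7 n exp (-κ n) · B n^j`. One further power of `n` is traded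
for the factor `1 / n`, whence the exponent `j + 3`. -/
lemma exists_far_sum_le {β h a : ℝ} (ha0 : 0 < a) (ha1 : a < 1) {κ : ℝ} (hκ : 0 < κ) (B : ℝ)
    (hB : 0 ≤ B) (j : ℕ) :
    ∃ C : ℝ, 0 ≤ C ∧ ∀ (n : ℕ) (s : Finset ℕ) (F : ℕ → ℝ), 1 ≤ n → s ⊆ Finset.range (n + 1) →
      (∀ k ∈ s, assoc β h (k / n) ≤ assoc β h a - κ) → (∀ k ∈ s, |F k| ≤ B * (n : ℝ) ^ j) →
      |∑ k ∈ s, spinWeight β h n k / peak β h a n * F k| ≤ C * (1 / n) := by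
  refine ⟨14 * B * ((j + 3).factorial / κ ^ (j + 3)), by positivity, ?_⟩
  intro n s F hn hs hA hF
  have hn' : (1 : ℝ) ≤ n := by exact_mod_cast hn
  have hterm : ∀ k ∈ s, |spinWeight β h n k / peak β h a n * F k|
      ≤ 7 * n * Real.exp (-(κ * n)) * (B * (n : ℝ) ^ j) := by
    intro k hk
    have hkn : k ≤ n := Nat.lt_succ_iff.1 (Finset.mem_range.1 (hs hk))
    have h0 : 0 ≤ spinWeight β h n k / peak β h a n :=
      div_nonneg (spinWeight_nonneg β h n k) (peak_pos β h ha0 ha1 (by omega)).le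
    rw [abs_mul, abs_of_nonneg h0]
    exact mul_le_mul (spinWeight_div_peak_le ha0 ha1 hn hkn (hA k hk)) (hF k hk) (abs_nonneg _)
      (by positivity)
  have hcard : (s.card : ℝ) ≤ 2 * n := by
    have := Finset.card_le_card hs
    rw [Finset.card_range] at this
    have : (s.card : ℝ) ≤ n + 1 := by exact_mod_cast this
    linarith
  calc |∑ k ∈ s, spinWeight β h n k / peak β h a n * F k|
      ≤ s.card • (7 * n * Real.exp (-(κ * n)) * (B * (n : ℝ) ^ j)) :=
        (Finset.abs_sum_le_sum_abs _ _).trans (Finset.sum_le_card_nsmul _ _ _ hterm)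
    _ ≤ 2 * n * (7 * n * Real.exp (-(κ * n)) * (B * (n : ℝ) ^ j)) := by
        rw [nsmul_eq_mul]; gcongr
    _ = 14 * B * ((n : ℝ) ^ (j + 3) * Real.exp (-(κ * n))) * (1 / n) := by
        field_simp; ring
    _ ≤ _ := by
        gcongr
        exact pow_mul_exp_neg_le hκ (j + 3) n

/-- The point `a` is the only maximizer at distance at most `δ / 2` from `a`. -/
def StrictMaxNear (β h a δ : ℝ) : Prop :=
  ∀ x ∈ Set.Icc (0 : ℝ) 1, x ≠ a → |2 * (x - a)| ≤ δ → assoc β h x < assoc β h a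

lemma nearSum_split {n : ℕ} (hn : 1 ≤ n) (β h a δ δ₀ N : ℝ) (hδ₀ : 2 * δ₀ ≤ δ) (G : ℝ → ℝ) :
    nearSum β h a δ n (fun x => G (N / n * (x - n * (2 * a - 1)))) / peak β h a n
      = ∑ k ∈ (Finset.range (n + 1)).filter (fun k : ℕ => |(k : ℝ) / n - a| ≤ δ₀),
          spinWeight β h n k / peak β h a n * G (2 * N * (k / n - a))
        + ∑ k ∈ (Finset.range (n + 1)).filter
            (fun k : ℕ => |2 * ((k : ℝ) / n - a)| ≤ δ ∧ ¬ |(k : ℝ) / n - a| ≤ δ₀),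
          spinWeight β h n k / peak β h a n * G (2 * N * (k / n - a)) := by
  have hn' : (0 : ℝ) < n := by exact_mod_cast hn
  have e : ∀ k : ℕ, N / n * (2 * (k : ℝ) - n - n * (2 * a - 1)) = 2 * N * (k / n - a) := by
    intro k; field_simp; ring
  simp only [nearSum, Finset.sum_div, e]
  rw [← Finset.sum_filter_add_sum_filter_not _ (fun k : ℕ => |(k : ℝ) / n - a| ≤ δ₀),
    Finset.filter_filter, Finset.filter_filter]
  congr 1
  · refine Finset.sum_congr (Finset.filter_congr fun k _ => ?_) fun k _ => by ring
    refine ⟨fun h => h.2, fun h => ⟨?_, h⟩⟩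
    rw [abs_mul, abs_two]
    linarith
  · exact Finset.sum_congr rfl fun k _ => by ring

/-- Here `e + 1 ≤ 2 q` is essential: the mesh is `2 N / n = 2 N^(1 - 2q)`, so discretization costs
no more than `N^(-e)`. -/
lemma scale_bounds {n q e : ℕ} {N : ℝ} (hn : 1 ≤ n) (hN : 1 ≤ N) (hNn : N ^ (2 * q) = n)
    (he1 : 1 ≤ e) (he : e + 1 ≤ 2 * q) :
    0 < 2 * N / n ∧ 2 * N / n ≤ 2 ∧ 2 * N / n ≤ 2 * (N ^ e)⁻¹ ∧ (1 : ℝ) / n ≤ (N ^ e)⁻¹ ∧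
      (N ^ e)⁻¹ ≤ 1 ∧ N ≤ n := by
  have hn' : (0 : ℝ) < n := by exact_mod_cast hn
  have hN0 : 0 < N := by linarith
  have h1 : 2 * N / n ≤ 2 * (N ^ e)⁻¹ := by
    rw [← hNn, ← div_eq_mul_inv, div_le_div_iff₀ (by positivity) (by positivity)]
    have := pow_le_pow_right₀ hN he
    rw [pow_succ] at this
    linarith
  have h2 : (N ^ e)⁻¹ ≤ 1 := inv_le_one_of_one_le₀ (one_le_pow₀ hN)
  refine ⟨by positivity, by linarith, h1, ?_, h2, ?_⟩
  · rw [← hNn, one_div]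
    exact inv_anti₀ (by positivity) (pow_le_pow_right₀ hN (by omega))
  · rw [← hNn]
    exact le_self_pow₀ hN (by omega)

lemma abs_div_sub_le_one {n k : ℕ} {a : ℝ} (ha0 : 0 < a) (ha1 : a < 1) (hn : 1 ≤ n)
    (hk : k ∈ Finset.range (n + 1)) : |(k : ℝ) / n - a| ≤ 1 ∧ (k : ℝ) / n ∈ Set.Icc (0 : ℝ) 1 := by
  have hn' : (0 : ℝ) < n := by exact_mod_cast hn
  have hk' : (k : ℝ) ≤ n := by exact_mod_cast Nat.lt_succ_iff.1 (Finset.mem_range.1 hk)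
  have h1 : (k : ℝ) / n ≤ 1 := (div_le_one hn').2 hk'
  have h0 : 0 ≤ (k : ℝ) / n := by positivity
  exact ⟨abs_le.2 ⟨by linarith, by linarith⟩, h0, h1⟩

lemma StrictMaxNear.exists_gap {β h a δ : ℝ} (hs : StrictMaxNear β h a δ) {δ₀ : ℝ}
    (hδ₀ : 0 < δ₀) : ∃ κ : ℝ, 0 < κ ∧ ∀ x ∈ Set.Icc (0 : ℝ) 1, |2 * (x - a)| ≤ δ →
      ¬ |x - a| ≤ δ₀ → assoc β h x ≤ assoc β h a - κ := by
  have hT : IsClosed ({x : ℝ | |2 * (x - a)| ≤ δ} ∩ {x | δ₀ ≤ |x - a|}) :=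
    (isClosed_le (by fun_prop) continuous_const).inter
      (isClosed_le continuous_const (by fun_prop))
  obtain ⟨κ, hκ, h1⟩ := FourSpin.exists_gap (β := β) (h := h) (A₀ := assoc β h a) hT
    fun x hx => hs x hx.1 (fun hxa => by
      have h2 : δ₀ ≤ |x - a| := hx.2.2
      rw [hxa, sub_self, abs_zero] at h2
      linarith) hx.2.1
  exact ⟨κ, hκ, fun x hx h2 h3 => h1 x ⟨hx, h2, (not_le.1 h3).le⟩⟩

/-- Laplace's method for the sum near a maximizer, uniformly over Lipschitz observables. -/
theorem exists_nearSum_sub_integral_le {β h a c : ℝ} {q e : ℕ} (H : LocalExpansion β h a c q e)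
    {δ : ℝ} (hδ : 0 < δ) (hs : StrictMaxNear β h a δ) : ∃ C : ℝ, 0 ≤ C ∧
      ∀ (n : ℕ) (N : ℝ), 1 ≤ n → 1 ≤ N → N ^ (2 * q) = n →
        ∀ g : ℝ → ℝ, LipschitzWith 1 g → |g 0| ≤ 1 →
          |2 * N / n * (nearSum β h a δ n (fun x => g (N / n * (x - n * (2 * a - 1))))
            / peak β h a n) - ∫ x, limitDensity c q x * g x| ≤ C * (N ^ e)⁻¹ := by
  have hq : 1 ≤ q := by have := H.e_lt; omega
  -- The radius is halved because `nearSum` measures `|2 (k/n - a)|`.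
  obtain ⟨δ₀, C₀, hδ₀, hδ₀δ, hC₀, hwin⟩ := exists_window_extension H (half_pos hδ)
  obtain ⟨C₁, hC₁, hlat⟩ := exists_lattice_sum_sub_integral_le H.coeff_pos hq C₀ hC₀
  obtain ⟨κ, hκ, hgap⟩ := hs.exists_gap hδ₀
  -- The values `3` and `1` come from `|g(y)| ≤ 1 + |y| ≤ 1 + 2 N ≤ 3 n`.
  obtain ⟨C₂, hC₂, hfar⟩ := exists_far_sum_le (β := β) (h := h) H.pos H.lt_one hκ 3 (by norm_num) 1
  refine ⟨C₁ + 2 * C₂, by positivity, ?_⟩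
  intro n N hn hN hNn g hg hg0
  obtain ⟨s1, s2, s3, s4, s5, s6⟩ := scale_bounds hn hN hNn H.one_le_e H.e_lt
  have hn' : (1 : ℝ) ≤ n := by exact_mod_cast hn
  obtain ⟨V, K, hVK, hV, hsum⟩ := hwin n N hn hN hNn
  have hl := hlat _ _ _ K V s1 s2 s3 hVK hV g hg hg0
  rw [hsum g] at hl
  rw [nearSum_split hn β h a δ δ₀ N (by linarith), mul_add]
  have hf := hfar n ((Finset.range (n + 1)).filter
    (fun k : ℕ => |2 * ((k : ℝ) / n - a)| ≤ δ ∧ ¬ |(k : ℝ) / n - a| ≤ δ₀))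
    (fun k => g (2 * N * (k / n - a))) hn (Finset.filter_subset _ _) ?_ ?_
  · set X := ∑ k ∈ (Finset.range (n + 1)).filter
      (fun k : ℕ => |2 * ((k : ℝ) / n - a)| ≤ δ ∧ ¬ |(k : ℝ) / n - a| ≤ δ₀),
      spinWeight β h n k / peak β h a n * g (2 * N * (k / n - a))
    have hX : |2 * N / n * X| ≤ 2 * C₂ * (N ^ e)⁻¹ := by
      rw [abs_mul, abs_of_pos s1]
      calc 2 * N / n * |X| ≤ 2 * (C₂ * (1 / n)) := mul_le_mul s2 hf (abs_nonneg _) two_pos.le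
        _ ≤ 2 * (C₂ * (N ^ e)⁻¹) := by gcongr
        _ = _ := by ring
    rw [abs_le] at hl hX ⊢
    constructor <;> linarith [hl.1, hl.2, hX.1, hX.2]
  · intro k hk
    obtain ⟨hk1, hk2, hk3⟩ := Finset.mem_filter.1 hk
    exact hgap _ (abs_div_sub_le_one H.pos H.lt_one hn hk1).2 hk2 hk3
  · intro k hk
    have h1 := (abs_div_sub_le_one H.pos H.lt_one hn (Finset.mem_filter.1 hk).1).1
    refine (abs_le_one_add_abs hg hg0 _).trans ?_
    have : |2 * N * ((k : ℝ) / n - a)| ≤ 2 * N * 1 := by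
      rw [abs_mul, abs_of_pos (by linarith : 0 < 2 * N)]; gcongr
    rw [pow_one]
    linarith

theorem exists_nearSum_moment_le {β h a c : ℝ} {q e : ℕ} (H : LocalExpansion β h a c q e)
    {δ : ℝ} (hδ : 0 < δ) (hs : StrictMaxNear β h a δ) (l : ℕ) : ∃ C : ℝ, 0 ≤ C ∧
      ∀ (n : ℕ) (N : ℝ), 1 ≤ n → 1 ≤ N → N ^ (2 * q) = n →
          2 * N / n * (nearSum β h a δ n (fun x => |N / n * (x - n * (2 * a - 1))| ^ l)
            / peak β h a n) ≤ C := by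
  have hq : 1 ≤ q := by have := H.e_lt; omega
  obtain ⟨δ₀, C₀, hδ₀, hδ₀δ, hC₀, hwin⟩ := exists_window_extension H (half_pos hδ)
  obtain ⟨C₁, hC₁, hlat⟩ := exists_lattice_moment_le H.coeff_pos hq C₀ hC₀ l
  obtain ⟨κ, hκ, hgap⟩ := hs.exists_gap hδ₀
  obtain ⟨C₂, hC₂, hfar⟩ := exists_far_sum_le (β := β) (h := h) H.pos H.lt_one hκ (2 ^ l)
    (by positivity) l
  refine ⟨C₁ + 2 * C₂, by positivity, ?_⟩
  intro n N hn hN hNn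
  obtain ⟨s1, s2, s3, s4, s5, s6⟩ := scale_bounds hn hN hNn H.one_le_e H.e_lt
  have hn' : (1 : ℝ) ≤ n := by exact_mod_cast hn
  obtain ⟨V, K, hVK, hV, hsum⟩ := hwin n N hn hN hNn
  have hl := hlat _ _ _ K V s1 s2 (by positivity) s5 hVK hV
  rw [hsum fun x => |x| ^ l] at hl
  rw [nearSum_split hn β h a δ δ₀ N (by linarith) fun x => |x| ^ l, mul_add]
  have hf := hfar n ((Finset.range (n + 1)).filter
    (fun k : ℕ => |2 * ((k : ℝ) / n - a)| ≤ δ ∧ ¬ |(k : ℝ) / n - a| ≤ δ₀))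
    (fun k => |2 * N * (k / n - a)| ^ l) hn (Finset.filter_subset _ _) ?_ ?_
  · refine add_le_add hl ?_
    have h1 : C₂ * (1 / n) ≤ C₂ := mul_le_of_le_one_right hC₂ (s4.trans s5)
    exact mul_le_mul s2 (((le_abs_self _).trans hf).trans h1)
      (Finset.sum_nonneg fun k _ => mul_nonneg (div_nonneg (spinWeight_nonneg β h n k)
        (peak_pos β h H.pos H.lt_one (by omega)).le) (by positivity)) two_pos.le
  · intro k hk
    obtain ⟨hk1, hk2, hk3⟩ := Finset.mem_filter.1 hk
    exact hgap _ (abs_div_sub_le_one H.pos H.lt_one hn hk1).2 hk2 hk3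
  · intro k hk
    have h1 := (abs_div_sub_le_one H.pos H.lt_one hn (Finset.mem_filter.1 hk).1).1
    rw [abs_of_nonneg (by positivity), ← mul_pow]
    refine pow_le_pow_left₀ (abs_nonneg _) ?_ _
    rw [abs_mul, abs_of_pos (by linarith : 0 < 2 * N)]
    calc 2 * N * |(k : ℝ) / n - a| ≤ 2 * N * 1 := by gcongr
      _ ≤ 2 * n := by linarith

/-! ### Wasserstein bounds -/

/-- The magnetization moves by `2` per spin, so the density involves `x / 2`, and `c (x/2)^(2q) = (c
/ 4^q) x^(2q)`. -/
lemma integral_expPowerLaw (c : ℝ) (q : ℕ) (f : ℝ → ℝ) :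
    ∫ x, f x ∂(expPowerLaw (-c / 4 ^ q) (2 * q))
      = (∫ x, limitDensity c q x * f x) / ∫ x, limitDensity c q x := by
  have e : ∀ x : ℝ, Real.exp (-c / 4 ^ q * x ^ (2 * q)) = limitDensity c q x := by
    intro x
    rw [limitDensity, div_pow, pow_mul 2 2 q]
    norm_num
    ring_nf
  rw [expPowerLaw, integral_tilted]
  simp only [e, smul_eq_mul]
  rw [← integral_div]
  congr 1
  ext x
  ring

lemma integrable_limitDensity {c : ℝ} (hc : 0 < c) {q : ℕ} (hq : 1 ≤ q) :
    Integrable (limitDensity c q) := by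
  have := integrable_limitDensity_mul hc hq (g := fun _ => 1)
    ((LipschitzWith.const (1 : ℝ)).weaken zero_le_one) (by simp)
  simpa using this

lemma integral_limitDensity_pos {c : ℝ} (hc : 0 < c) {q : ℕ} (hq : 1 ≤ q) :
    0 < ∫ x, limitDensity c q x :=
  integral_exp_pos (integrable_limitDensity hc hq)

lemma integrable_limitDensity_mul_abs {c : ℝ} (hc : 0 < c) {q : ℕ} (hq : 1 ≤ q) :
    Integrable fun x => limitDensity c q x * |x| :=
  integrable_limitDensity_mul hc hq (lipschitzWith_one_norm (E := ℝ)) (by simp)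

lemma abs_integral_limitDensity_mul_le {c : ℝ} (hc : 0 < c) {q : ℕ} (hq : 1 ≤ q) {g : ℝ → ℝ}
    (hg : ∀ x, |g x| ≤ |x|) :
    |∫ x, limitDensity c q x * g x| ≤ ∫ x, limitDensity c q x * |x| := by
  have := norm_integral_le_of_norm_le (integrable_limitDensity_mul_abs hc hq)
    (f := fun x => limitDensity c q x * g x) (ae_of_all _ fun x => ?_)
  · simpa using this
  · rw [norm_mul, Real.norm_of_nonneg (limitDensity_pos c q x).le, Real.norm_eq_abs]
    exact mul_le_mul_of_nonneg_left (hg x) (limitDensity_pos c q x).le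

lemma abs_div_sub_div_le {X Y x z ε M : ℝ} (hz : 0 < z) (hX : |X - x| ≤ ε)
    (hY : |Y - z| ≤ ε) (hx : |x| ≤ M) (hYz : z / 2 ≤ Y) :
    |X / Y - x / z| ≤ (z + M) * (2 / z ^ 2) * ε := by
  have hY0 : 0 < Y := by linarith
  have hε : 0 ≤ ε := (abs_nonneg _).trans hX
  have hM : 0 ≤ M := (abs_nonneg _).trans hx
  have e : X / Y - x / z = ((X - x) * z - x * (Y - z)) / (Y * z) := by field_simp; ring
  rw [e, abs_div, abs_of_pos (mul_pos hY0 hz), div_le_iff₀ (mul_pos hY0 hz)]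
  have h1 : |(X - x) * z - x * (Y - z)| ≤ (z + M) * ε := by
    refine (abs_sub _ _).trans ?_
    rw [abs_mul, abs_mul, abs_of_pos hz]
    have := mul_le_mul hx hY (abs_nonneg _) hM
    nlinarith
  have h2 : 1 ≤ 2 / z ^ 2 * (Y * z) := by
    rw [div_mul_eq_mul_div, le_div_iff₀ (by positivity)]
    nlinarith
  have h3 : 0 ≤ (z + M) * ε := by positivity
  nlinarith [mul_le_mul_of_nonneg_left h2 h3]

lemma nearSum_one_nonneg (β h a δ : ℝ) (n : ℕ) : 0 ≤ nearSum β h a δ n fun _ => 1 :=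
  Finset.sum_nonneg fun k _ => by simpa using spinWeight_nonneg β h n k

/-- Trivial bound from `|k/n - a| ≤ 1`, used when `N` is too small for the asymptotic estimate. -/
lemma abs_nearSum_le {β h a δ : ℝ} (ha0 : 0 < a) (ha1 : a < 1) {n : ℕ} (hn : 1 ≤ n) {N : ℝ}
    (hN : 0 < N) {g : ℝ → ℝ} (hg : ∀ x, |g x| ≤ |x|) :
    |nearSum β h a δ n fun x => g (N / n * (x - n * (2 * a - 1)))|
      ≤ 2 * N * nearSum β h a δ n fun _ => 1 := by
  have hn' : (0 : ℝ) < n := by exact_mod_cast hn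
  rw [nearSum, nearSum, Finset.mul_sum]
  refine (Finset.abs_sum_le_sum_abs _ _).trans (Finset.sum_le_sum fun k hk => ?_)
  have h1 := (abs_div_sub_le_one ha0 ha1 hn (Finset.mem_filter.1 hk).1).1
  rw [abs_mul, abs_of_nonneg (spinWeight_nonneg β h n k), mul_one, mul_comm]
  refine mul_le_mul_of_nonneg_right ((hg _).trans ?_) (spinWeight_nonneg β h n k)
  have e : N / n * (2 * (k : ℝ) - n - n * (2 * a - 1)) = 2 * N * (k / n - a) := by
    field_simp; ring
  rw [e, abs_mul, abs_of_pos (by linarith : 0 < 2 * N)]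
  exact mul_le_of_le_one_right (by linarith) h1

lemma nearSum_sub_const (β h a δ : ℝ) (n : ℕ) (F : ℝ → ℝ) (r : ℝ) :
    nearSum β h a δ n (fun x => F x - r)
      = nearSum β h a δ n F - r * nearSum β h a δ n fun _ => 1 := by
  simp only [nearSum, mul_sub, Finset.sum_sub_distrib, Finset.mul_sum]
  congr 1
  exact Finset.sum_congr rfl fun k _ => by ring

/-- The conditional expectations of Lipschitz observables near a maximizer. -/
theorem exists_nearSum_ratio_le {β h a c : ℝ} {q e : ℕ} (H : LocalExpansion β h a c q e)
    {δ : ℝ} (hδ : 0 < δ) (hs : StrictMaxNear β h a δ) : ∃ C : ℝ, 0 ≤ C ∧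
      ∀ (n : ℕ) (N : ℝ), 1 ≤ n → 1 ≤ N → N ^ (2 * q) = n →
        0 < nearSum β h a δ n (fun _ => 1) → ∀ f : ℝ → ℝ, LipschitzWith 1 f →
          |nearSum β h a δ n (fun x => f (N / n * (x - n * (2 * a - 1))))
            / nearSum β h a δ n (fun _ => 1) - ∫ x, f x ∂(expPowerLaw (-c / 4 ^ q) (2 * q))|
              ≤ C * (N ^ e)⁻¹ := by
  have hc := H.coeff_pos
  have hq : 1 ≤ q := by have := H.e_lt; omega
  obtain ⟨C, hC0, hC⟩ := exists_nearSum_sub_integral_le H hδ hs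
  set Z := ∫ x, limitDensity c q x with hZ
  have hZ0 : 0 < Z := integral_limitDensity_pos hc hq
  set M := ∫ x, limitDensity c q x * |x| with hM
  have hM0 : 0 ≤ M := integral_nonneg fun x => mul_nonneg (limitDensity_pos c q x).le (abs_nonneg x)
  set D₁ := (Z + M) * (2 / Z ^ 2) * C with hD₁
  set D₂ := (4 * C / Z + M / Z) * (2 * C / Z) with hD₂
  have hD₁0 : 0 ≤ D₁ := by positivity
  have hD₂0 : 0 ≤ D₂ := by positivity
  refine ⟨D₁ + D₂, by positivity, ?_⟩
  intro n N hn hN hNn hpos f hf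
  -- Constants cancel in the difference of expectations, and `|g x| ≤ |x|` holds uniformly in `f`.
  set g : ℝ → ℝ := fun x => f x - f 0 with hg
  have hgL : LipschitzWith 1 g := LipschitzWith.of_dist_le_mul fun x y => by
    simpa [hg, Real.dist_eq] using hf.dist_le_mul x y
  have hg0 : |g 0| ≤ 1 := by simp [hg]
  have hgx : ∀ x, |g x| ≤ |x| := fun x => by
    simpa [hg, Real.dist_eq] using hf.dist_le_mul x 0
  have hX := hC n N hn hN hNn g hgL hg0
  have hY := hC n N hn hN hNn (fun _ => 1)
    ((LipschitzWith.const (1 : ℝ)).weaken zero_le_one) (by simp)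
  simp only [mul_one] at hY
  rw [← hZ] at hY
  obtain ⟨s1, -, -, -, -, -⟩ := scale_bounds hn hN hNn H.one_le_e H.e_lt
  have hpk := peak_pos β h H.pos H.lt_one (by omega : n ≠ 0)
  set S₁ := nearSum β h a δ n (fun _ => 1) with hS₁
  set Sg := nearSum β h a δ n (fun x => g (N / n * (x - n * (2 * a - 1)))) with hSg
  set x₀ := ∫ x, limitDensity c q x * g x with hx₀
  have hx₀M : |x₀| ≤ M := abs_integral_limitDensity_mul_le hc hq hgx
  have hη : 0 < (N ^ e)⁻¹ := by positivity
  have hratio : nearSum β h a δ n (fun x => f (N / n * (x - n * (2 * a - 1)))) / S₁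
      - ∫ x, f x ∂(expPowerLaw (-c / 4 ^ q) (2 * q)) = Sg / S₁ - x₀ / Z := by
    have e1 : Sg = nearSum β h a δ n (fun x => f (N / n * (x - n * (2 * a - 1)))) - f 0 * S₁ :=
      nearSum_sub_const β h a δ n _ (f 0)
    have hfint : Integrable fun x => limitDensity c q x * f x := by
      have h1 := (integrable_limitDensity_mul hc hq hgL hg0).add
        ((integrable_limitDensity hc hq).mul_const (f 0))
      refine h1.congr (ae_of_all _ fun x => ?_)
      simp only [hg, Pi.add_apply]
      ring
    have e2 : x₀ = (∫ x, limitDensity c q x * f x) - Z * f 0 := by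
      rw [hx₀, hZ, ← integral_mul_const, ← integral_sub hfint
        ((integrable_limitDensity hc hq).mul_const (f 0))]
      congr 1
      ext x
      simp only [hg]
      ring
    rw [integral_expPowerLaw, e1, e2, ← hZ]
    field_simp
    ring
  rw [hratio]
  have hXY : Sg / S₁ = (2 * N / n * (Sg / peak β h a n)) / (2 * N / n * (S₁ / peak β h a n)) := by
    rw [mul_div_mul_left _ _ s1.ne', div_div_div_cancel_right₀ hpk.ne']
  -- If the error is small, the denominator is at least `Z / 2` and the quotients compare. Otherwise
  -- `N ≤ N ^ e < 2 C / Z` is bounded and trivial bounds suffice, so the estimate has no threshold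
  -- on `n`.
  by_cases hcase : C * (N ^ e)⁻¹ ≤ Z / 2
  · rw [hXY]
    refine (abs_div_sub_div_le hZ0 hX hY hx₀M ?_).trans ?_
    · have := (abs_le.1 (hY.trans hcase)).1
      linarith
    · rw [← mul_assoc]
      exact mul_le_mul_of_nonneg_right (by linarith) hη.le
  · have hN0 : 0 < N := by linarith
    have hNe : N ≤ N ^ e := le_self_pow₀ hN (by have := H.one_le_e; omega)
    have hlt : Z / 2 < C * (N ^ e)⁻¹ := not_le.1 hcase
    have hNC : N ≤ 2 * C / Z := by
      rw [← div_eq_mul_inv, lt_div_iff₀ (by positivity)] at hlt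
      rw [le_div_iff₀ hZ0]
      nlinarith
    have h1 : |Sg / S₁| ≤ 2 * N := by
      rw [abs_div, abs_of_pos hpos, div_le_iff₀ hpos]
      exact abs_nearSum_le H.pos H.lt_one hn hN0 hgx
    have h2 : |x₀ / Z| ≤ M / Z := by
      rw [abs_div, abs_of_pos hZ0]
      gcongr
    have h3 : 1 ≤ 2 * C / Z * (N ^ e)⁻¹ := by
      rw [div_mul_eq_mul_div, le_div_iff₀ hZ0]
      linarith
    have h4 : 4 * C / Z + M / Z ≤ D₂ * (N ^ e)⁻¹ := by
      rw [hD₂, mul_assoc]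
      exact le_mul_of_one_le_right (by positivity) h3
    have h5 : 2 * N ≤ 4 * C / Z := by
      have : 4 * C / Z = 2 * (2 * C / Z) := by ring
      linarith
    calc |Sg / S₁ - x₀ / Z| ≤ |Sg / S₁| + |x₀ / Z| := abs_sub _ _
      _ ≤ 4 * C / Z + M / Z := by linarith
      _ ≤ D₂ * (N ^ e)⁻¹ := h4
      _ ≤ _ := mul_le_mul_of_nonneg_right (by linarith) hη.le

lemma integral_scaledLaw {n : ℕ} (μ : Measure (Config n)) (r a : ℝ) {f : ℝ → ℝ}
    (hf : LipschitzWith 1 f) : ∫ x, f x ∂(scaledLaw μ r a)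
      = ∫ ω, f ((n : ℝ) ^ (-r) * (magnetization ω - n * (2 * a - 1))) ∂μ :=
  integral_map (measurable_of_finite _).aemeasurable hf.continuous.aestronglyMeasurable

lemma wassersteinDist_le {μ ν : Measure ℝ} {C : ℝ}
    (hC : ∀ f : ℝ → ℝ, LipschitzWith 1 f → |∫ x, f x ∂μ - ∫ x, f x ∂ν| ≤ C) :
    wassersteinDist μ ν ≤ ENNReal.ofReal C :=
  iSup₂_le fun f hf => ENNReal.ofReal_le_ofReal (hC f hf)

lemma rpow_scale {n q : ℕ} (hn : 1 ≤ n) (hq : 1 ≤ q) {r : ℝ} (hr : r = 1 - 1 / (2 * q)) :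
    (n : ℝ) ^ (-r) = (n : ℝ) ^ (1 / (2 * q) : ℝ) / n ∧ 1 ≤ (n : ℝ) ^ (1 / (2 * q) : ℝ) ∧
      ((n : ℝ) ^ (1 / (2 * q) : ℝ)) ^ (2 * q) = n := by
  have hn' : (0 : ℝ) < n := by exact_mod_cast hn
  have hq' : (0 : ℝ) < q := by exact_mod_cast hq
  refine ⟨?_, Real.one_le_rpow (by exact_mod_cast hn) (by positivity), ?_⟩
  · rw [hr, neg_sub, Real.rpow_sub hn', Real.rpow_one]
  · rw [← Real.rpow_natCast, ← Real.rpow_mul hn'.le]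
    push_cast
    rw [one_div_mul_cancel (by positivity), Real.rpow_one]

theorem exists_wassersteinDist_cond_le {β h a c : ℝ} {q e : ℕ} (H : LocalExpansion β h a c q e)
    {δ : ℝ} (hδ : 0 < δ) (hs : StrictMaxNear β h a δ) {r : ℝ} (hr : r = 1 - 1 / (2 * q)) :
    ∃ C : ℝ, 0 ≤ C ∧ ∀ n : ℕ, 1 ≤ n → 0 < nearSum β h a δ n (fun _ => 1) →
      wassersteinDist (scaledLaw ((gibbs n β h)[|near n a δ]) r a)
        (expPowerLaw (-c / 4 ^ q) (2 * q))
          ≤ ENNReal.ofReal (C * (((n : ℝ) ^ (1 / (2 * q) : ℝ)) ^ e)⁻¹) := by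
  have hq : 1 ≤ q := by have := H.e_lt; omega
  obtain ⟨C, hC0, hC⟩ := exists_nearSum_ratio_le H hδ hs
  refine ⟨C, hC0, fun n hn hpos => wassersteinDist_le fun f hf => ?_⟩
  obtain ⟨h1, h2, h3⟩ := rpow_scale hn hq hr
  rw [integral_scaledLaw _ _ _ hf, h1, integral_cond_near (by omega) β h a δ
    (fun x => f ((n : ℝ) ^ (1 / (2 * q) : ℝ) / n * (x - n * (2 * a - 1))))]
  exact hC n _ hn h2 h3 hpos f hf

/-- If this sum vanished, the total mass `1` would be `0 / 0 = 0`. -/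
lemma nearSum_half_one_pos (β h : ℝ) {n : ℕ} (hn : 1 ≤ n) :
    0 < nearSum β h (1 / 2) 1 n fun _ => 1 := by
  have h1 := integral_gibbs_eq_nearSum (by omega : n ≠ 0) β h fun _ => 1
  refine lt_of_le_of_ne (nearSum_one_nonneg β h (1 / 2) 1 n) fun h0 => ?_
  rw [← h0] at h1
  simp at h1

theorem exists_wassersteinDist_gibbs_le {β h c : ℝ} {q e : ℕ}
    (H : LocalExpansion β h (1 / 2) c q e) (hs : StrictMaxNear β h (1 / 2) 1) {r : ℝ}
    (hr : r = 1 - 1 / (2 * q)) : ∃ C : ℝ, 0 ≤ C ∧ ∀ n : ℕ, 1 ≤ n →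
      wassersteinDist (scaledLaw (gibbs n β h) r (1 / 2))
        (expPowerLaw (-c / 4 ^ q) (2 * q))
          ≤ ENNReal.ofReal (C * (((n : ℝ) ^ (1 / (2 * q) : ℝ)) ^ e)⁻¹) := by
  have hq : 1 ≤ q := by have := H.e_lt; omega
  obtain ⟨C, hC0, hC⟩ := exists_nearSum_ratio_le H one_pos hs
  refine ⟨C, hC0, fun n hn => wassersteinDist_le fun f hf => ?_⟩
  obtain ⟨h1, h2, h3⟩ := rpow_scale hn hq hr
  rw [integral_scaledLaw _ _ _ hf, h1, integral_gibbs_eq_nearSum (by omega) β h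
    (fun x => f ((n : ℝ) ^ (1 / (2 * q) : ℝ) / n * (x - n * (2 * (1 / 2) - 1))))]
  exact hC n _ hn h2 h3 (nearSum_half_one_pos β h hn) f hf

/-! ### The local expansions -/

/-- One integration of a power bound; repeated use gives a Taylor estimate, without the factorial
gain. -/
lemma abs_le_of_abs_deriv_le {F F' : ℝ → ℝ} {δ B : ℝ} (hB : 0 ≤ B) {j : ℕ}
    (hF : ∀ t, |t| ≤ δ → HasDerivAt F (F' t) t) (h0 : F 0 = 0)
    (hF' : ∀ t, |t| ≤ δ → |F' t| ≤ B * |t| ^ j) :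
    ∀ t, |t| ≤ δ → |F t| ≤ B * |t| ^ (j + 1) := by
  intro t ht
  have hs : ∀ s ∈ Set.uIcc 0 t, |s| ≤ |t| := fun s hs => by
    simpa using Set.abs_sub_left_of_mem_uIcc hs
  have := (convex_uIcc 0 t).norm_image_sub_le_of_norm_hasDerivWithin_le (f := F)
    (C := B * |t| ^ j) (fun s hs' => (hF s ((hs s hs').trans ht)).hasDerivWithinAt)
    (fun s hs' => (hF' s ((hs s hs').trans ht)).trans 
      (mul_le_mul_of_nonneg_left (pow_le_pow_left₀ (abs_nonneg _) (hs s hs') _) hB))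
    Set.left_mem_uIcc Set.right_mem_uIcc
  rw [h0, sub_zero, sub_zero, Real.norm_eq_abs, Real.norm_eq_abs] at this
  rw [pow_succ]
  linarith

lemma exists_entropy_prefactor_bound {a : ℝ} (ha0 : 0 < a) (ha1 : a < 1) {δ : ℝ} (hδa : δ < a)
    (hδb : δ < 1 - a) : ∃ K : ℝ, 0 ≤ K ∧ ∀ t, |t| ≤ δ →
      |Real.log ((a + t) * (1 - (a + t))) - Real.log (a * (1 - a))| ≤ K * |t| ^ 1 := by
  have hmem : ∀ t, |t| ≤ δ → 0 < a + t ∧ 0 < 1 - (a + t) := fun t ht => by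
    have := abs_le.1 ht
    constructor <;> linarith
  obtain ⟨K, hK⟩ := (isCompact_Icc (a := -δ) (b := δ)).exists_bound_of_continuousOn
    (f := fun t => (a + t)⁻¹ - (1 - (a + t))⁻¹) (by
      refine ContinuousOn.sub (ContinuousOn.inv₀ (by fun_prop) fun t ht => ?_)
        (ContinuousOn.inv₀ (by fun_prop) fun t ht => ?_)
      · exact (hmem t (abs_le.2 ht)).1.ne'
      · exact (hmem t (abs_le.2 ht)).2.ne')
  refine ⟨max K 0, le_max_right _ _, fun t ht => ?_⟩
  have := abs_le_of_abs_deriv_le (F := fun t => (Real.log (a + t) + Real.log (1 - (a + t)))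
    - (Real.log a + Real.log (1 - a))) (F' := fun t => (a + t)⁻¹ - (1 - (a + t))⁻¹)
    (δ := δ) (le_max_right K 0) (j := 0) (fun s hs => ?_) (by simp) (fun s hs => ?_) t ht
  · obtain ⟨h1, h2⟩ := hmem t ht
    rw [Real.log_mul h1.ne' h2.ne', Real.log_mul ha0.ne' (by linarith)]
    exact this
  · obtain ⟨h1, h2⟩ := hmem s hs
    have d1 : HasDerivAt (fun s : ℝ => a + s) 1 s := (hasDerivAt_id s).const_add a
    have d2 : HasDerivAt (fun s : ℝ => 1 - (a + s)) (-1) s := d1.const_sub 1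
    refine (((d1.log h1.ne').add (d2.log h2.ne')).sub_const _).congr_deriv ?_
    ring
  · rw [pow_zero, mul_one]
    exact (hK s (abs_le.1 hs)).trans (le_max_left _ _)

/-- The third derivative is bounded on a compact neighbourhood and integrated three times; `A'(a) =
0` removes the linear term. -/
lemma localExpansion_of_twoRegular {β h a : ℝ} (ha0 : 0 < a) (ha1 : a < 1)
    (hr : TwoRegular β h a) :
    LocalExpansion β h a (-iteratedDeriv 2 (assoc β h) a / 2) 1 1 := by
  have hneg := hr.2
  rw [twoRegular_iff ha0 ha1] at hr
  have e2 := iteratedDeriv_assoc β h ha0 ha1 (j := 2) (by norm_num)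
  refine ⟨ha0, ha1, by linarith, le_rfl, by norm_num, ?_⟩
  set δ := min a (1 - a) / 2 with hδ
  have hm : 0 < min a (1 - a) := lt_min ha0 (by linarith)
  have hδ0 : 0 < δ := half_pos hm
  have hδa : δ < a := by rw [hδ]; linarith [min_le_left a (1 - a)]
  have hδb : δ < 1 - a := by rw [hδ]; linarith [min_le_right a (1 - a)]
  have hmem : ∀ t, |t| ≤ δ → 0 < a + t ∧ a + t < 1 := fun t ht => by
    have := abs_le.1 ht
    constructor <;> linarith
  obtain ⟨K₁, hK₁0, hK₁⟩ := exists_entropy_prefactor_bound ha0 ha1 hδa hδb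
  have hD : ∀ j < 6, ∀ t, |t| ≤ δ →
      HasDerivAt (fun t => assocDeriv β h j (a + t)) (assocDeriv β h (j + 1) (a + t)) t := by
    intro j hj t ht
    obtain ⟨h1, h2⟩ := hmem t ht
    have d1 : HasDerivAt (fun s : ℝ => a + s) 1 t := (hasDerivAt_id t).const_add a
    exact ((hasDerivAt_assocDeriv β h h1 h2 j hj).comp t d1).congr_deriv (mul_one _)
  obtain ⟨K₂, hK₂⟩ := (isCompact_Icc (a := -δ) (b := δ)).exists_bound_of_continuousOn
    (f := fun t => assocDeriv β h 3 (a + t)) fun t ht =>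
      (hD 3 (by norm_num) t (abs_le.2 ht)).continuousAt.continuousWithinAt
  set B := max K₂ 0 with hB
  have hB0 : 0 ≤ B := le_max_right _ _
  have b2 := abs_le_of_abs_deriv_le (F := fun t => assocDeriv β h 2 (a + t) - assocDeriv β h 2 a)
    (F' := fun t => assocDeriv β h 3 (a + t)) (δ := δ) hB0 (j := 0)
    (fun t ht => (hD 2 (by norm_num) t ht).sub_const _) (by simp) fun t ht => by
      rw [pow_zero, mul_one]
      exact (hK₂ t (abs_le.1 ht)).trans (le_max_left _ _)
  have b1 := abs_le_of_abs_deriv_le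
    (F := fun t => assocDeriv β h 1 (a + t) - assocDeriv β h 2 a * t)
    (F' := fun t => assocDeriv β h 2 (a + t) - assocDeriv β h 2 a) (δ := δ) hB0 (j := 1)
    (fun t ht => ((hD 1 (by norm_num) t ht).sub ((hasDerivAt_id' t).const_mul _)).congr_deriv
      (by rw [mul_one])) (by simp [hr.1]) b2
  have b0 := abs_le_of_abs_deriv_le
    (F := fun t => assocDeriv β h 0 (a + t) - assocDeriv β h 0 a - assocDeriv β h 2 a / 2 * t ^ 2)
    (F' := fun t => assocDeriv β h 1 (a + t) - assocDeriv β h 2 a * t) (δ := δ) hB0 (j := 2)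
    (fun t ht => (((hD 0 (by norm_num) t ht).sub_const _).sub
      ((hasDerivAt_pow 2 t).const_mul _)).congr_deriv (by push_cast; ring)) (by simp) b1
  refine ⟨max B K₁, δ, hB0.trans (le_max_left _ _), hδ0, fun t ht => ⟨?_, ?_⟩⟩
  · have h1 := b0 t ht
    have e : assoc β h (a + t) - assoc β h a + -iteratedDeriv 2 (assoc β h) a / 2 * t ^ (2 * 1)
        = assocDeriv β h 0 (a + t) - assocDeriv β h 0 a - assocDeriv β h 2 a / 2 * t ^ 2 := by
      rw [e2]; simp only [assocDeriv]; ring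
    rw [e]
    exact h1.trans (mul_le_mul_of_nonneg_right (le_max_left _ _) (by positivity))
  · exact (hK₁ t ht).trans (mul_le_mul_of_nonneg_right (le_max_right _ _) (by positivity))

/-- At `1/2` the prefactor is `(1 - 4 t²) / 4`, even in `t`, so its error is quadratic. This permits
`e = 2` at the degenerate points. -/
lemma abs_log_prefactor_half_le {t : ℝ} (ht : |t| ≤ 1 / 4) :
    |Real.log ((1 / 2 + t) * (1 - (1 / 2 + t))) - Real.log (1 / 2 * (1 - 1 / 2))|
      ≤ 8 * |t| ^ 2 := by
  have ht2 : t ^ 2 ≤ 1 / 16 := by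
    rw [← sq_abs]
    have := pow_le_pow_left₀ (abs_nonneg t) ht 2
    norm_num at this ⊢
    exact this
  have h1 : 0 < 1 - 4 * t ^ 2 := by linarith
  rw [show (1 / 2 + t) * (1 - (1 / 2 + t)) = (1 - 4 * t ^ 2) * (1 / 2 * (1 - 1 / 2)) by ring,
    Real.log_mul h1.ne' (by norm_num), add_sub_cancel_right, sq_abs]
  have h2 := Real.one_sub_inv_le_log_of_pos h1
  have h3 := Real.log_nonpos h1.le (by linarith [sq_nonneg t])
  have h4 : (1 - 4 * t ^ 2)⁻¹ ≤ 1 + 8 * t ^ 2 := by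
    rw [inv_le_iff_one_le_mul₀ h1]
    nlinarith [sq_nonneg t]
  rw [abs_of_nonpos h3]
  linarith

/-- The entropy series with `m = 2 t`; at `h = 1/2` the quadratic term cancels, and `256 = 2⁸` comes
from the `m⁸` remainder. -/
lemma assoc_half_add (β : ℝ) {t : ℝ} (ht : |t| ≤ 1 / 4) :
    |assoc β (1 / 2) (1 / 2 + t) - assoc β (1 / 2) (1 / 2) + 16 * (1 / 12 - β) * t ^ 4
      + 64 / 30 * t ^ 6| ≤ 256 * t ^ 8 := by
  obtain ⟨h1, h2⟩ := abs_le.1 ht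
  have l1 := log_two_sub_binEntropy_ge (a := 1 / 2 + t) ⟨by linarith, by linarith⟩
  have l2 := log_two_sub_binEntropy_le (a := 1 / 2 + t) (by nlinarith)
  rw [show 2 * (1 / 2 + t) - 1 = 2 * t by ring] at l1 l2
  rw [assoc_half, assoc, show 2 * (1 / 2 + t) - 1 = 2 * t by ring, abs_le]
  have h8 : 0 ≤ t ^ 8 := by positivity
  constructor <;> nlinarith

lemma localExpansion_four {β : ℝ} (hβ : β < 1 / 12) :
    LocalExpansion β (1 / 2) (1 / 2) (16 * (1 / 12 - β)) 2 2 := by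
  -- The constant `300` covers `64/30 + 256`, using `t⁸ ≤ t⁶`.
  refine ⟨by norm_num, by norm_num, by linarith, by norm_num, by norm_num, 300, 1 / 4,
    by norm_num, by norm_num, fun t ht => ⟨?_, ?_⟩⟩
  · have h1 := abs_le.1 (assoc_half_add β ht)
    have h6 : t ^ 8 ≤ t ^ 6 := by
      have ht2 : t ^ 2 ≤ 1 := by
        rw [sq_le_one_iff_abs_le_one]; linarith
      have h0 : 0 ≤ t ^ 6 := by positivity
      nlinarith
    have e6 : |t| ^ (2 * 2 + 2) = t ^ 6 := by
      rw [show 2 * 2 + 2 = 2 * 3 by norm_num, pow_mul, sq_abs, ← pow_mul]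
    have h0 : 0 ≤ t ^ 6 := by positivity
    rw [e6, abs_le]
    constructor <;> linarith [h1.1, h1.2]
  · refine (abs_log_prefactor_half_le ht).trans ?_
    have : 0 ≤ |t| ^ 2 := by positivity
    linarith

lemma localExpansion_six :
    LocalExpansion (1 / 12) (1 / 2) (1 / 2) (64 / 30) 3 2 := by
  refine ⟨by norm_num, by norm_num, by norm_num, by norm_num, by norm_num, 256, 1 / 4,
    by norm_num, by norm_num, fun t ht => ⟨?_, ?_⟩⟩
  · have h1 := assoc_half_add (1 / 12) ht
    have e8 : |t| ^ (2 * 3 + 2) = t ^ 8 := by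
      rw [show 2 * 3 + 2 = 2 * 4 by norm_num, pow_mul, sq_abs, ← pow_mul]
    rw [e8]
    refine le_of_eq_of_le ?_ h1
    congr 1
    ring
  · refine (abs_log_prefactor_half_le ht).trans ?_
    have : 0 ≤ |t| ^ 2 := by positivity
    linarith

lemma limitDensity_one (c : ℝ) : limitDensity c 1 = fun x => Real.exp (-(c / 4) * x ^ 2) := by
  ext x
  rw [limitDensity]
  ring_nf

lemma limitGaussian_eq {β h a : ℝ} (hneg : iteratedDeriv 2 (assoc β h) a < 0) :
    limitGaussian β h a
      = expPowerLaw (-(-iteratedDeriv 2 (assoc β h) a / 2) / 4 ^ 1) (2 * 1) := by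
  set d := iteratedDeriv 2 (assoc β h) a with hd
  have hv : 0 < -4 / d := div_pos_of_neg_of_neg (by norm_num) hneg
  have hv' : (-4 / d).toNNReal ≠ 0 := (Real.toNNReal_pos.2 hv).ne'
  have hexp : ∀ x : ℝ, -(-d / 2) / 4 ^ 1 * x ^ (2 * 1) = -(-d / 8) * x ^ 2 := fun x => by ring
  rw [limitGaussian, ← hd, gaussianReal_of_var_ne_zero _ hv', expPowerLaw, Measure.tilted]
  congr 1
  ext x
  simp only [hexp]
  rw [gaussianPDF, gaussianPDFReal, integral_gaussian, Real.coe_toNNReal _ hv.le]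
  congr 1
  have e1 : 2 * Real.pi * (-4 / d) = Real.pi / (-d / 8) := by
    have := hneg.ne
    field_simp
    ring
  have e2 : -(x - 0) ^ 2 / (2 * (-4 / d)) = -(-d / 8) * x ^ 2 := by
    have := hneg.ne
    field_simp
    ring
  rw [e1, e2]
  exact (div_eq_inv_mul _ _).symm

/-- The factor `1 / 2` is the Jacobian between `k`-units and magnetization units, in which
`limitDensity` is written. -/
lemma rawWeight_eq {β h a : ℝ} (hneg : iteratedDeriv 2 (assoc β h) a < 0) :
    rawWeight β h a
      = (∫ x, limitDensity (-iteratedDeriv 2 (assoc β h) a / 2) 1 x) / 2 / √(a * (1 - a)) := by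
  set d := iteratedDeriv 2 (assoc β h) a with hd
  rw [rawWeight, ← hd, limitDensity_one, integral_gaussian,
    show d / 2 = -(-d / 2) by ring, integral_gaussian]
  congr 1
  rw [show Real.pi / (-d / 2 / 4) = 2 ^ 2 * (Real.pi / (-d / 2)) by
    have := hneg.ne
    field_simp
    norm_num, Real.sqrt_mul (by norm_num), Real.sqrt_sq (by norm_num)]
  ring

/-! ### Concentration -/

/-- Otherwise the midpoint `a + b - 1` would lie in both intervals. -/
lemma Isolates.two_mul_le {S : Finset ℝ} {δ : ℝ} (hδ : Isolates S δ) {a b : ℝ} (ha : a ∈ S)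
    (hb : b ∈ S) (hab : a ≠ b) : 2 * δ ≤ |2 * (a - b)| := by
  by_contra! hlt
  have hd := hδ.2 ha hb hab
  have h := abs_lt.1 hlt
  have h0 := hδ.1
  have h1 : a + b - 1 ∈ Set.Ioo (2 * a - 1 - δ) (2 * a - 1 + δ) := ⟨by linarith, by linarith⟩
  have h2 : a + b - 1 ∈ Set.Ioo (2 * b - 1 - δ) (2 * b - 1 + δ) := ⟨by linarith, by linarith⟩
  exact Set.disjoint_left.1 hd h1 h2

/-- Isolation concerns open intervals, so the closed windows of `near` may touch at radius `δ`; at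
radius `δ / 2` they are disjoint. -/
lemma Isolates.half {S : Finset ℝ} {δ : ℝ} (hδ : Isolates S δ) : Isolates S (δ / 2) := by
  refine ⟨half_pos hδ.1, fun a ha b hb hab => (hδ.2 ha hb hab).mono ?_ ?_⟩ <;>
  · refine Set.Ioo_subset_Ioo ?_ ?_ <;> linarith [hδ.1]

lemma eventually_isolates (S : Finset ℝ) : ∀ᶠ δ in 𝓝[>] (0 : ℝ), Isolates S δ := by
  have h1 : ∀ᶠ δ in 𝓝[>] (0 : ℝ), ∀ a ∈ S, ∀ b ∈ S, a ≠ b → δ ≤ |a - b| := by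
    refine (Finset.eventually_all S).2 fun a _ => (Finset.eventually_all S).2 fun b _ => ?_
    by_cases hab : a = b
    · exact Eventually.of_forall fun δ h => absurd hab h
    · have : 0 < |a - b| := abs_pos.2 (sub_ne_zero.2 hab)
      filter_upwards [nhdsWithin_le_nhds (Iio_mem_nhds this)] with δ hδ _ using le_of_lt hδ
  filter_upwards [h1, self_mem_nhdsWithin] with δ hδ hδ0
  refine ⟨hδ0, fun a ha b hb hab => Set.disjoint_left.2 fun x hx hy => ?_⟩
  have h2 := hδ a ha b hb hab
  have h3 : |2 * a - 1 - (2 * b - 1)| < 2 * δ := by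
    rw [abs_lt]
    constructor <;> linarith [hx.1, hx.2, hy.1, hy.2]
  rw [show 2 * a - 1 - (2 * b - 1) = 2 * (a - b) by ring, abs_mul, abs_two] at h3
  linarith

/-- The maximizers of `assoc β h` are the elements of the finite set `S`, and are 2-regular. -/
structure RegularMaximizers (β h : ℝ) (S : Finset ℝ) : Prop where
  eq : maximizers β h = S
  reg : ∀ a ∈ S, TwoRegular β h a

namespace RegularMaximizers

variable {β h : ℝ} {S : Finset ℝ}

lemma mem (H : RegularMaximizers β h S) {a : ℝ} : a ∈ S ↔ a ∈ maximizers β h := by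
  rw [H.eq, Finset.mem_coe]

lemma assoc_eq (H : RegularMaximizers β h S) {a b : ℝ} (ha : a ∈ S) (hb : b ∈ S) :
    assoc β h a = assoc β h b := by
  rw [H.mem] at ha hb
  exact le_antisymm (hb.2 ha.1) (ha.2 hb.1)

lemma assoc_lt (H : RegularMaximizers β h S) {a x : ℝ} (ha : a ∈ S) (hx : x ∈ Set.Icc (0 : ℝ) 1)
    (hxS : x ∉ S) : assoc β h x < assoc β h a := by
  have ha' := H.mem.1 ha
  refine lt_of_le_of_ne (ha'.2 hx) fun heq => hxS (H.mem.2 ⟨hx, fun y hy => ?_⟩)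
  rw [Set.mem_ofPred_eq, heq]
  exact ha'.2 hy

lemma strictMaxNear (H : RegularMaximizers β h S) {δ : ℝ} (hδ : Isolates S δ) {a : ℝ}
    (ha : a ∈ S) : StrictMaxNear β h a δ := by
  intro x hx hxa hxδ
  refine H.assoc_lt ha hx fun hxS => ?_
  have := hδ.two_mul_le hxS ha hxa
  linarith [hδ.1]

lemma pos (H : RegularMaximizers β h S) {a : ℝ} (ha : a ∈ S) : 0 < a :=
  (mem_Ioo_of_mem_maximizers (H.mem.1 ha)).1

lemma lt_one (H : RegularMaximizers β h S) {a : ℝ} (ha : a ∈ S) : a < 1 :=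
  (mem_Ioo_of_mem_maximizers (H.mem.1 ha)).2

lemma nonempty (H : RegularMaximizers β h S) : S.Nonempty := by
  obtain ⟨a, ha⟩ := maximizers_nonempty β h
  exact ⟨a, H.mem.2 ha⟩

lemma localExpansion (H : RegularMaximizers β h S) {a : ℝ} (ha : a ∈ S) :
    LocalExpansion β h a (-iteratedDeriv 2 (assoc β h) a / 2) 1 1 :=
  localExpansion_of_twoRegular (H.pos ha) (H.lt_one ha) (H.reg a ha)

lemma rawWeight_pos (H : RegularMaximizers β h S) {a : ℝ} (ha : a ∈ S) :
    0 < rawWeight β h a := by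
  have h1 : 0 < 1 - a := by linarith [H.lt_one ha]
  have h2 := H.pos ha
  rw [rawWeight_eq (H.reg a ha).2]
  have := integral_limitDensity_pos (H.localExpansion ha).coeff_pos le_rfl
  positivity

lemma sum_rawWeight_pos (H : RegularMaximizers β h S) : 0 < ∑ b ∈ S, rawWeight β h b :=
  Finset.sum_pos (fun _ hb => H.rawWeight_pos hb) H.nonempty

/-- Laplace's method with constant observable. Replacing `peak` by `exp (n A(a))`, which is the same
for all maximizers, leaves `√(a (1 - a))` in the weight and makes masses at different points
comparable. -/
lemma exists_mass_le (H : RegularMaximizers β h S) {δ : ℝ} (hδ : Isolates S δ) {a : ℝ}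
    (ha : a ∈ S) : ∃ C : ℝ, 0 ≤ C ∧ ∀ n : ℕ, 1 ≤ n →
      |√(2 * Real.pi) * Real.exp (-(n * assoc β h a)) * nearSum β h a δ n (fun _ => 1)
        - rawWeight β h a| ≤ C / √n := by
  obtain ⟨C, hC0, hC⟩ := exists_nearSum_sub_integral_le (H.localExpansion ha) hδ.1
    (H.strictMaxNear hδ ha)
  have h1 : 0 < 1 - a := by linarith [H.lt_one ha]
  have h2 := H.pos ha
  set s := √(a * (1 - a)) with hs
  have hs0 : 0 < s := by positivity
  refine ⟨C / (2 * s), by positivity, fun n hn => ?_⟩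
  have hn' : (0 : ℝ) < n := by exact_mod_cast hn
  have hsq : √(n : ℝ) ^ 2 = n := Real.sq_sqrt hn'.le
  have hsn : 0 < √(n : ℝ) := by positivity
  have h3 := hC n (√n) hn (Real.one_le_sqrt.2 (by exact_mod_cast hn)) hsq (fun _ => 1)
    ((LipschitzWith.const (1 : ℝ)).weaken zero_le_one) (by simp)
  simp only [mul_one, pow_one] at h3
  rw [rawWeight_eq (H.reg a ha).2]
  set Z := ∫ x, limitDensity (-iteratedDeriv 2 (assoc β h) a / 2) 1 x
  set X := nearSum β h a δ n (fun _ => 1)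
  set W := √(2 * Real.pi) * Real.exp (-(n * assoc β h a)) * X with hW
  have e1 : 2 * √n / n * (X / peak β h a n) = 2 * s * W := by
    rw [peak, Real.sqrt_mul (by positivity), Real.sqrt_mul (x := 2 * Real.pi) (by positivity),
      hW, ← hs, Real.exp_neg]
    have := (Real.exp_pos (n * assoc β h a)).ne'
    field_simp
    rw [hsq]
  rw [e1] at h3
  have e2 : W - Z / 2 / s = (2 * s * W - Z) / (2 * s) := by field_simp
  rw [e2, abs_div, abs_of_pos (by positivity : 0 < 2 * s), div_le_iff₀ (by positivity)]
  refine h3.trans_eq ?_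
  field_simp

end RegularMaximizers

/-- The total weight of the `k` such that `2 k / n` has distance more than `δ` from all `2 a`,
`a ∈ S`. -/
noncomputable def farSum (β h : ℝ) (S : Finset ℝ) (δ : ℝ) (n : ℕ) : ℝ :=
  ∑ k ∈ (Finset.range (n + 1)).filter fun k : ℕ => ∀ a ∈ S, δ < |2 * ((k : ℝ) / n - a)|,
    spinWeight β h n k

lemma gibbs_real_far {n : ℕ} (hn : n ≠ 0) (β h : ℝ) (S : Finset ℝ) (δ : ℝ) :
    (gibbs n β h).real {ω : Config n | ∀ a ∈ S, δ < |magnetization ω / n - (2 * a - 1)|}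
      = farSum β h S δ n / ∑ k ∈ Finset.range (n + 1), spinWeight β h n k := by
  classical
  have hn' : (n : ℝ) ≠ 0 := by exact_mod_cast hn
  rw [gibbs_real_eq hn β h fun x => ∀ a ∈ S, δ < |x / n - (2 * a - 1)|, farSum]
  congr 1
  have e : ∀ (k : ℕ) (a : ℝ), (2 * (k : ℝ) - n) / n - (2 * a - 1) = 2 * (k / n - a) := by
    intro k a; field_simp; ring
  refine Finset.sum_congr ?_ fun _ _ => rfl
  ext k
  simp only [Finset.mem_filter, e]

lemma farSum_nonneg (β h : ℝ) (S : Finset ℝ) (δ : ℝ) (n : ℕ) : 0 ≤ farSum β h S δ n :=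
  Finset.sum_nonneg fun k _ => spinWeight_nonneg β h n k

lemma sum_spinWeight_eq {S : Finset ℝ} {δ : ℝ}
    (hδ : ∀ a ∈ S, ∀ b ∈ S, a ≠ b → 2 * δ < |2 * (a - b)|) (β h : ℝ) (n : ℕ) :
    ∑ k ∈ Finset.range (n + 1), spinWeight β h n k
      = ∑ a ∈ S, nearSum β h a δ n (fun _ => 1) + farSum β h S δ n := by
  simp only [nearSum, farSum, Finset.sum_filter, mul_one]
  rw [Finset.sum_comm, ← Finset.sum_add_distrib]
  refine Finset.sum_congr rfl fun k _ => ?_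
  by_cases hk : ∃ a ∈ S, |2 * ((k : ℝ) / n - a)| ≤ δ
  · obtain ⟨a, ha, hka⟩ := hk
    rw [Finset.sum_eq_single_of_mem a ha, if_pos hka, if_neg, add_zero]
    · exact fun hall => absurd hka (not_le.2 (hall a ha))
    · intro b hb hba
      refine if_neg fun hkb => ?_
      have h1 := hδ a ha b hb hba.symm
      have h2 := abs_sub (2 * ((k : ℝ) / n - b)) (2 * ((k : ℝ) / n - a))
      rw [show 2 * ((k : ℝ) / n - b) - 2 * ((k : ℝ) / n - a) = 2 * (a - b) by ring] at h2
      linarith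
  · push Not at hk
    rw [if_pos hk, Finset.sum_eq_zero, zero_add]
    exact fun a ha => if_neg (not_le.2 (hk a ha))

namespace RegularMaximizers

variable {β h : ℝ} {S : Finset ℝ}

lemma exists_farSum_le (H : RegularMaximizers β h S) {δ : ℝ} (hδ : 0 < δ) {a : ℝ} (ha : a ∈ S) :
    ∃ κ : ℝ, 0 < κ ∧ ∀ n : ℕ, 1 ≤ n →
      Real.exp (-(n * assoc β h a)) * farSum β h S δ n ≤ 2 * n * Real.exp (-(κ * n)) := by
  have hT : IsClosed (⋂ b ∈ S, {x : ℝ | δ ≤ |2 * (x - b)|}) :=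
    isClosed_biInter fun b _ => isClosed_le continuous_const (by fun_prop)
  obtain ⟨κ, hκ, hgap⟩ := exists_gap (β := β) (h := h) (A₀ := assoc β h a) hT
    fun x hx => H.assoc_lt ha hx.1 fun hxS => by
      have h1 : δ ≤ |2 * (x - x)| := by
        have := hx.2
        simp only [Set.mem_iInter] at this
        exact this x hxS
      rw [sub_self, mul_zero, abs_zero] at h1
      linarith
  refine ⟨κ, hκ, fun n hn => ?_⟩
  have hn' : (1 : ℝ) ≤ n := by exact_mod_cast hn
  have hterm : ∀ k ∈ (Finset.range (n + 1)).filter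
      (fun k : ℕ => ∀ a ∈ S, δ < |2 * ((k : ℝ) / n - a)|),
      spinWeight β h n k ≤ Real.exp (n * (assoc β h a - κ)) := by
    intro k hk
    obtain ⟨hk1, hk2⟩ := Finset.mem_filter.1 hk
    refine (spinWeight_le (by omega) (Nat.lt_succ_iff.1 (Finset.mem_range.1 hk1)) β h).trans
      (Real.exp_le_exp.2 (mul_le_mul_of_nonneg_left (hgap _ ⟨?_, ?_⟩) (by positivity)))
    · exact (abs_div_sub_le_one (H.pos ha) (H.lt_one ha) hn hk1).2
    · simp only [Set.mem_iInter]
      exact fun b hb => (hk2 b hb).le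
  have hcard : (((Finset.range (n + 1)).filter
      (fun k : ℕ => ∀ a ∈ S, δ < |2 * ((k : ℝ) / n - a)|)).card : ℝ) ≤ 2 * n := by
    have := Finset.card_filter_le (Finset.range (n + 1))
      (fun k : ℕ => ∀ a ∈ S, δ < |2 * ((k : ℝ) / n - a)|)
    rw [Finset.card_range] at this
    have h2 : (((Finset.range (n + 1)).filter
      (fun k : ℕ => ∀ a ∈ S, δ < |2 * ((k : ℝ) / n - a)|)).card : ℝ) ≤ n + 1 := by
      exact_mod_cast this
    linarith
  have hsum := Finset.sum_le_card_nsmul _ _ _ hterm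
  rw [nsmul_eq_mul] at hsum
  calc Real.exp (-(n * assoc β h a)) * farSum β h S δ n
      ≤ Real.exp (-(n * assoc β h a)) * (2 * n * Real.exp (n * (assoc β h a - κ))) :=
        mul_le_mul_of_nonneg_left
          (hsum.trans (mul_le_mul_of_nonneg_right hcard (Real.exp_pos _).le)) (Real.exp_pos _).le
    _ = 2 * n * (Real.exp (-(n * assoc β h a)) * Real.exp (n * (assoc β h a - κ))) := by ring
    _ = _ := by rw [← Real.exp_add]; ring_nf

/-- The partition function is the sum of the window masses and the far part, which is `O(n exp (-κ
n))` in these units and hence `O(1/√n)`. -/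
lemma exists_total_le (H : RegularMaximizers β h S) {a : ℝ} (ha : a ∈ S) :
    ∃ C : ℝ, 0 ≤ C ∧ ∀ n : ℕ, 1 ≤ n →
      |√(2 * Real.pi) * Real.exp (-(n * assoc β h a)) *
          ∑ k ∈ Finset.range (n + 1), spinWeight β h n k - ∑ b ∈ S, rawWeight β h b|
        ≤ C / √n := by
  obtain ⟨δ, hδ⟩ := (eventually_isolates S).exists
  have hδ2 : Isolates S (δ / 2) := hδ.half
  have hsep : ∀ a ∈ S, ∀ b ∈ S, a ≠ b → 2 * (δ / 2) < |2 * (a - b)| := fun a ha b hb hab => by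
    linarith [hδ.two_mul_le ha hb hab, hδ.1]
  have hmass : ∀ b : ℝ, ∃ C : ℝ, 0 ≤ C ∧ (b ∈ S → ∀ n : ℕ, 1 ≤ n →
      |√(2 * Real.pi) * Real.exp (-(n * assoc β h b)) * nearSum β h b (δ / 2) n (fun _ => 1)
        - rawWeight β h b| ≤ C / √n) := by
    intro b
    by_cases hb : b ∈ S
    · obtain ⟨C, hC0, hC⟩ := H.exists_mass_le hδ2 hb
      exact ⟨C, hC0, fun _ => hC⟩
    · exact ⟨0, le_rfl, fun h => absurd h hb⟩
  choose C hC0 hC using hmass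
  obtain ⟨κ, hκ, hfar⟩ := H.exists_farSum_le hδ2.1 ha
  set D := √(2 * Real.pi) * (2 * ((2 : ℕ).factorial / κ ^ 2)) with hD
  refine ⟨∑ b ∈ S, C b + D, add_nonneg (Finset.sum_nonneg fun b _ => hC0 b) (by positivity), ?_⟩
  intro n hn
  have hn' : (1 : ℝ) ≤ n := by exact_mod_cast hn
  have hsn : 0 < √(n : ℝ) := by positivity
  have hsnn : √(n : ℝ) ≤ n := Real.sqrt_le_iff.2 ⟨by positivity, by nlinarith⟩
  set E := √(2 * Real.pi) * Real.exp (-(n * assoc β h a)) with hE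
  have e : E * ∑ k ∈ Finset.range (n + 1), spinWeight β h n k - ∑ b ∈ S, rawWeight β h b
      = ∑ b ∈ S, (E * nearSum β h b (δ / 2) n (fun _ => 1) - rawWeight β h b)
        + E * farSum β h S (δ / 2) n := by
    rw [sum_spinWeight_eq hsep, mul_add, Finset.mul_sum, Finset.sum_sub_distrib]
    ring
  rw [e, add_div, Finset.sum_div]
  refine (abs_add_le _ _).trans (add_le_add ((Finset.abs_sum_le_sum_abs _ _).trans
    (Finset.sum_le_sum fun b hb => ?_)) ?_)
  · rw [hE, H.assoc_eq ha hb]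
    exact hC b hb n hn
  · rw [abs_of_nonneg (mul_nonneg (by positivity) (farSum_nonneg β h S _ n)), le_div_iff₀ hsn, hE,
      mul_assoc (√(2 * Real.pi)), hD, mul_assoc (√(2 * Real.pi))]
    refine mul_le_mul_of_nonneg_left ?_ (by positivity)
    have h1 := pow_mul_exp_neg_le hκ 2 n
    calc Real.exp (-(n * assoc β h a)) * farSum β h S (δ / 2) n * √n
        ≤ (2 * n * Real.exp (-(κ * n))) * n := by
          refine mul_le_mul (hfar n hn) hsnn hsn.le (by positivity)
      _ = 2 * (n ^ 2 * Real.exp (-(κ * n))) := by ring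
      _ ≤ _ := by linarith

end RegularMaximizers

namespace RegularMaximizers

variable {β h : ℝ} {S : Finset ℝ}

lemma tendsto_div_sqrt (C : ℝ) : Tendsto (fun n : ℕ => C / √(n : ℝ)) atTop (𝓝 0) :=
  tendsto_const_nhds.div_atTop
    (Real.tendsto_sqrt_atTop.comp tendsto_natCast_atTop_atTop)

lemma eventually_half_le_total (H : RegularMaximizers β h S) {a : ℝ} (ha : a ∈ S) :
    ∀ᶠ n : ℕ in atTop, (∑ b ∈ S, rawWeight β h b) / 2 ≤
      √(2 * Real.pi) * Real.exp (-(n * assoc β h a)) *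
          ∑ k ∈ Finset.range (n + 1), spinWeight β h n k := by
  obtain ⟨C, hC0, hC⟩ := H.exists_total_le ha
  filter_upwards [eventually_ge_atTop 1,
    (tendsto_div_sqrt C).eventually_le_const (half_pos H.sum_rawWeight_pos)] with n hn h1
  linarith [(abs_le.1 ((hC n hn).trans h1)).1]

lemma exists_prob_near_le (H : RegularMaximizers β h S) {δ : ℝ} (hδ : Isolates S δ) {a : ℝ}
    (ha : a ∈ S) : ∃ C : ℝ, 0 ≤ C ∧ ∀ᶠ n : ℕ in atTop,
      |(gibbs n β h).real (near n a δ) - weight β h S a| ≤ C / √n := by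
  obtain ⟨C₁, hC₁0, hC₁⟩ := H.exists_mass_le hδ ha
  obtain ⟨C₂, hC₂0, hC₂⟩ := H.exists_total_le ha
  have hR := H.sum_rawWeight_pos
  have hr := H.rawWeight_pos ha
  set R := ∑ b ∈ S, rawWeight β h b with hRdef
  refine ⟨(R + rawWeight β h a) * (2 / R ^ 2) * max C₁ C₂,
    mul_nonneg (mul_nonneg (add_nonneg hR.le hr.le) (div_nonneg two_pos.le (sq_nonneg R)))
      (hC₁0.trans (le_max_left _ _)), ?_⟩
  filter_upwards [eventually_ge_atTop 1, H.eventually_half_le_total ha] with n hn hhalf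
  rw [gibbs_real_near (by omega), weight, ← hRdef]
  set E := √(2 * Real.pi) * Real.exp (-(n * assoc β h a)) with hE
  have hE0 : 0 < E := by positivity
  rw [← mul_div_mul_left (nearSum β h a δ n fun _ => 1) _ hE0.ne']
  refine (abs_div_sub_div_le (ε := max C₁ C₂ / √n) hR ((hC₁ n hn).trans ?_) ((hC₂ n hn).trans ?_)
    (abs_of_pos hr).le hhalf).trans_eq (mul_div_assoc _ _ _).symm
  · exact div_le_div_of_nonneg_right (le_max_left _ _) (Real.sqrt_nonneg _)
  · exact div_le_div_of_nonneg_right (le_max_right _ _) (Real.sqrt_nonneg _)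

lemma exists_prob_far_le (H : RegularMaximizers β h S) {δ : ℝ} (hδ : 0 < δ) :
    ∃ c : ℝ, 0 < c ∧ ∀ᶠ n : ℕ in atTop,
      (gibbs n β h).real {ω : Config n | ∀ a ∈ S, δ < |magnetization ω / n - (2 * a - 1)|}
        ≤ Real.exp (-c * n) := by
  obtain ⟨a, ha⟩ := H.nonempty
  obtain ⟨κ, hκ, hfar⟩ := H.exists_farSum_le hδ ha
  have hR := H.sum_rawWeight_pos
  set R := ∑ b ∈ S, rawWeight β h b with hRdef
  set D := √(2 * Real.pi) * 2 * ((2 : ℕ).factorial / (κ / 2) ^ 2) with hD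
  -- Half of the exponential rate is given up to absorb the factor `n` and all constants for large
  -- `n`.
  refine ⟨κ / 2, half_pos hκ, ?_⟩
  have hlarge : ∀ᶠ n : ℕ in atTop, D / (R / 2) ≤ (n : ℝ) :=
    tendsto_natCast_atTop_atTop.eventually_ge_atTop _
  filter_upwards [eventually_ge_atTop 1, H.eventually_half_le_total ha, hlarge]
    with n hn hhalf hnD
  have hn' : (1 : ℝ) ≤ n := by exact_mod_cast hn
  rw [gibbs_real_far (by omega), div_le_iff₀ (sum_spinWeight_pos β h n)]
  rw [div_le_iff₀ (by positivity)] at hnD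
  set E := √(2 * Real.pi) * Real.exp (-(n * assoc β h a)) with hE
  have hE0 : 0 < E := by positivity
  refine le_of_mul_le_mul_left ?_ hE0
  have h1 := pow_mul_exp_neg_le (half_pos hκ) 2 n
  have hexp : Real.exp (-(κ * n)) = Real.exp (-(κ / 2) * n) * Real.exp (-(κ / 2 * n)) := by
    rw [← Real.exp_add]; ring_nf
  have hx := Real.exp_pos (-(κ / 2) * n)
  have h2 : √(2 * Real.pi) * (2 * n * Real.exp (-(κ / 2 * n))) ≤ R / 2 := by
    have h3 : (√(2 * Real.pi) * (2 * n * Real.exp (-(κ / 2 * n)))) * n ≤ (R / 2) * n := by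
      calc (√(2 * Real.pi) * (2 * n * Real.exp (-(κ / 2 * n)))) * n
          = √(2 * Real.pi) * 2 * (n ^ 2 * Real.exp (-(κ / 2 * n))) := by ring
        _ ≤ D := by rw [hD]; gcongr
        _ ≤ _ := by linarith
    exact le_of_mul_le_mul_right h3 (by linarith)
  calc E * farSum β h S δ n
      = √(2 * Real.pi) * (Real.exp (-(n * assoc β h a)) * farSum β h S δ n) := by
        rw [hE]; ring
    _ ≤ √(2 * Real.pi) * (2 * n * Real.exp (-(κ * n))) := by
        exact mul_le_mul_of_nonneg_left (hfar n hn) (Real.sqrt_nonneg _)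
    _ = Real.exp (-(κ / 2) * n) * (√(2 * Real.pi) * (2 * n * Real.exp (-(κ / 2 * n)))) := by
        rw [hexp]; ring
    _ ≤ Real.exp (-(κ / 2) * n) *
          (E * ∑ k ∈ Finset.range (n + 1), spinWeight β h n k) := by
        exact mul_le_mul_of_nonneg_left (h2.trans hhalf) hx.le
    _ = _ := by ring

lemma tendsto_prob_near (H : RegularMaximizers β h S) {δ : ℝ} (hδ : Isolates S δ) {a : ℝ}
    (ha : a ∈ S) : Tendsto (fun n : ℕ => (gibbs n β h).real (near n a δ)) atTop
      (𝓝 (weight β h S a)) := by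
  obtain ⟨C, -, hC⟩ := H.exists_prob_near_le hδ ha
  rw [tendsto_iff_dist_tendsto_zero]
  exact squeeze_zero' (Eventually.of_forall fun n => dist_nonneg) hC (tendsto_div_sqrt C)

lemma tendsto_prob_far (H : RegularMaximizers β h S) {δ : ℝ} (hδ : 0 < δ) :
    Tendsto (fun n : ℕ => (gibbs n β h).real
      {ω : Config n | ∀ a ∈ S, δ < |magnetization ω / n - (2 * a - 1)|}) atTop (𝓝 0) := by
  obtain ⟨c, hc, hle⟩ := H.exists_prob_far_le hδ
  refine squeeze_zero' (Eventually.of_forall fun n => measureReal_nonneg) hle ?_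
  refine Real.tendsto_exp_atBot.comp ?_
  exact tendsto_natCast_atTop_atTop.const_mul_atTop_of_neg (by linarith)

/-- On each window `f` is replaced by its value at the centre with error `ε`; off the windows `‖f‖`
bounds the error. Radius `δ / 2` ensures that at most one indicator is nonzero. -/
lemma abs_integral_sub_le {δ ε : ℝ} (hδ : Isolates S δ) (hε : 0 ≤ ε) (f : ℝ →ᵇ ℝ)
    (hf : ∀ a ∈ S, ∀ x, |x - (2 * a - 1)| ≤ δ / 2 → |f x - f (2 * a - 1)| ≤ ε) (n : ℕ) :
    |∫ ω : Config n, f (magnetization ω / n) ∂(gibbs n β h)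
        - ∑ a ∈ S, (gibbs n β h).real (near n a (δ / 2)) * f (2 * a - 1)|
      ≤ ε + ‖f‖ * (gibbs n β h).real
        {ω : Config n | ∀ a ∈ S, δ / 2 < |magnetization ω / n - (2 * a - 1)|} := by
  classical
  set μ := gibbs n β h
  set B := {ω : Config n | ∀ a ∈ S, δ / 2 < |magnetization ω / n - (2 * a - 1)|} with hB
  have hmeas : ∀ s : Set (Config n), MeasurableSet s := fun s => (Set.toFinite s).measurableSet
  have e1 : ∑ a ∈ S, μ.real (near n a (δ / 2)) * f (2 * a - 1)
      = ∫ ω, ∑ a ∈ S, (near n a (δ / 2)).indicator (fun _ => f (2 * a - 1)) ω ∂μ := by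
    rw [integral_finsetSum _ fun a _ => Integrable.of_finite (μ := μ)]
    refine Finset.sum_congr rfl fun a _ => ?_
    rw [integral_indicator_const _ (hmeas _), smul_eq_mul]
  have e2 : ε + ‖f‖ * μ.real B = ∫ ω, (ε + B.indicator (fun _ => ‖f‖) ω) ∂μ := by
    rw [integral_add Integrable.of_finite Integrable.of_finite,
      integral_indicator_const _ (hmeas _)]
    simp [mul_comm]
  rw [e1, e2, ← integral_sub Integrable.of_finite Integrable.of_finite]
  have hint : ∀ g : Config n → ℝ, Integrable g μ := fun g => Integrable.of_finite
  rw [← Real.norm_eq_abs]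
  refine norm_integral_le_of_norm_le (hint _) (ae_of_all _ fun ω => ?_)
  rw [Real.norm_eq_abs]
  set x := magnetization ω / n with hx
  by_cases hω : ∃ a ∈ S, |x - (2 * a - 1)| ≤ δ / 2
  · obtain ⟨a, ha, hxa⟩ := hω
    rw [Finset.sum_eq_single_of_mem a ha, Set.indicator_of_mem (show ω ∈ near n a (δ / 2) from hxa)]
    · have := hf a ha x hxa
      have h2 : 0 ≤ B.indicator (fun _ => ‖f‖) ω :=
        Set.indicator_nonneg (fun _ _ => norm_nonneg f) ω
      linarith
    · intro b hb hba
      refine Set.indicator_of_notMem (fun hmem : ω ∈ near n b (δ / 2) => ?_) _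
      have hxb : |x - (2 * b - 1)| ≤ δ / 2 := hmem
      have h1 := hδ.two_mul_le ha hb hba.symm
      have h2 := abs_sub (x - (2 * b - 1)) (x - (2 * a - 1))
      rw [show x - (2 * b - 1) - (x - (2 * a - 1)) = 2 * (a - b) by ring] at h2
      linarith [hδ.1]
  · push Not at hω
    rw [Finset.sum_eq_zero, sub_zero, Set.indicator_of_mem (show ω ∈ B from hω)]
    · have := f.norm_coe_le_norm x
      rw [Real.norm_eq_abs] at this
      linarith
    · exact fun a ha => Set.indicator_of_notMem
        (fun hmem : ω ∈ near n a (δ / 2) => absurd hmem (not_le.2 (hω a ha))) _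

lemma tendsto_integral (H : RegularMaximizers β h S) (f : ℝ →ᵇ ℝ) :
    Tendsto (fun n : ℕ => ∫ ω : Config n, f (magnetization ω / n) ∂(gibbs n β h)) atTop
      (𝓝 (∑ a ∈ S, weight β h S a * f (2 * a - 1))) := by
  refine Metric.tendsto_nhds.2 fun ε hε => ?_
  have hcont : ∀ᶠ δ in 𝓝[>] (0 : ℝ), ∀ a ∈ S, ∀ x, |x - (2 * a - 1)| ≤ δ / 2 →
      |f x - f (2 * a - 1)| ≤ ε / 3 := by
    refine (Finset.eventually_all S).2 fun a _ => ?_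
    obtain ⟨η, hη, hfη⟩ := Metric.continuous_iff.1 f.continuous (2 * a - 1) (ε / 3) (by linarith)
    filter_upwards [nhdsWithin_le_nhds (Iio_mem_nhds hη), self_mem_nhdsWithin] with δ hδ hδ0 x hx
    have h1 : δ < η := hδ
    have h2 : 0 < δ := hδ0
    exact (hfη x (by rw [Real.dist_eq]; linarith)).le
  obtain ⟨δ, hδ, hfδ⟩ := ((eventually_isolates S).and hcont).exists
  have hδ2 : Isolates S (δ / 2) := hδ.half
  have t1 : Tendsto (fun n : ℕ => ∑ a ∈ S, (gibbs n β h).real (near n a (δ / 2)) * f (2 * a - 1))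
      atTop (𝓝 (∑ a ∈ S, weight β h S a * f (2 * a - 1))) :=
    tendsto_finsetSum _ fun a ha => (H.tendsto_prob_near hδ2 ha).mul_const _
  have t2 := (H.tendsto_prob_far hδ2.1).const_mul ‖f‖
  rw [mul_zero] at t2
  filter_upwards [Metric.tendsto_nhds.1 t1 (ε / 3) (by linarith),
    t2.eventually_lt_const (show (0 : ℝ) < ε / 3 by linarith)] with n h1 h2
  have h3 := abs_integral_sub_le (β := β) (h := h) hδ (by linarith) f hfδ n
  rw [Real.dist_eq] at h1 ⊢
  have h4 := abs_sub_le (∫ ω : Config n, f (magnetization ω / n) ∂(gibbs n β h))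
    (∑ a ∈ S, (gibbs n β h).real (near n a (δ / 2)) * f (2 * a - 1))
    (∑ a ∈ S, weight β h S a * f (2 * a - 1))
  linarith

theorem concentratesAround (H : RegularMaximizers β h S) : ConcentratesAround β h S := by
  refine ⟨H.tendsto_integral, fun δ hδ => H.exists_prob_far_le hδ, fun δ hδ a ha => ?_⟩
  obtain ⟨C, hC0, hC⟩ := H.exists_prob_near_le hδ ha
  refine ⟨C, ?_⟩
  -- For `n ≥ 3 > e` one has `log n ≥ 1`, so the rate `1/√n` already proved implies the stated one.
  filter_upwards [hC, eventually_ge_atTop 3] with n hn hn3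
  refine hn.trans ?_
  rw [div_eq_mul_one_div]
  gcongr
  have h1 : 1 ≤ Real.log n := by
    rw [Real.le_log_iff_exp_le (by positivity)]
    have : (3 : ℝ) ≤ n := by exact_mod_cast hn3
    linarith [Real.exp_one_lt_d9]
  exact one_le_pow₀ h1

/-! ### Conditional moments and central limit theorems -/

lemma eventually_nearSum (H : RegularMaximizers β h S) {δ : ℝ} (hδ : Isolates S δ) {a : ℝ}
    (ha : a ∈ S) : ∃ z : ℝ, 0 < z ∧ ∀ᶠ n : ℕ in atTop,
      z ≤ 2 * √n / n * (nearSum β h a δ n (fun _ => 1) / peak β h a n) := by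
  obtain ⟨C, hC0, hC⟩ := exists_nearSum_sub_integral_le (H.localExpansion ha) hδ.1
    (H.strictMaxNear hδ ha)
  have hZ := integral_limitDensity_pos (H.localExpansion ha).coeff_pos le_rfl
  refine ⟨_, half_pos hZ, ?_⟩
  filter_upwards [eventually_ge_atTop 1,
    (tendsto_div_sqrt C).eventually_le_const (half_pos hZ)] with n hn h1
  have h3 := hC n (√n) hn (Real.one_le_sqrt.2 (by exact_mod_cast hn))
    (Real.sq_sqrt (by positivity)) (fun _ => 1)
    ((LipschitzWith.const (1 : ℝ)).weaken zero_le_one) (by simp)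
  simp only [mul_one, pow_one, ← div_eq_mul_inv] at h3
  linarith [(abs_le.1 (h3.trans h1)).1]

theorem conditionalCLT (H : RegularMaximizers β h S) : ConditionalCLT β h S := by
  intro δ hδ a ha
  obtain ⟨z, hz, hev⟩ := H.eventually_nearSum hδ ha
  have hs := H.strictMaxNear hδ ha
  constructor
  · intro l
    obtain ⟨C, hC0, hC⟩ := exists_nearSum_moment_le (H.localExpansion ha) hδ.1 hs l
    refine ⟨C / z, ?_⟩
    filter_upwards [eventually_ge_atTop 1, hev] with n hn hzn
    have hn' : (0 : ℝ) < n := by exact_mod_cast hn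
    have hsn : 0 < √(n : ℝ) := by positivity
    have h1 := hC n (√n) hn (Real.one_le_sqrt.2 (by exact_mod_cast hn)) (Real.sq_sqrt hn'.le)
    have hpk := peak_pos β h (H.pos ha) (H.lt_one ha) (by omega : n ≠ 0)
    -- Pulling out `√n ^ l` leaves moments on the scale of the limit law, which are bounded.
    have e1 : ∀ x : ℝ, |x / n - (2 * a - 1)| ^ l
        = (√(n : ℝ) ^ l)⁻¹ * |√n / n * (x - n * (2 * a - 1))| ^ l := by
      intro x
      have : √(n : ℝ) / n * (x - n * (2 * a - 1)) = √n * (x / n - (2 * a - 1)) := by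
        field_simp
      rw [this, abs_mul, abs_of_pos hsn, mul_pow, inv_mul_cancel_left₀ (by positivity)]
    rw [integral_cond_near (by omega) β h a δ fun x => |x / n - (2 * a - 1)| ^ l]
    simp only [e1]
    have e2 : nearSum β h a δ n
        (fun x => (√(n : ℝ) ^ l)⁻¹ * |√n / n * (x - n * (2 * a - 1))| ^ l)
        = (√(n : ℝ) ^ l)⁻¹ * nearSum β h a δ n
          (fun x => |√n / n * (x - n * (2 * a - 1))| ^ l) := by
      simp only [nearSum, Finset.mul_sum]
      exact Finset.sum_congr rfl fun k _ => by ring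
    have e3 : (n : ℝ) ^ (-(l : ℝ) / 2) = (√(n : ℝ) ^ l)⁻¹ := by
      rw [Real.sqrt_eq_rpow, ← Real.rpow_natCast, ← Real.rpow_mul hn'.le, ← Real.rpow_neg hn'.le]
      congr 1
      ring
    rw [e2, e3, mul_div_assoc, mul_comm]
    refine mul_le_mul_of_nonneg_right ?_ (by positivity)
    set X := nearSum β h a δ n (fun x => |√n / n * (x - n * (2 * a - 1))| ^ l)
    set Y := nearSum β h a δ n (fun _ => 1)
    have hs1 : 0 < 2 * √(n : ℝ) / n := by positivity
    have e4 : X / Y = (2 * √n / n * (X / peak β h a n)) / (2 * √n / n * (Y / peak β h a n)) := by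
      rw [mul_div_mul_left _ _ hs1.ne', div_div_div_cancel_right₀ hpk.ne']
    rw [e4]
    exact div_le_div₀ hC0 h1 hz hzn
  · obtain ⟨C, hC0, hC⟩ := exists_wassersteinDist_cond_le (H.localExpansion ha) hδ.1 hs
      (r := 1 / 2) (by norm_num)
    refine ⟨C, ?_⟩
    filter_upwards [eventually_ge_atTop 1, hev] with n hn hzn
    have hpos : 0 < nearSum β h a δ n (fun _ => 1) := by
      refine lt_of_le_of_ne (nearSum_one_nonneg β h a δ n) fun h0 => ?_
      rw [← h0, zero_div, mul_zero] at hzn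
      linarith
    rw [limitGaussian_eq (H.reg a ha).2]
    refine (hC n hn hpos).trans_eq ?_
    rw [pow_one, Real.sqrt_eq_rpow, div_eq_mul_inv C, Nat.cast_one, mul_one]

end RegularMaximizers

/-- The method yields the rate `n^(-e/(2q))`, that is `n^(-1/2)` for `q = e = 2` and `n^(-1/3)` for
`q = 3`, `e = 2`; both imply `n^(-1/4)`. -/
lemma inv_rpow_pow_le {n e : ℕ} (hn : 1 ≤ n) {s t : ℝ} (hst : -(s * e) ≤ t) :
    (((n : ℝ) ^ s) ^ e)⁻¹ ≤ (n : ℝ) ^ t := by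
  have hn' : (0 : ℝ) < n := by exact_mod_cast hn
  rw [← Real.rpow_natCast, ← Real.rpow_mul hn'.le, ← Real.rpow_neg hn'.le]
  exact Real.rpow_le_rpow_of_exponent_le (by exact_mod_cast hn) hst

end FourSpin

/-! ### The phase diagram and its limit laws -/

theorem mainTheorem6 :
    ∃ g : ℝ → ℝ,
      (∀ β : ℝ, 0 < β → β ≤ 1 / 12 → g β = 1 / 2) ∧
      ∀ β h : ℝ, 0 < β →
        -- region `R₁`
        (h < g β →
          FourSpin.maximizers β h = {1 / 2} ∧ FourSpin.TwoRegular β h (1 / 2) ∧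
          FourSpin.ConcentratesAround β h {1 / 2} ∧
          FourSpin.ConditionalCLT β h {1 / 2} ∧
          ∃ C : ℝ, ∀ n : ℕ, 1 ≤ n →
            wassersteinDist (FourSpin.scaledLaw (FourSpin.gibbs n β h) (1 / 2) (1 / 2))
              (FourSpin.limitGaussian β h (1 / 2)) ≤ ENNReal.ofReal (C / √n)) ∧
        -- region `R₂`
        (g β < h →
          ∃ am ap : ℝ, 0 < am ∧ am < 1 / 2 ∧ 1 / 2 < ap ∧ ap < 1 ∧
            FourSpin.maximizers β h = {am, ap} ∧
            FourSpin.TwoRegular β h am ∧ FourSpin.TwoRegular β h ap ∧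
            FourSpin.ConcentratesAround β h {am, ap} ∧
            FourSpin.ConditionalCLT β h {am, ap}) ∧
        -- region `R₃`
        (1 / 12 < β → h = g β →
          ∃ am ap : ℝ, 0 < am ∧ am < 1 / 2 ∧ 1 / 2 < ap ∧ ap < 1 ∧
            FourSpin.maximizers β h = {am, 1 / 2, ap} ∧
            FourSpin.TwoRegular β h am ∧ FourSpin.TwoRegular β h (1 / 2) ∧
            FourSpin.TwoRegular β h ap ∧
            FourSpin.ConcentratesAround β h {am, 1 / 2, ap} ∧
            FourSpin.ConditionalCLT β h {am, 1 / 2, ap}) ∧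
        -- region `R₄`
        (β < 1 / 12 → h = 1 / 2 →
          iteratedDeriv 4 (FourSpin.assoc β h) (1 / 2) < 0 ∧
          ∃ C : ℝ, ∀ n : ℕ, 1 ≤ n →
            wassersteinDist (FourSpin.scaledLaw (FourSpin.gibbs n β h) (3 / 4) (1 / 2))
              (expPowerLaw (iteratedDeriv 4 (FourSpin.assoc β h) (1 / 2)
                / (2 ^ 4 * (Nat.factorial 4 : ℝ))) 4)
              ≤ ENNReal.ofReal (C * (n : ℝ) ^ (-(1 / 4) : ℝ))) ∧
        -- the point `(1/12, 1/2)`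
        (β = 1 / 12 → h = 1 / 2 →
          iteratedDeriv 6 (FourSpin.assoc β h) (1 / 2) < 0 ∧
          ∃ C : ℝ, ∀ n : ℕ, 1 ≤ n →
            wassersteinDist (FourSpin.scaledLaw (FourSpin.gibbs n β h) (5 / 6) (1 / 2))
              (expPowerLaw (iteratedDeriv 6 (FourSpin.assoc β h) (1 / 2)
                / (2 ^ 6 * (Nat.factorial 6 : ℝ))) 6)
              ≤ ENNReal.ofReal (C * (n : ℝ) ^ (-(1 / 4) : ℝ))) := by
  refine ⟨FourSpin.critField, fun β hβ hβ' => FourSpin.critField_eq_half hβ hβ', fun β h hβ => ?_⟩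
  refine ⟨fun hh => ?_, fun hh => ?_, fun hβ' hh => ?_, fun hβ' hh => ?_, fun hβ' hh => ?_⟩
  · obtain ⟨hmax, hreg⟩ := FourSpin.maximizers_of_lt_critField hβ hh
    have H : FourSpin.RegularMaximizers β h {1 / 2} := ⟨by simp [hmax], by simpa using hreg⟩
    refine ⟨hmax, hreg, H.concentratesAround, H.conditionalCLT, ?_⟩
    obtain ⟨C, -, hC⟩ := FourSpin.exists_wassersteinDist_gibbs_le (r := 1 / 2)
      (H.localExpansion (Finset.mem_singleton_self _))
      (fun x hx hne _ => FourSpin.assoc_half β h ▸ FourSpin.assoc_lt_of_lt_critField hβ hh hx hne)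
      (by norm_num)
    refine ⟨C, fun n hn => ?_⟩
    rw [FourSpin.limitGaussian_eq hreg.2]
    refine (hC n hn).trans_eq ?_
    rw [pow_one, Real.sqrt_eq_rpow, div_eq_mul_inv C, Nat.cast_one, mul_one]
  · obtain ⟨ap, h1, h2, hmax, hr1, hr2⟩ := FourSpin.maximizers_of_critField_lt hβ hh
    have H : FourSpin.RegularMaximizers β h {1 - ap, ap} :=
      ⟨by simp [hmax], by simpa using ⟨hr1, hr2⟩⟩
    exact ⟨1 - ap, ap, by linarith, by linarith, h1, h2, hmax, hr1, hr2, H.concentratesAround,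
      H.conditionalCLT⟩
  · subst hh
    obtain ⟨ap, h1, h2, hmax, hr1, hr2, hr3⟩ := FourSpin.maximizers_of_eq_critField hβ'
    have H : FourSpin.RegularMaximizers β (FourSpin.critField β) {1 - ap, 1 / 2, ap} :=
      ⟨by simp [hmax], fun a ha => by
        simp only [Finset.mem_insert, Finset.mem_singleton] at ha
        rcases ha with rfl | rfl | rfl <;> assumption⟩
    exact ⟨1 - ap, ap, by linarith, by linarith, h1, h2, hmax, hr1, hr2, hr3,
      H.concentratesAround, H.conditionalCLT⟩
  · subst hh
    rw [FourSpin.iteratedDeriv_four_assoc_half]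
    refine ⟨by linarith, ?_⟩
    obtain ⟨C, hC0, hC⟩ := FourSpin.exists_wassersteinDist_gibbs_le (r := 3 / 4)
      (FourSpin.localExpansion_four hβ')
      (fun x hx hne _ => FourSpin.assoc_half β (1 / 2) ▸
        FourSpin.assoc_lt_of_le_one_twelfth hβ'.le hx hne) (by norm_num)
    refine ⟨C, fun n hn => ?_⟩
    -- The exponent of the limit law is the fourth Taylor coefficient of `A` at `1/2`, rescaled by
    -- `2⁻⁴`.
    have e : -(16 * (1 / 12 - β)) / 4 ^ 2 = 384 * (β - 1 / 12) / (2 ^ 4 * (Nat.factorial 4 : ℝ)) := by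
      norm_num [Nat.factorial]; ring
    rw [← e]
    refine (hC n hn).trans (ENNReal.ofReal_le_ofReal (mul_le_mul_of_nonneg_left ?_ hC0))
    exact FourSpin.inv_rpow_pow_le hn (by norm_num)
  · subst hh
    subst hβ'
    rw [FourSpin.iteratedDeriv_six_assoc_half]
    refine ⟨by norm_num, ?_⟩
    obtain ⟨C, hC0, hC⟩ := FourSpin.exists_wassersteinDist_gibbs_le (r := 5 / 6)
      FourSpin.localExpansion_six
      (fun x hx hne _ => FourSpin.assoc_half (1 / 12) (1 / 2) ▸
        FourSpin.assoc_lt_of_le_one_twelfth le_rfl hx hne) (by norm_num)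
    refine ⟨C, fun n hn => ?_⟩
    have e : -(64 / 30 : ℝ) / 4 ^ 3 = -1536 / (2 ^ 6 * (Nat.factorial 6 : ℝ)) := by
      norm_num [Nat.factorial]
    rw [← e]
    refine (hC n hn).trans (ENNReal.ofReal_le_ofReal (mul_le_mul_of_nonneg_left ?_ hC0))
    exact FourSpin.inv_rpow_pow_le hn (by norm_num)
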